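/- Let $q$ be a prime power, let $n\ge 1$ be odd, and put $r=(q^n+1)/(q+1)$. Let $k=\mathbb F_{q^{2n}}$, let $K$ be an algebraically closed field containing $k$, and let $X_n$ be the plane curve over $k$ with affine equation $y^{q^2}-y=z^r$. Let $F(S,T)\in K[S,T]$ be the polynomial with $F(X+Y,XY)=(X^{q-1}-1)(Y^{q-1}-1)$. Consider polynomials $w\in K[t]$ that satisfy $$t\,w\,F(t^r+w+w^q,\;w^{q+1})=(t^r-t)(t^{qr}-t).\qquad(\ast)$$ Let $$f=\sum_{1\le i<(n+1)/2}t^{(q^{2i-1}+1)/(q+1)},\qquad g=\sum_{0\le i<(n+1)/2}t^{(q^{2i}-1)/(q+1)}.$$ 1. The polynomial $w=fg$ satisfies $(\ast)$. 2. Let $P=(\beta,\gamma)\in K^2$ be any point of $X_n$, and put $(b,c)=(\beta^{q^n},\gamma^{q^n})$ and $\Phi(P)=(\beta^{q^{2n}},\gamma^{q^{2n}})$. For every $w\in K[t]$ satisfying $(\ast)$, the affine curve $(y^q-b)(y-b^q)-w(cz)=0$ intersects the affine curve $X_n$ in $P$ with multiplicity $q^n$ and in $\Phi(P)$ with multiplicity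 one, and in no other point of $K^2$ (if $\Phi(P)=P$, the intersection multiplicity at $P$ is $q^n+1$). 3. On the nonsingular projective model of $X_n$ over $K$ there is a unique point above each of $P$ and $\Phi(P)$ (denoted by the same letters), and $y$ and $z$ have a unique common pole $\infty$. The function $h=(y^q-b)(y-b^q)-f(cz)g(cz)$ has divisor $$(h)=q^n\,P+\Phi(P)-(q^n+1)\,\infty .$$ In particular, if $\beta,\gamma\in k$, then $(h)=(q^n+1)(P-\infty)$. 4. The curve $X_n$ is maximal over $k$: the number $N$ of $k$-rational points of its nonsingular projective model is $N=q^{2n}+1+2\,\mathfrak g\,q^n$, where $\mathfrak g$ is the genus of $X_n$. -/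

import Mathlib

open Polynomial
open scoped Polynomial.Bivariate

noncomputable section

/-! ## Places, divisors and the genus of a function field `F / k` -/

/-- A place of `F / k`: a valuation ring `O` of `F` with `k ⊆ O ⊊ F`. -/
structure Place (k F : Type*) [Field k] [Field F] [Algebra k F] where
  ring : ValuationSubring F
  algebraMap_mem : ∀ a : k, algebraMap k F a ∈ ring
  ring_ne_top : ring ≠ ⊤

namespace Place

variable {k F : Type*} [Field k] [Field F] [Algebra k F]

/-- The valuation ring of a place, as a `k`-algebra. -/
instance instAlgebraRing (P : Place k F) : Algebra k P.ring :=
  ((algebraMap k F).codRestrict P.ring.toSubring P.algebraMap_mem).toAlgebra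

/-- The degree of a place, `[O / m : k]`. -/
def degree (P : Place k F) : ℕ :=
  Module.finrank k (IsLocalRing.ResidueField P.ring)

/-- `f` lies in the maximal ideal of the valuation ring of `P`, that is, `f` vanishes at `P`. -/
def Vanishes (P : Place k F) (f : F) : Prop :=
  ∃ x ∈ IsLocalRing.maximalIdeal P.ring, (x : F) = f

/-- `f` has order `m` at `P`: it is a unit of the valuation ring times the `m`-th power of a
uniformizer. In particular `f ≠ 0`, and `m` is unique. -/
def HasOrder (P : Place k F) (f : F) (m : ℤ) : Prop :=
  ∃ (π : P.ring) (u : P.ringˣ), Irreducible π ∧ f = ((u : P.ring) : F) * (π : F) ^ m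

end Place

/-- Divisors of `F / k`. -/
abbrev PlaceDivisor (k F : Type*) [Field k] [Field F] [Algebra k F] : Type _ := Place k F →₀ ℤ

namespace PlaceDivisor

variable {k F : Type*} [Field k] [Field F] [Algebra k F]

/-- The degree of a divisor. -/
def degree (D : PlaceDivisor k F) : ℤ := D.sum fun P m => m * (P.degree : ℤ)

/-- The Riemann-Roch space `L(D)`, of all `f` with `f = 0` or `(f) + D ≥ 0`. The condition
`ord_P f + D(P) ≥ 0` is written as `f * π ^ D(P) ∈ O_P`, for the uniformizers `π` at `P`. -/
def riemannRochSpace (D : PlaceDivisor k F) : Submodule k F where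
  carrier := {f | ∀ (P : Place k F) (π : P.ring), Irreducible π → f * (π : F) ^ D P ∈ P.ring}
  zero_mem' := by
    intro P π _
    rw [zero_mul]
    exact P.ring.zero_mem
  add_mem' := by
    intro f g hf hg P π hπ
    rw [add_mul]
    exact P.ring.add_mem _ _ (hf P π hπ) (hg P π hπ)
  smul_mem' := by
    intro a f hf P π hπ
    rw [Algebra.smul_def, mul_assoc]
    exact P.ring.mul_mem _ _ (P.algebraMap_mem a) (hf P π hπ)

end PlaceDivisor

/-- The function `f` has divisor `D`. -/
def HasDivisor {k F : Type*} [Field k] [Field F] [Algebra k F] (f : F) (D : PlaceDivisor k F) :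
    Prop :=
  ∀ P : Place k F, P.HasOrder f (D P)

/-- `g` is the genus of `F / k`: the maximum of `deg D - ℓ(D) + 1` over all divisors `D`. -/
def HasGenus (k F : Type*) [Field k] [Field F] [Algebra k F] (g : ℕ) : Prop :=
  IsGreatest
    (Set.range fun D : PlaceDivisor k F =>
      D.degree - (Module.finrank k D.riemannRochSpace : ℤ) + 1) (g : ℤ)

/-- A curve over the finite field `k`, given by its function field `F`, is maximal if the number
`N` of rational points of its nonsingular projective model (the places of degree one) attains the
Hasse-Weil bound, `N = |k| + 1 + 2 g √|k|`. -/
def IsMaximalCurve (k F : Type*) [Field k] [Field F] [Algebra k F] : Prop :=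
  ∃ g : ℕ, HasGenus k F g ∧
    (Nat.card {P : Place k F // P.degree = 1} : ℝ) =
      (Nat.card k : ℝ) + 1 + 2 * (g : ℝ) * Real.sqrt (Nat.card k : ℝ)

/-! ## Intersection multiplicities in the affine plane -/

/-- The ideal of the point `Q` in `K[y, z]`, where `y` is the inner variable `C X` of `K[X][Y]` and
`z` is the outer variable `Y`. -/
def pointIdeal {K : Type*} [Field K] (Q : K × K) : Ideal K[X][Y] :=
  RingHom.ker (evalEvalRingHom Q.1 Q.2)

instance pointIdeal_isPrime {K : Type*} [Field K] (Q : K × K) : (pointIdeal Q).IsPrime :=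
  RingHom.ker_isPrime _

/-- The dimension over `K` of the local ring `R_p` modulo the two elements `G` and `H`. -/
def localMultiplicity (K : Type*) {R : Type*} [Field K] [CommRing R] [Algebra K R]
    (p : Ideal R) [p.IsPrime] (G H : R) : ℕ∞ :=
  Module.length K
    (Localization.AtPrime p ⧸
      Ideal.span {algebraMap R (Localization.AtPrime p) G,
        algebraMap R (Localization.AtPrime p) H})

/-- The intersection multiplicity at `Q` of the affine plane curves `G = 0` and `H = 0`:
the dimension over `K` of the local ring of the plane at `Q` modulo `G` and `H`. -/
def intersectionMultiplicity {K : Type*} [Field K] (G H : K[X][Y]) (Q : K × K) : ℕ∞ :=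
  localMultiplicity K (pointIdeal Q) G H

/-! ## The plane curve `y ^ (q ^ 2) - y = z ^ r` -/

namespace PlaneCurve

/-- `r = (q ^ n + 1) / (q + 1)`; the division is exact for odd `n`. -/
def r (q n : ℕ) : ℕ := (q ^ n + 1) / (q + 1)

/-- The equation `z ^ r - (y ^ (q ^ 2) - y)` of the curve, as a polynomial in `y = C X` and
`z = Y`. -/
def equation (k : Type*) [Field k] (q n : ℕ) : k[X][Y] :=
  X ^ r q n - C (X ^ q ^ 2 - X)

theorem r_pos (q n : ℕ) [hq : Fact (IsPrimePow q)] [hn : Fact (Odd n)] : 0 < r q n := by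
  have hq0 : 0 < q := hq.out.pos
  have hn0 : n ≠ 0 := by
    rintro rfl
    exact absurd hn.out (by decide)
  refine Nat.div_pos ?_ (Nat.succ_pos q)
  have := Nat.le_self_pow hn0 q
  omega

theorem irreducible_equation (k : Type*) [Field k] (q n : ℕ) [hq : Fact (IsPrimePow q)]
    [hn : Fact (Odd n)] : Irreducible (equation k q n) := by
  have hr : r q n ≠ 0 := (r_pos q n).ne'
  have hq1 : 1 < q := hq.out.one_lt
  have hq2 : 1 < q ^ 2 := Nat.one_lt_pow two_ne_zero hq1
  have hmonic : (equation k q n).Monic := monic_X_pow_sub_C _ hr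
  have hdeg : (equation k q n).natDegree = r q n := natDegree_X_pow_sub_C
  have hprime : (Ideal.span {(X : k[X])}).IsPrime :=
    (Ideal.span_singleton_prime X_ne_zero).2 prime_X
  refine IsEisensteinAt.irreducible (𝓟 := Ideal.span {(X : k[X])}) ⟨?_, ?_, ?_⟩ hprime
    hmonic.isPrimitive (by rw [hdeg]; exact Nat.pos_of_ne_zero hr)
  · rw [hmonic.leadingCoeff, ← Ideal.eq_top_iff_one]
    exact hprime.ne_top
  · intro m hm
    rw [hdeg] at hm
    rw [equation, coeff_sub, coeff_X_pow, if_neg hm.ne, zero_sub, coeff_C, neg_mem_iff]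
    split_ifs
    · exact Ideal.sub_mem _
        (Ideal.pow_mem_of_mem _ (Ideal.mem_span_singleton_self _) _ (by omega))
        (Ideal.mem_span_singleton_self _)
    · exact Ideal.zero_mem _
  · rw [equation, coeff_sub, coeff_X_pow, if_neg hr.symm, zero_sub, coeff_C_zero, neg_mem_iff,
      Ideal.span_singleton_pow, Ideal.mem_span_singleton, X_pow_dvd_iff]
    intro h
    have h1 := h 1 (by norm_num)
    rw [coeff_sub, coeff_X_pow, if_neg hq2.ne, coeff_X_one] at h1
    norm_num at h1

/-- The coordinate ring `k[y, z] / (y ^ (q ^ 2) - y - z ^ r)`. -/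
abbrev CoordRing (k : Type*) [Field k] (q n : ℕ) : Type _ := AdjoinRoot (equation k q n)

instance isDomain_coordRing (k : Type*) [Field k] (q n : ℕ) [Fact (IsPrimePow q)]
    [Fact (Odd n)] : IsDomain (CoordRing k q n) :=
  AdjoinRoot.isDomain_of_prime (irreducible_equation k q n).prime

/-- The function field of the curve. -/
abbrev FunField (k : Type*) [Field k] (q n : ℕ) [Fact (IsPrimePow q)] [Fact (Odd n)] : Type _ :=
  FractionRing (CoordRing k q n)

variable {k : Type*} [Field k] {q n : ℕ} [Fact (IsPrimePow q)] [Fact (Odd n)]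

/-- A polynomial in `y` and `z`, as a function on the curve. -/
def toFun (G : k[X][Y]) : FunField k q n :=
  algebraMap (CoordRing k q n) (FunField k q n) (AdjoinRoot.mk (equation k q n) G)

/-- The place `P` of the curve lies at the affine point `Q`: the functions `y` and `z` take at `P`
the values `Q.1` and `Q.2`. -/
def IsAt (P : Place k (FunField k q n)) (Q : k × k) : Prop :=
  P.Vanishes (toFun (C (X - C Q.1))) ∧ P.Vanishes (toFun (X - C (C Q.2)))

/-- The place `P` is a common pole of `y` and `z`. -/
def IsCommonPole (P : Place k (FunField k q n)) : Prop :=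
  (toFun (C X) : FunField k q n) ∉ P.ring ∧ (toFun X : FunField k q n) ∉ P.ring

end PlaneCurve

/-! ## The second curve -/

namespace PlaneCurve

/-- The symmetric polynomial `F(S, T)` with `F(X + Y, X * Y) = (X ^ (q - 1) - 1) * (Y ^ (q - 1) - 1)`,
evaluated in a `K`-algebra. See `symF_add_mul`. -/
def symF (K : Type*) [Field K] (q : ℕ) {A : Type*} [CommRing A] [Algebra K A] (S T : A) : A :=
  ∏ ζ ∈ nthRootsFinset (q - 1) (1 : K),
    (T - algebraMap K A ζ * S + algebraMap K A ζ ^ 2)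

theorem symF_add_mul (K : Type*) [Field K] [IsAlgClosed K] (q : ℕ) (hq : 1 < q)
    (hK : (q : K) = 0) {A : Type*} [CommRing A] [Algebra K A] (x y : A) :
    symF K q (x + y) (x * y) = (x ^ (q - 1) - 1) * (y ^ (q - 1) - 1) := by
  have hpos : 0 < q - 1 := by omega
  have hne : ((q - 1 : ℕ) : K) ≠ 0 := by
    rw [Nat.cast_sub hq.le, hK, Nat.cast_one, zero_sub]
    exact neg_ne_zero.2 one_ne_zero
  have : NeZero ((q - 1 : ℕ) : K) := ⟨hne⟩
  obtain ⟨ζ, hζ⟩ := HasEnoughRootsOfUnity.exists_primitiveRoot K (q - 1)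
  have key : ∀ x : A, x ^ (q - 1) - 1 =
      ∏ ζ ∈ nthRootsFinset (q - 1) (1 : K), (x - algebraMap K A ζ) := by
    intro x
    have h := congrArg (aeval x) (X_pow_sub_one_eq_prod hpos hζ)
    simpa [map_prod] using h
  rw [key, key, ← Finset.prod_mul_distrib]
  refine Finset.prod_congr rfl fun ζ _ => ?_
  ring

/-- `w ∈ K[t]` satisfies `t w F(t ^ r + w + w ^ q, w ^ (q + 1)) = (t ^ r - t) (t ^ (q r) - t)`. -/
def IsSolution {K : Type*} [Field K] (q n : ℕ) (w : K[X]) : Prop :=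
  X * w * symF K q (X ^ r q n + w + w ^ q) (w ^ (q + 1)) =
    (X ^ r q n - X) * (X ^ (q * r q n) - X)

/-- `f`: the sum of the `t ^ ((q ^ (2 i - 1) + 1) / (q + 1))` for `i ≥ 1` with `2 i - 1 < n`, which
are those of degree less than `r = (q ^ n + 1) / (q + 1)`. -/
def f (K : Type*) [Field K] (q n : ℕ) : K[X] :=
  ∑ i ∈ Finset.Ico 1 ((n + 1) / 2), X ^ ((q ^ (2 * i - 1) + 1) / (q + 1))

/-- `g`: the sum of the `t ^ ((q ^ (2 i) - 1) / (q + 1))` for `i ≥ 0` with `2 i < n + 1`, which are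
those of degree less than `q r - 1 = (q ^ (n + 1) - 1) / (q + 1)`. -/
def g (K : Type*) [Field K] (q n : ℕ) : K[X] :=
  ∑ i ∈ Finset.range ((n + 1) / 2), X ^ ((q ^ (2 * i) - 1) / (q + 1))

/-- The polynomial `(y ^ q - b) (y - b ^ q) - w(c z)` in `y = C X` and `z = Y`. -/
def secondCurve {K : Type*} [Field K] (q : ℕ) (b c : K) (w : K[X]) : K[X][Y] :=
  C ((X ^ q - C b) * (X - C (b ^ q))) - aeval (C (C c) * X : K[X][Y]) w

end PlaneCurve

end

/-!
Write `Q = q ^ n` and `w = f g`. Everything rests on two polynomials `U = -∑ t ^ (r q ^ (2 i - 1))`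
and `V = -∑ t ^ (r q ^ (2 i))` (`factorU`, `factorV`). They satisfy `w(t ^ (Q + 1)) = U V`,
`U ^ q - V = t ^ r` and `U - V ^ q = t ^ (r Q)`, and on the curve the sums telescope to
`U(z) = y ^ q - y ^ Q` and `V(z) = y - y ^ (q Q)`. Hence
`w(z ^ (Q + 1)) = (y ^ q - y ^ Q) (y - y ^ (q Q))` on the curve (`aeval_f_mul_g`).

*The functional equation.* With `S = u ^ (q + 1) + v ^ (q + 1)` and `T = (u v) ^ (q + 1)` the
symmetric polynomial factors, and `u v F(S, T) = (u ^ (q ^ 2) - u) (v ^ (q ^ 2) - v)`. Pulled back to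
`t ^ (Q + 1)`, the functional equation is an equation of degree `q ^ 2` for `w`, with the `q ^ 2`
distinct roots `(U + ε ^ q) (V + ε)` for `ε ^ (q ^ 2) = ε`. Only `ε = 0` gives a polynomial in
`t ^ (Q + 1)`. So `f g` is a solution, and it is the only one (`IsSolution.eq_f_mul_g`).

*Places.* As a polynomial in `y` over `k[z]` the equation has derivative `-1`, so the coordinate ring
is a Dedekind domain, and the places at which `y` is integral are its maximal ideals. At a pole of
`y`, the equation forces `y` and `z` to have pole orders proportional to `r` and `q ^ 2`; the
monomials `y ^ a z ^ b` with `b < r` are a basis of the coordinate ring with distinct pole orders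
`r a + q ^ 2 b`, so the valuation is determined, and there is one place at infinity. Counting
monomials gives the dimension of the space of functions with bounded pole order, and from it Riemann's
inequality and the genus `(q ^ 2 - 1) (r - 1) / 2` (`hasGenus_genus`). The same count shows that a
function in the coordinate ring has at most as many zeros as its pole order (`sum_le_wdeg`).

*The divisor of `h`.* Replacing `b` by `y ^ Q - (y - β) ^ Q` and `c` by `z ^ Q - (z - γ) ^ Q` in `h`
and using the identity for `w(z ^ (Q + 1))` shows that `h` vanishes to order `Q` at `P`. The identity
at the point `(b, c)` shows that `h` vanishes at `Φ(P)`. If `Φ(P) = P`, then the derivative of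
`w(t ^ (Q + 1)) = U V` provides the additional zero. The pole order of `h` at infinity is `Q + 1`,
so there are no other zeros (`valuation_mk_secondCurve`). The local ring of the plane at a point of
the curve, modulo both equations, is the coordinate ring modulo a power of the maximal ideal, which
turns orders into intersection multiplicities.

*Rational points.* By the additive Hilbert 90, an element of `k` is the `z`-coordinate of `q ^ 2` or of
no rational points, according to whether the trace of `z ^ r` to the field with `q ^ 2` elements
vanishes. The `r`-th powers form the union of the spaces `x ^ Q = δ x` for `δ ^ (q + 1) = 1`, and on
each of them the trace has a kernel with `Q / q` elements (`natCard_traceHom_eq_zero`).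
-/

section

open WithZero IsDedekindDomain

namespace PlaneCurve

/-! ### Frobenius powers and the exponents -/

section Frobenius

variable {q : ℕ} [hq : Fact (IsPrimePow q)]

theorem exists_charP_of_natCast_eq_zero {K : Type*} [Field K] (hK : (q : K) = 0) :
    ∃ p m : ℕ, p.Prime ∧ CharP K p ∧ q = p ^ m := by
  obtain ⟨p, m, hp, hm, rfl⟩ := hq.out
  have hp' := hp.nat_prime
  have hp0 : (p : K) = 0 := by
    rw [Nat.cast_pow] at hK
    exact pow_eq_zero_iff hm.ne' |>.1 hK
  have := Fact.mk hp'
  exact ⟨p, m, hp', (CharP.charP_iff_prime_eq_zero hp').2 hp0, rfl⟩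

/-- Raising to the power `q ^ e` is a ring endomorphism in characteristic `p ∣ q`. -/
theorem exists_ringHom_pow {K : Type*} [Field K] (hK : (q : K) = 0) (A : Type*) [CommRing A]
    [Nontrivial A] [Algebra K A] (e : ℕ) : ∃ φ : A →+* A, ∀ x, φ x = x ^ q ^ e := by
  obtain ⟨p, m, hp, hc, rfl⟩ := exists_charP_of_natCast_eq_zero (q := q) hK
  have := Fact.mk hp
  have : CharP A p := charP_of_injective_algebraMap (algebraMap K A).injective p
  exact ⟨iterateFrobenius A p (m * e), fun x => by rw [iterateFrobenius_def, pow_mul]⟩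

theorem one_lt_q : 1 < q := hq.out.one_lt

end Frobenius

theorem succ_dvd_pow_odd_add_one (q i : ℕ) (hi : 1 ≤ i) : q + 1 ∣ q ^ (2 * i - 1) + 1 := by
  have : Odd (2 * i - 1) := ⟨i - 1, by omega⟩
  simpa using this.nat_add_dvd_pow_add_pow q 1

theorem succ_dvd_pow_even_sub_one (q i : ℕ) : q + 1 ∣ q ^ (2 * i) - 1 := by
  have h1 : q + 1 ∣ q ^ 2 - 1 := by
    have := Nat.sq_sub_sq q 1
    rw [one_pow] at this
    exact this ▸ Dvd.intro _ rfl
  have h2 := Nat.sub_dvd_pow_sub_pow (q ^ 2) 1 i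
  rw [one_pow, ← pow_mul] at h2
  exact h1.trans h2

section Exponents

variable (q n : ℕ) [hn : Fact (Odd n)]

theorem r_mul_succ : r q n * (q + 1) = q ^ n + 1 := by
  refine Nat.div_mul_cancel ?_
  simpa using hn.out.nat_add_dvd_pow_add_pow q 1

end Exponents

/-! ### The two factors of the solution -/

section Factors

variable (K : Type*) [Field K] (q n : ℕ)

/-- The polynomial `U` with `U(z) = y ^ q - y ^ (q ^ n)` on the curve. -/
noncomputable def factorU : K[X] :=
  -∑ i ∈ Finset.Ico 1 ((n + 1) / 2), X ^ (r q n * q ^ (2 * i - 1))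

/-- The polynomial `V` with `V(z) = y - y ^ (q ^ (n + 1))` on the curve. -/
noncomputable def factorV : K[X] :=
  -∑ i ∈ Finset.range ((n + 1) / 2), X ^ (r q n * q ^ (2 * i))

variable [hq : Fact (IsPrimePow q)] [hn : Fact (Odd n)]

/-- `f(t) g(t) = U(z) V(z)` for `t = z ^ (q ^ n + 1)`. -/
theorem expand_f_mul_g : expand K (q ^ n + 1) (f K q n * g K q n) =
    factorU K q n * factorV K q n := by
  have hf : expand K (q ^ n + 1) (f K q n) = - X ^ r q n * factorU K q n := by
    rw [f, factorU, map_sum, neg_mul_neg, Finset.mul_sum]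
    refine Finset.sum_congr rfl fun i hi => ?_
    obtain ⟨d, hd⟩ := succ_dvd_pow_odd_add_one q i (Finset.mem_Ico.1 hi).1
    rw [map_pow, expand_X, ← pow_mul, ← pow_add, hd, Nat.mul_div_cancel_left _ q.succ_pos]
    congr 1
    have : r q n + r q n * q ^ (2 * i - 1) = r q n * (q ^ (2 * i - 1) + 1) := by ring
    rw [this, hd, ← r_mul_succ q n]
    ring
  have hg : X ^ r q n * expand K (q ^ n + 1) (g K q n) = - factorV K q n := by
    rw [g, factorV, map_sum, neg_neg, Finset.mul_sum]
    refine Finset.sum_congr rfl fun i _ => ?_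
    obtain ⟨d, hd⟩ := succ_dvd_pow_even_sub_one q i
    rw [map_pow, expand_X, ← pow_mul, ← pow_add, hd, Nat.mul_div_cancel_left _ q.succ_pos]
    congr 1
    have h1 : 1 ≤ q ^ (2 * i) := Nat.one_le_pow _ _ hq.out.pos
    have h2 : q ^ (2 * i) = (q + 1) * d + 1 := by omega
    rw [h2, ← r_mul_succ q n]
    ring
  have hX : (X ^ r q n : K[X]) ≠ 0 := pow_ne_zero _ X_ne_zero
  apply mul_left_cancel₀ hX
  rw [map_mul, hf]
  linear_combination (-X ^ r q n * factorU K q n) * hg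

variable {K} {A : Type*} [CommRing A] [Algebra K A]

variable {q} in
/-- The telescoping sums `y ^ (q ^ (2 i + 2)) - y ^ (q ^ (2 i)) = z ^ (r q ^ (2 i))`. -/
theorem aeval_factorV [Nontrivial A] (hK : (q : K) = 0) {y z : A} (h : y ^ q ^ 2 - y = z ^ r q n) :
    aeval z (factorV K q n) = y - y ^ q ^ (n + 1) := by
  obtain ⟨m, rfl⟩ := hn.out
  have : (2 * m + 1 + 1) / 2 = m + 1 := by omega
  rw [factorV, this, map_neg, map_sum, ← neg_sub, neg_inj]
  have key : ∀ i, y ^ q ^ (2 * (i + 1)) - y ^ q ^ (2 * i) = z ^ (r q (2 * m + 1) * q ^ (2 * i)) := by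
    intro i
    obtain ⟨φ, hφ⟩ := exists_ringHom_pow hK A (2 * i)
    rw [pow_mul z, ← h, ← hφ (_ - _), map_sub, hφ, hφ, ← pow_mul, ← pow_add]
    congr 3
    ring
  have := Finset.sum_range_sub (fun i => y ^ q ^ (2 * i)) (m + 1)
  simp only [key] at this
  simpa [mul_add, add_assoc] using this

variable {q} in
/-- A telescoping sum: `z ^ (r q ^ j) = y ^ q ^ (j + 2) - y ^ q ^ j` on the curve. -/
theorem aeval_factorU [Nontrivial A] (hK : (q : K) = 0) {y z : A} (h : y ^ q ^ 2 - y = z ^ r q n) :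
    aeval z (factorU K q n) = y ^ q - y ^ q ^ n := by
  obtain ⟨m, rfl⟩ := hn.out
  have : (2 * m + 1 + 1) / 2 = m + 1 := by omega
  rw [factorU, this, map_neg, map_sum, ← neg_sub, neg_inj, Finset.sum_Ico_eq_sum_range]
  have key : ∀ i, y ^ q ^ (2 * (i + 1) + 1) - y ^ q ^ (2 * i + 1) =
      z ^ (r q (2 * m + 1) * q ^ (2 * i + 1)) := by
    intro i
    obtain ⟨φ, hφ⟩ := exists_ringHom_pow hK A (2 * i + 1)
    rw [pow_mul z, ← h, ← hφ (_ - _), map_sub, hφ, hφ, ← pow_mul, ← pow_add]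
    congr 3
    ring
  have := Finset.sum_range_sub (fun i => y ^ q ^ (2 * i + 1)) m
  simp only [key] at this
  rw [mul_zero, zero_add, pow_one] at this
  rw [← this]
  simp only [map_pow, aeval_X]
  refine Finset.sum_congr (by simp) fun i _ => ?_
  congr 3
  omega

variable {q} in
/-- The identity satisfied by `w = f g` along the graph of the `q ^ n`-Frobenius of the curve. -/
theorem aeval_f_mul_g [Nontrivial A] (hK : (q : K) = 0) {y z : A}
    (h : y ^ q ^ 2 - y = z ^ r q n) :
    aeval (z ^ (q ^ n + 1)) (f K q n * g K q n) = (y ^ q - y ^ q ^ n) * (y - y ^ q ^ (n + 1)) := by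
  rw [← expand_aeval, expand_f_mul_g, map_mul, aeval_factorU n hK h, aeval_factorV n hK h]

variable {q} in
theorem factorU_pow_sub (hK : (q : K) = 0) :
    factorU K q n ^ q - factorV K q n = X ^ r q n := by
  obtain ⟨m, rfl⟩ := hn.out
  have : (2 * m + 1 + 1) / 2 = m + 1 := by omega
  obtain ⟨φ, hφ⟩ := exists_ringHom_pow hK K[X] 1
  simp only [pow_one] at hφ
  rw [← hφ, factorU, factorV, this, map_neg, map_sum, Finset.sum_Ico_eq_sum_range,
    Finset.sum_range_succ']
  simp only [hφ, ← pow_mul]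
  have : ∀ i, r q (2 * m + 1) * q ^ (2 * (1 + i) - 1) * q = r q (2 * m + 1) * q ^ (2 * (i + 1)) := by
    intro i
    rw [mul_assoc, ← pow_succ]
    congr 2
    omega
  simp [this]

variable {q} in
theorem factorU_sub_pow (hK : (q : K) = 0) :
    factorU K q n - factorV K q n ^ q = X ^ (r q n * q ^ n) := by
  obtain ⟨m, rfl⟩ := hn.out
  have : (2 * m + 1 + 1) / 2 = m + 1 := by omega
  obtain ⟨φ, hφ⟩ := exists_ringHom_pow hK K[X] 1
  simp only [pow_one] at hφ
  rw [← hφ, factorU, factorV, this, map_neg, map_sum, Finset.sum_Ico_eq_sum_range,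
    Finset.sum_range_succ]
  simp only [hφ, ← pow_mul]
  have : ∀ i, r q (2 * m + 1) * q ^ (2 * i) * q = r q (2 * m + 1) * q ^ (2 * i + 1) := by
    intro i
    rw [mul_assoc, ← pow_succ]
  have h2 : ∀ i, 2 * (1 + i) - 1 = 2 * i + 1 := by omega
  simp [this, h2]

theorem coeff_factorU_r : (factorU K q n).coeff (r q n) = 0 := by
  rw [factorU, coeff_neg, finsetSum_coeff, neg_eq_zero]
  refine Finset.sum_eq_zero fun i hi => ?_
  rw [coeff_X_pow, if_neg]
  have h0 := r_pos q n
  have := Nat.one_lt_pow (n := 2 * i - 1) (by have := (Finset.mem_Ico.1 hi).1; omega)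
    (one_lt_q (q := q))
  nlinarith

theorem coeff_factorV_r : (factorV K q n).coeff (r q n) = -1 := by
  obtain ⟨m, hm⟩ := hn.out
  have : (n + 1) / 2 = m + 1 := by omega
  rw [factorV, coeff_neg, finsetSum_coeff, neg_inj, this, Finset.sum_range_succ',
    Finset.sum_eq_zero, zero_add, mul_zero, pow_zero, mul_one, coeff_X_pow_self]
  intro i hi
  rw [coeff_X_pow, if_neg]
  have h0 := r_pos q n
  have := Nat.one_lt_pow (n := 2 * (i + 1)) (by omega) (one_lt_q (q := q))
  nlinarith

end Factors

/-! ### Solutions of the functional equation -/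

section Solutions

theorem map_symF {K : Type*} [Field K] (q : ℕ) {A B : Type*} [CommRing A] [CommRing B]
    [Algebra K A] [Algebra K B] (φ : A →ₐ[K] B) (S T : A) :
    φ (symF K q S T) = symF K q (φ S) (φ T) := by
  simp [symF, map_prod]

variable {K : Type*} [Field K] [IsAlgClosed K] (q n : ℕ) [hq : Fact (IsPrimePow q)]
  [hn : Fact (Odd n)]

variable {q} in
/-- The first argument of `symF` equals `u ^ (q + 1) + v ^ (q + 1)`, so that the left-hand side of
the functional equation factors for `w = u v` whenever `t ^ r = (u ^ q - v) (u - v ^ q)`. -/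
theorem mul_symF_eq (hK : (q : K) = 0) {A : Type*} [CommRing A] [Nontrivial A] [Algebra K A]
    (u v : A) :
    u * v * symF K q ((u ^ q - v) * (u - v ^ q) + u * v + (u * v) ^ q) ((u * v) ^ (q + 1)) =
      (u ^ q ^ 2 - u) * (v ^ q ^ 2 - v) := by
  have h1 : (u ^ q - v) * (u - v ^ q) + u * v + (u * v) ^ q = u ^ (q + 1) + v ^ (q + 1) := by ring
  have h2 : q ^ 2 = (q + 1) * (q - 1) + 1 := by
    have := one_lt_q (q := q)
    obtain ⟨s, rfl⟩ : ∃ s, q = s + 1 := ⟨q - 1, by omega⟩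
    simp; ring
  rw [h1, mul_pow, symF_add_mul K q one_lt_q hK, h2, pow_succ u (_ * _), pow_succ v (_ * _),
    ← pow_mul, ← pow_mul]
  ring

variable {q} in
/-- The `q ^ 2` translates `(U + ε ^ q) (V + ε)` of `U V` satisfy the functional equation pulled
back to `t = X ^ (q ^ n + 1)`. -/
theorem translate_mul_symF_eq (hK : (q : K) = 0) {ε : K} (hε : ε ^ q ^ 2 = ε) :
    let W : K[X] := (factorU K q n + C (ε ^ q)) * (factorV K q n + C ε)
    W * symF K q (X ^ (r q n * (q ^ n + 1)) + W + W ^ q) (W ^ (q + 1)) =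
      (X ^ (r q n * q) - X ^ (r q n * q ^ n)) *
        (X ^ r q n - X ^ (r q n * q ^ (n + 1))) := by
  intro W
  obtain ⟨φ, hφ⟩ := exists_ringHom_pow hK K[X] 1
  simp only [pow_one] at hφ
  set u := factorU K q n + C (ε ^ q) with hu
  set v := factorV K q n + C ε with hv
  have hε' : (C (ε ^ q) : K[X]) ^ q = C ε := by rw [← C_pow, ← pow_mul, ← sq, hε]
  have h1 : u ^ q - v = X ^ r q n := by
    rw [← factorU_pow_sub n hK, ← hφ, hu, map_add, hφ, hφ, hε', hv]; ring
  have h2 : u - v ^ q = X ^ (r q n * q ^ n) := by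
    rw [← factorU_sub_pow n hK, ← hφ, ← hφ, hv, map_add, hφ (C ε), ← C_pow]; ring
  have h3 : u ^ q ^ 2 - u = X ^ (r q n * q) - X ^ (r q n * q ^ n) := by
    rw [pow_mul, ← h1, ← h2, ← hφ (_ - _), map_sub, hφ, hφ, ← pow_mul, sq]; ring
  have h4 : v ^ q ^ 2 - v = X ^ r q n - X ^ (r q n * q ^ (n + 1)) := by
    rw [pow_succ q n, ← mul_assoc, pow_mul _ (_ * _), ← h1, ← h2, ← hφ (_ - _), map_sub, hφ, hφ,
      ← pow_mul, sq]; ring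
  have h5 := mul_symF_eq hK u v
  rw [h1, h2, h3, h4, ← pow_add] at h5
  rw [← h5, mul_add, mul_one, add_comm (r q n) (r q n * q ^ n)]

variable {q n}

omit [IsAlgClosed K] hq in
/-- The functional equation, pulled back to `t = X ^ (q ^ n + 1)`. -/
theorem isSolution_iff {w : K[X]} : IsSolution q n w ↔
    let W := expand K (q ^ n + 1) w
    W * symF K q (X ^ (r q n * (q ^ n + 1)) + W + W ^ q) (W ^ (q + 1)) =
      (X ^ (r q n * q) - X ^ (r q n * q ^ n)) *
        (X ^ r q n - X ^ (r q n * q ^ (n + 1))) := by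
  have hX : (X ^ (q ^ n + 1) : K[X]) ≠ 0 := pow_ne_zero _ X_ne_zero
  rw [IsSolution, ← (expand_injective (R := K) (show 0 < q ^ n + 1 by omega)).eq_iff]
  simp only [map_mul, map_symF, map_add, map_pow, map_sub, expand_X]
  rw [mul_assoc, ← pow_mul, mul_comm (q ^ n + 1) (r q n), ← pow_mul]
  have h1 : (X ^ (q ^ n + 1) : K[X]) = X ^ r q n * X ^ (r q n * q) := by
    rw [← r_mul_succ q n, ← pow_add]; congr 1; ring
  have h2 : (X ^ (r q n * (q ^ n + 1)) : K[X]) = X ^ (r q n * q ^ n) * X ^ r q n := by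
    rw [← pow_add]; congr 1
  have h3 : (X ^ ((q ^ n + 1) * (q * r q n)) : K[X]) =
      X ^ (r q n * q ^ (n + 1)) * X ^ (r q n * q) := by
    rw [← pow_add]; congr 1; ring
  have h4 : (X ^ (r q n * (q ^ n + 1)) - X ^ (q ^ n + 1) : K[X]) *
      (X ^ ((q ^ n + 1) * (q * r q n)) - X ^ (q ^ n + 1)) = X ^ (q ^ n + 1) *
      ((X ^ (r q n * q) - X ^ (r q n * q ^ n)) *
        (X ^ r q n - X ^ (r q n * q ^ (n + 1)))) := by
    rw [h1, h2, h3]; ring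
  rw [h4]
  exact (mul_right_injective₀ hX).eq_iff

/-- The product `f g` satisfies the functional equation, since `U V` satisfies its pullback. -/
theorem isSolution_f_mul_g (hK : (q : K) = 0) : IsSolution q n (f K q n * g K q n) := by
  have h := translate_mul_symF_eq n hK (ε := 0) (zero_pow (pow_ne_zero 2 hq.out.ne_zero))
  simp only [ne_eq, hq.out.ne_zero, not_false_eq_true, zero_pow, C_0, add_zero] at h
  rw [← expand_f_mul_g K q n] at h
  exact isSolution_iff.2 h

/-- The polynomial whose roots in `K[X]` are the pullbacks of solutions and the translates of
`U V`. -/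
noncomputable def translatePoly (K : Type*) [Field K] (q n : ℕ) : K[X][X] :=
  X * ∏ ζ ∈ nthRootsFinset (q - 1) (1 : K),
    (X ^ (q + 1) - C (C ζ) * (C (X ^ (r q n * (q ^ n + 1))) + X + X ^ q) + C (C ζ) ^ 2) -
  C ((X ^ (r q n * q) - X ^ (r q n * q ^ n)) * (X ^ r q n - X ^ (r q n * q ^ (n + 1))))

omit [IsAlgClosed K] hq hn in
theorem eval_translatePoly (W : K[X]) : (translatePoly K q n).eval W =
    W * symF K q (X ^ (r q n * (q ^ n + 1)) + W + W ^ q) (W ^ (q + 1)) -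
      (X ^ (r q n * q) - X ^ (r q n * q ^ n)) * (X ^ r q n - X ^ (r q n * q ^ (n + 1))) := by
  simp [translatePoly, symF, eval_prod]

omit [IsAlgClosed K] hn in
/-- Each of the at most `q - 1` quadratic factors of `symF` contributes the degree `q + 1` in `W`,
and the factor `W` in front contributes one more. -/
theorem translatePoly_ne_zero_and_natDegree_le :
    translatePoly K q n ≠ 0 ∧ (translatePoly K q n).natDegree ≤ q ^ 2 := by
  have hq1 := one_lt_q (q := q)
  have hlin : ∀ ζ : K, (- (C (C ζ) * (C (X ^ (r q n * (q ^ n + 1))) + X + X ^ q)) +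
      C (C ζ) ^ 2 : K[X][X]).natDegree < q + 1 := by
    intro ζ
    refine Nat.lt_succ_of_le ?_
    compute_degree
    simp only [max_le_iff]
    omega
  have hfac : ∀ ζ ∈ nthRootsFinset (q - 1) (1 : K),
      (X ^ (q + 1) - C (C ζ) * (C (X ^ (r q n * (q ^ n + 1))) + X + X ^ q) +
        C (C ζ) ^ 2 : K[X][X]).Monic := by
    intro ζ _
    rw [sub_eq_add_neg, add_assoc]
    exact monic_X_pow_add (degree_le_natDegree.trans_lt (by exact_mod_cast hlin ζ))
  have hfac' : ∀ ζ ∈ nthRootsFinset (q - 1) (1 : K),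
      (X ^ (q + 1) - C (C ζ) * (C (X ^ (r q n * (q ^ n + 1))) + X + X ^ q) +
        C (C ζ) ^ 2 : K[X][X]).natDegree = q + 1 := by
    intro ζ _
    rw [sub_eq_add_neg, add_assoc, natDegree_add_eq_left_of_natDegree_lt, natDegree_X_pow]
    rw [natDegree_X_pow]
    exact hlin ζ
  have hmon := monic_prod_of_monic _ _ hfac
  have hmon' := monic_X.mul hmon
  have hdeg := monic_X.natDegree_mul hmon
  rw [natDegree_prod_of_monic _ _ hfac, Finset.sum_congr rfl hfac', Finset.sum_const,
    smul_eq_mul, natDegree_X] at hdeg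
  have hcard : (nthRootsFinset (q - 1) (1 : K)).card ≤ q - 1 := by
    classical
    rw [nthRootsFinset_def]
    exact (Multiset.toFinset_card_le _).trans (card_nthRoots _ _)
  rw [translatePoly]
  constructor
  · intro h
    have := congrArg natDegree h
    rw [natDegree_sub_C, hdeg, natDegree_zero] at this
    omega
  · rw [natDegree_sub_C, hdeg]
    obtain ⟨s, rfl⟩ : ∃ s, q = s + 1 := ⟨q - 1, by omega⟩
    rw [Nat.add_sub_cancel] at hcard ⊢
    nlinarith

/-- The solution is unique: the pullback of a solution is one of the `q ^ 2` translates
`(U + ε ^ q) (V + ε)`, as these are all the roots of a polynomial of degree `q ^ 2`; being a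
polynomial in `X ^ (q ^ n + 1)`, it has no term in `X ^ r`, hence `ε = 0`. -/
theorem IsSolution.eq_f_mul_g (hK : (q : K) = 0) {w : K[X]} (hw : IsSolution q n w) :
    w = f K q n * g K q n := by
  classical
  obtain ⟨hne, hdeg⟩ := translatePoly_ne_zero_and_natDegree_le (K := K) (q := q) (n := n)
  have hr0 := r_pos q n
  have hq1 := one_lt_q (q := q)
  set S : Finset K := (X ^ q ^ 2 - X : K[X]).roots.toFinset with hS
  have hsep : (X ^ q ^ 2 - X : K[X]).Separable := by
    rw [separable_def]
    have hK' : (q : K[X]) = 0 := by rw [← C_eq_natCast, hK, C_0]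
    refine ⟨0, -1, ?_⟩
    simp [derivative_X_pow, hK']
  have hdegS : (X ^ q ^ 2 - X : K[X]).natDegree = q ^ 2 :=
    FiniteField.X_pow_card_sub_X_natDegree_eq K (Nat.one_lt_pow two_ne_zero hq1)
  have hSne : (X ^ q ^ 2 - X : K[X]) ≠ 0 := by
    intro h; rw [h, natDegree_zero] at hdegS; exact pow_ne_zero 2 hq.out.ne_zero hdegS.symm
  have hScard : S.card = q ^ 2 := by
    rw [hS, Multiset.toFinset_card_of_nodup (nodup_roots hsep),
      ← (IsAlgClosed.splits _).natDegree_eq_card_roots, hdegS]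
  have hSmem : ∀ ε ∈ S, ε ^ q ^ 2 = ε := by
    intro ε hε
    rw [hS, Multiset.mem_toFinset, mem_roots hSne, IsRoot.def] at hε
    simpa [sub_eq_zero] using hε
  let ω : K → K[X] := fun ε => (factorU K q n + C (ε ^ q)) * (factorV K q n + C ε)
  -- The coefficient at `X ^ r` recovers `ε ^ q`.
  have hUV : ∀ v : K[X], (expand K (q ^ n + 1) v).coeff (r q n) = 0 := by
    intro v
    rw [coeff_expand (Nat.succ_pos _), if_neg]
    intro h
    have h1 := Nat.le_of_dvd hr0 h
    have h2 := r_mul_succ q n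
    nlinarith
  have hcoeff : ∀ ε, (ω ε).coeff (r q n) = -ε ^ q := by
    intro ε
    have : ω ε = expand K (q ^ n + 1) (f K q n * g K q n) + factorU K q n * C ε +
        C (ε ^ q) * factorV K q n + C (ε ^ q * ε) := by
      rw [expand_f_mul_g, C_mul]; ring
    rw [this, coeff_add, coeff_add, coeff_add, hUV, coeff_mul_C, coeff_C_mul, coeff_factorU_r,
      coeff_factorV_r, coeff_C, if_neg hr0.ne']
    ring
  have hinj : Set.InjOn ω S := by
    intro a ha b hb hab
    have h1 := congrArg (fun v => -coeff v (r q n)) hab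
    simp only [hcoeff, neg_neg] at h1
    rw [← hSmem a ha, ← hSmem b hb, sq, pow_mul, pow_mul, h1]
  have hroot : ∀ ε ∈ S, ω ε ∈ (translatePoly K q n).roots.toFinset := by
    intro ε hε
    rw [Multiset.mem_toFinset, mem_roots hne, IsRoot.def, eval_translatePoly, sub_eq_zero]
    exact translate_mul_symF_eq n hK (hSmem ε hε)
  have himage : S.image ω = (translatePoly K q n).roots.toFinset := by
    refine Finset.eq_of_subset_of_card_le (Finset.image_subset_iff.2 hroot) ?_
    rw [Finset.card_image_of_injOn hinj, hScard]
    exact (Multiset.toFinset_card_le _).trans ((card_roots' _).trans hdeg)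
  have hW : expand K (q ^ n + 1) w ∈ S.image ω := by
    rw [himage, Multiset.mem_toFinset, mem_roots hne, IsRoot.def, eval_translatePoly, sub_eq_zero]
    exact isSolution_iff.1 hw
  obtain ⟨ε, -, hε⟩ := Finset.mem_image.1 hW
  have h0 := hcoeff ε
  rw [hε, hUV, zero_eq_neg, pow_eq_zero_iff hq.out.ne_zero] at h0
  refine expand_injective (Nat.succ_pos (q ^ n)) ?_
  rw [← hε, expand_f_mul_g]
  simp [ω, h0, hq.out.ne_zero]

end Solutions

end PlaneCurve

/-! ### The coordinate ring is a Dedekind domain -/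

section Dedekind

/-- A monogenic extension of a Dedekind domain `A` by an irreducible monic polynomial whose
derivative is the unit `-1` is a Dedekind domain: the discriminant of its power basis is a unit, so
it contains every element of its fraction field that is integral over `A`. -/
theorem isDedekindDomain_of_equiv_adjoinRoot {A C : Type*} [CommRing A] [IsDedekindDomain A]
    [CommRing C] [IsDomain C] {p : A[X]} (hm : p.Monic) (hi : Irreducible p)
    (hd : derivative p = -1) (e : C ≃+* AdjoinRoot p) : IsDedekindDomain C := by
  let K := FractionRing A
  set pK : K[X] := p.map (algebraMap A K) with hpK
  have hiK : Irreducible pK := (hm.irreducible_iff_irreducible_map_fraction_map).1 hi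
  have hmK : pK.Monic := hm.map _
  have hdK : derivative pK = -1 := by rw [hpK, derivative_map, hd]; simp
  have hsep : pK.Separable := by
    rw [separable_def, hdK]
    exact ⟨0, -1, by ring⟩
  have := Fact.mk hiK
  let L := AdjoinRoot pK
  have hroot : aeval (AdjoinRoot.root pK) p = 0 := by
    have := AdjoinRoot.eval₂_root pK
    rwa [hpK, eval₂_map] at this
  let φ : AdjoinRoot p →ₐ[A] L := AdjoinRoot.liftAlgHom p (Algebra.ofId A L) (AdjoinRoot.root pK)
    hroot
  have hφ : ∀ f, φ (AdjoinRoot.mk p f) = AdjoinRoot.mk pK (f.map (algebraMap A K)) := by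
    intro f
    rw [← AdjoinRoot.aeval_eq (f.map _), aeval_map_algebraMap]
    rfl
  have hφinj : Function.Injective φ := by
    rw [injective_iff_map_eq_zero]
    intro x
    obtain ⟨f, rfl⟩ := AdjoinRoot.mk_surjective x
    rw [hφ, AdjoinRoot.mk_eq_zero, AdjoinRoot.mk_eq_zero]
    exact (map_dvd_map _ (IsFractionRing.injective A K) hm).1
  let : Algebra A C := (e.symm.toRingHom.comp (algebraMap A (AdjoinRoot p))).toAlgebra
  let : Algebra C L := (φ.toRingHom.comp e.toRingHom).toAlgebra
  have hCL : ∀ c : C, algebraMap C L c = φ (e c) := fun _ => rfl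
  have hAC : ∀ a : A, algebraMap A C a = e.symm (algebraMap A (AdjoinRoot p) a) := fun _ => rfl
  have : IsScalarTower A C L := IsScalarTower.of_algebraMap_eq fun a => by
    rw [hCL, hAC, RingEquiv.apply_symm_apply, AlgHom.commutes]
  have : FiniteDimensional K L := (AdjoinRoot.powerBasis hiK.ne_zero).finite
  have hmin : minpoly K (AdjoinRoot.root pK) = pK := by
    rw [AdjoinRoot.minpoly_root hiK.ne_zero, hmK.leadingCoeff, inv_one, C_1, mul_one]
  have : Algebra.IsSeparable K L := by
    refine ⟨fun x => ?_⟩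
    have hx : x ∈ Algebra.adjoin K {AdjoinRoot.root pK} := by
      rw [AdjoinRoot.adjoinRoot_eq_top]; trivial
    have hle : Algebra.adjoin K {AdjoinRoot.root pK} ≤ (separableClosure K L).toSubalgebra := by
      rw [Algebra.adjoin_le_iff, Set.singleton_subset_iff]
      refine mem_separableClosure_iff.2 ?_
      rw [IsSeparable, hmin]
      exact hsep
    exact mem_separableClosure_iff.1 (hle hx)
  have : IsIntegralClosure C A L := by
    refine ⟨hφinj.comp e.injective, fun {x} => ⟨fun hx => ?_, ?_⟩⟩
    · let B := AdjoinRoot.powerBasis hiK.ne_zero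
      have hgen : B.gen = AdjoinRoot.root pK := AdjoinRoot.powerBasis_gen _
      have hint : IsIntegral A B.gen := ⟨p, hm, by rw [hgen]; exact hroot⟩
      -- the discriminant is `±` the norm of the derivative `-1`, hence `1` or `-1`
      have h := Algebra.discr_mul_isIntegral_mem_adjoin K hint hx
      rw [Algebra.discr_powerBasis_eq_norm, hgen, hmin, hdK, map_neg, map_one] at h
      generalize Module.finrank K (AdjoinRoot pK) * (Module.finrank K (AdjoinRoot pK) - 1) / 2 = N
        at h
      have hnorm : Algebra.norm K (-1 : L) = 1 ∨ Algebra.norm K (-1 : L) = -1 := by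
        rw [← mul_self_eq_one_iff, ← map_mul, neg_mul_neg, mul_one, map_one]
      have hx' : x ∈ Algebra.adjoin A {AdjoinRoot.root pK} := by
        rcases hnorm with h1 | h1 <;>
        rcases neg_one_pow_eq_or K N with h2 | h2 <;>
          simpa only [h1, h2, mul_one, one_mul, one_smul, neg_mul_neg, mul_neg, neg_smul,
            neg_mem_iff] using h
      have hle : Algebra.adjoin A {AdjoinRoot.root pK} ≤ φ.range := by
        rw [Algebra.adjoin_le_iff, Set.singleton_subset_iff]
        exact ⟨AdjoinRoot.root p, AdjoinRoot.liftAlgHom_root _ _ _ _⟩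
      obtain ⟨c, hc⟩ := hle hx'
      refine ⟨e.symm c, ?_⟩
      rw [hCL, RingEquiv.apply_symm_apply]
      exact hc
    · rintro ⟨c, rfl⟩
      rw [hCL]
      have : IsIntegral A (e c) := by
        have := Module.Finite.of_basis (AdjoinRoot.powerBasis' hm).basis
        exact Algebra.IsIntegral.isIntegral _
      exact this.map φ
  exact IsIntegralClosure.isDedekindDomain A K L C

end Dedekind

namespace PlaneCurve

variable (k : Type*) [Field k] (q n : ℕ) [hq : Fact (IsPrimePow q)] [hn : Fact (Odd n)]

/-- The equation of the curve, seen as a polynomial in `y` over `k[z]`, has derivative `-1`: the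
coordinate ring is étale over `k[z]`. -/
theorem isDedekindDomain_coordRing (hk : (q : k) = 0) : IsDedekindDomain (CoordRing k q n) := by
  set p : k[X][X] := X ^ q ^ 2 - X - C (X ^ r q n) with hp
  have hswap : Bivariate.swap (equation k q n) = -p := by
    rw [equation, C_sub, C_pow, map_sub, map_sub, map_pow, map_pow, Bivariate.swap_Y,
      Bivariate.swap_X, hp, C_pow]
    ring
  have hm : p.Monic := by
    rw [hp, sub_sub]
    refine monic_X_pow_sub ?_
    refine degree_le_natDegree.trans_lt ?_
    rw [natDegree_X_add_C]
    exact_mod_cast Nat.one_lt_pow two_ne_zero one_lt_q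
  have hi : Irreducible p := by
    have h := (MulEquiv.irreducible_iff (Bivariate.swap (R := k)).toMulEquiv).2
      (irreducible_equation k q n)
    have h' : Irreducible (-p) := hswap ▸ h
    exact (Associated.irreducible_iff (Associated.neg_left (Associated.refl p))).1 h'
  have hd : derivative p = -1 := by
    have hk' : (q : k[X][X]) = 0 := by
      rw [← C_eq_natCast, ← C_eq_natCast, hk, C_0, C_0]
    rw [hp, derivative_sub, derivative_C]
    simp [derivative_X_pow, hk']
  refine isDedekindDomain_of_equiv_adjoinRoot hm hi hd
    (Ideal.quotientEquiv _ _ Bivariate.swap.toRingEquiv ?_)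
  rw [Ideal.map_span, Set.image_singleton]
  change Ideal.span {p} = Ideal.span {Bivariate.swap (equation k q n)}
  rw [hswap, Ideal.span_singleton_neg]

end PlaneCurve

/-! ### Places and normalized valuations -/

namespace Place

section Normalized

variable {k F : Type*} [Field k] [Field F] [Algebra k F]

theorem ext_ring {P P' : Place k F} (h : P.ring = P'.ring) : P = P' := by
  cases P; cases P'; cases h; rfl

/-- `w` is the normalized discrete valuation, with values in `ℤᵐ⁰`, of the place `P`. -/
def IsNormalized (P : Place k F) (w : Valuation F ℤᵐ⁰) : Prop :=
  (∀ x, x ∈ P.ring ↔ w x ≤ 1) ∧ ∃ π, w π = exp (-1 : ℤ)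

variable {P : Place k F} {w : Valuation F ℤᵐ⁰} (hw : P.IsNormalized w)
include hw

theorem IsNormalized.isUnit_iff (x : P.ring) : IsUnit x ↔ w x = 1 := by
  constructor
  · rintro ⟨u, rfl⟩
    have h1 := (hw.1 _).1 (u : P.ring).2
    have h2 := (hw.1 _).1 ((u⁻¹ : P.ringˣ) : P.ring).2
    have h3 : w ((u : P.ring) : F) * w (((u⁻¹ : P.ringˣ) : P.ring) : F) = 1 := by
      rw [← map_mul, ← map_one w]
      congr 1
      exact congrArg Subtype.val u.mul_inv
    refine le_antisymm h1 ?_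
    rw [← h3]
    exact mul_le_of_le_one_right' h2
  · intro h
    have hx : (x : F) ≠ 0 := by
      intro h0
      rw [h0, map_zero] at h
      exact zero_ne_one h
    refine IsUnit.of_mul_eq_one ⟨(x : F)⁻¹, (hw.1 _).2 (by rw [map_inv₀, h, inv_one])⟩ ?_
    exact Subtype.ext (mul_inv_cancel₀ hx)

theorem IsNormalized.vanishes_iff (f : F) : P.Vanishes f ↔ w f < 1 := by
  constructor
  · rintro ⟨x, hx, rfl⟩
    refine lt_of_le_of_ne ((hw.1 _).1 x.2) fun h => ?_
    exact (IsLocalRing.mem_maximalIdeal _).1 hx ((hw.isUnit_iff x).2 h)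
  · intro h
    refine ⟨⟨f, (hw.1 f).2 h.le⟩, (IsLocalRing.mem_maximalIdeal _).2 fun hu => ?_, rfl⟩
    exact h.ne ((hw.isUnit_iff _).1 hu)

theorem IsNormalized.irreducible_iff (x : P.ring) : Irreducible x ↔ w x = exp (-1 : ℤ) := by
  constructor
  · intro hx
    obtain ⟨π, hπ⟩ := hw.2
    have hx0 : (x : F) ≠ 0 := fun h => hx.ne_zero (Subtype.ext h)
    have hw0 : w x ≠ 0 := (Valuation.ne_zero_iff _).2 hx0
    have hlt : w x < 1 := lt_of_le_of_ne ((hw.1 _).1 x.2) fun h =>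
      hx.not_isUnit ((hw.isUnit_iff x).2 h)
    have hπ0 : π ≠ 0 := by rintro rfl; rw [map_zero] at hπ; exact exp_ne_zero hπ.symm
    have hle : w x ≤ exp (-1 : ℤ) := by
      rw [← exp_log hw0] at hlt ⊢
      rw [← exp_zero, exp_lt_exp] at hlt
      rw [exp_le_exp]
      omega
    have hπP : π ∈ P.ring := (hw.1 _).2 (by rw [hπ, ← exp_zero, exp_le_exp]; omega)
    have hcP : x / π ∈ P.ring := (hw.1 _).2 (by
      rw [map_div₀, hπ]; exact div_le_one_of_le₀ hle zero_le)
    have hxe : x = ⟨π, hπP⟩ * ⟨x / π, hcP⟩ := Subtype.ext (mul_div_cancel₀ _ hπ0).symm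
    rcases hx.isUnit_or_isUnit hxe with h | h
    · have := (hw.isUnit_iff _).1 h
      simp only [hπ, ← exp_zero, exp_inj] at this
      omega
    · have := (hw.isUnit_iff _).1 h
      simp only [map_div₀, hπ] at this
      exact (div_eq_one_iff_eq exp_ne_zero).1 this
  · intro hx
    refine ⟨fun hu => ?_, fun a b hab => ?_⟩
    · have := (hw.isUnit_iff _).1 hu
      rw [hx, ← exp_zero, exp_inj] at this
      omega
    · have h1 : w a * w b = exp (-1 : ℤ) := by
        rw [← hx, hab, ← map_mul]; rfl
      have ha := (hw.1 _).1 a.2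
      have hb := (hw.1 _).1 b.2
      have ha0 : w a ≠ 0 := by intro h; rw [h, zero_mul] at h1; exact exp_ne_zero h1.symm
      have hb0 : w b ≠ 0 := by intro h; rw [h, mul_zero] at h1; exact exp_ne_zero h1.symm
      rw [hw.isUnit_iff, hw.isUnit_iff]
      obtain ⟨i, hi⟩ : ∃ i : ℤ, w a = exp i := ⟨_, (exp_log ha0).symm⟩
      obtain ⟨j, hj⟩ : ∃ j : ℤ, w b = exp j := ⟨_, (exp_log hb0).symm⟩
      rw [hi, hj, ← exp_add, exp_inj] at h1
      rw [hi, ← exp_zero, exp_le_exp] at ha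
      rw [hj, ← exp_zero, exp_le_exp] at hb
      rw [hi, hj, ← exp_zero, exp_inj, exp_inj]
      omega

theorem IsNormalized.hasOrder_iff (f : F) (m : ℤ) : P.HasOrder f m ↔ w f = exp (-m) := by
  constructor
  · rintro ⟨π, u, hπ, rfl⟩
    rw [map_mul, map_zpow₀, (hw.irreducible_iff π).1 hπ, (hw.isUnit_iff u).1 u.isUnit, one_mul,
      ← exp_zsmul]
    simp
  · intro h
    obtain ⟨π, hπ⟩ := hw.2
    have hπ0 : π ≠ 0 := by rintro rfl; rw [map_zero] at hπ; exact exp_ne_zero hπ.symm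
    have hπP : π ∈ P.ring := (hw.1 _).2 (by rw [hπ, ← exp_zero, exp_le_exp]; omega)
    have h1 : w (f * π ^ (-m)) = 1 := by
      rw [map_mul, map_zpow₀, h, hπ, ← exp_zsmul, ← exp_add, ← exp_zero, exp_inj]
      simp
    have hu : IsUnit (⟨f * π ^ (-m), (hw.1 _).2 h1.le⟩ : P.ring) := (hw.isUnit_iff _).2 h1
    refine ⟨⟨π, hπP⟩, hu.unit, (hw.irreducible_iff _).2 hπ, ?_⟩
    rw [IsUnit.unit_spec]
    change f = f * π ^ (-m) * π ^ m
    rw [mul_assoc, ← zpow_add₀ hπ0, neg_add_cancel, zpow_zero, mul_one]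

theorem IsNormalized.forall_mul_zpow_mem_iff (f : F) (m : ℤ) :
    (∀ π : P.ring, Irreducible π → f * (π : F) ^ m ∈ P.ring) ↔ w f ≤ exp m := by
  have key : ∀ π : P.ring, Irreducible π → (f * (π : F) ^ m ∈ P.ring ↔ w f ≤ exp m) := by
    intro π hπ
    rw [hw.1, map_mul, map_zpow₀, (hw.irreducible_iff π).1 hπ, ← exp_zsmul, smul_eq_mul,
      mul_neg_one, exp_neg, ← div_eq_mul_inv, div_le_one₀ exp_pos]
  obtain ⟨π, hπ⟩ := hw.2
  have hπP : π ∈ P.ring := (hw.1 _).2 (by rw [hπ, ← exp_zero, exp_le_exp]; omega)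
  have hirr : Irreducible (⟨π, hπP⟩ : P.ring) := (hw.irreducible_iff _).2 hπ
  exact ⟨fun h => (key _ hirr).1 (h _ hirr), fun h π hπ => (key π hπ).2 h⟩

end Normalized

/-! ### The places that are finite over a Dedekind domain -/

section Finite

variable {k R F : Type*} [Field k] [CommRing R] [Field F] [Algebra k R] [Algebra R F]
  [Algebra k F] [IsScalarTower k R F]

/-- The reduction of `R` at a place whose valuation ring contains `R`. -/
noncomputable def residueHom (P : Place k F) (hP : ∀ x : R, algebraMap R F x ∈ P.ring) :
    R →ₐ[k] IsLocalRing.ResidueField P.ring where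
  toRingHom := (IsLocalRing.residue P.ring).comp ((algebraMap R F).codRestrict P.ring.toSubring hP)
  commutes' a := by
    refine congrArg (IsLocalRing.residue P.ring) (Subtype.ext ?_)
    exact (IsScalarTower.algebraMap_apply k R F a).symm

theorem residueHom_eq_zero_iff {P : Place k F} {hP : ∀ x : R, algebraMap R F x ∈ P.ring} {x : R} :
    residueHom P hP x = 0 ↔ P.Vanishes (algebraMap R F x) := by
  have : residueHom P hP x = IsLocalRing.residue P.ring ⟨algebraMap R F x, hP x⟩ := rfl
  rw [this, IsLocalRing.residue_eq_zero_iff]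
  constructor
  · intro h
    exact ⟨_, h, rfl⟩
  · rintro ⟨y, hy, hyx⟩
    have : y = ⟨algebraMap R F x, hP x⟩ := Subtype.ext hyx
    exact this ▸ hy

variable [IsDedekindDomain R] [IsFractionRing R F]

/-- The place of a nonzero prime of the Dedekind domain `R`. -/
noncomputable def ofHeightOneSpectrum (k : Type*) {R : Type*} (F : Type*) [Field k] [CommRing R]
    [Field F] [Algebra k R] [Algebra R F] [Algebra k F] [IsScalarTower k R F] [IsDedekindDomain R]
    [IsFractionRing R F] (v : HeightOneSpectrum R) : Place k F where
  ring := (v.valuation F).valuationSubring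
  algebraMap_mem a := by
    rw [Valuation.mem_valuationSubring_iff, IsScalarTower.algebraMap_apply k R F]
    exact v.valuation_le_one _
  ring_ne_top h := by
    obtain ⟨π, hπ⟩ := v.valuation_exists_uniformizer F
    have : π⁻¹ ∈ (v.valuation F).valuationSubring := h ▸ trivial
    rw [Valuation.mem_valuationSubring_iff, map_inv₀, hπ, ← exp_neg, ← exp_zero, exp_le_exp] at this
    omega

theorem ofHeightOneSpectrum_isNormalized (v : HeightOneSpectrum R) :
    (ofHeightOneSpectrum k F v).IsNormalized (v.valuation F) :=
  ⟨fun _ => Valuation.mem_valuationSubring_iff _ _, v.valuation_exists_uniformizer F⟩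

theorem algebraMap_mem_ofHeightOneSpectrum (v : HeightOneSpectrum R) (x : R) :
    algebraMap R F x ∈ (ofHeightOneSpectrum k F v).ring :=
  v.valuation_le_one x

theorem vanishes_ofHeightOneSpectrum_iff (v : HeightOneSpectrum R) (x : R) :
    (ofHeightOneSpectrum k F v).Vanishes (algebraMap R F x) ↔ x ∈ v.asIdeal := by
  rw [(ofHeightOneSpectrum_isNormalized v).vanishes_iff]
  exact v.valuation_lt_one_iff_mem x

theorem ofHeightOneSpectrum_injective :
    Function.Injective (ofHeightOneSpectrum k F : HeightOneSpectrum R → Place k F) := by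
  intro v v' h
  ext x
  rw [← vanishes_ofHeightOneSpectrum_iff (k := k) (F := F), h, vanishes_ofHeightOneSpectrum_iff]

/-- A place whose valuation ring contains `R` is the place of a nonzero prime of `R`. -/
theorem exists_eq_ofHeightOneSpectrum (P : Place k F) (hP : ∀ x : R, algebraMap R F x ∈ P.ring) :
    ∃ v : HeightOneSpectrum R, P = ofHeightOneSpectrum k F v := by
  let p : Ideal R := RingHom.ker (residueHom P hP)
  have hp : p.IsPrime := RingHom.ker_isPrime _
  have hinv : ∀ x : R, x ∉ p → (algebraMap R F x)⁻¹ ∈ P.ring := by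
    intro x hx
    have hu : IsUnit (⟨algebraMap R F x, hP x⟩ : P.ring) := by
      by_contra h
      exact hx (residueHom_eq_zero_iff.2 ⟨_, (IsLocalRing.mem_maximalIdeal _).2 h, rfl⟩)
    obtain ⟨y, hy⟩ := hu.exists_right_inv
    have h1 : algebraMap R F x * (y : F) = 1 := congrArg Subtype.val hy
    rw [inv_eq_of_mul_eq_one_right h1]
    exact y.2
  have hp0 : p ≠ ⊥ := by
    intro h0
    apply P.ring_ne_top
    rw [eq_top_iff]
    intro x _
    obtain ⟨a, b, hb, rfl⟩ := IsFractionRing.div_surjective (A := R) x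
    rw [div_eq_mul_inv]
    refine P.ring.mul_mem _ _ (hP a) (hinv b ?_)
    rw [h0, Ideal.mem_bot]
    exact nonZeroDivisors.ne_zero hb
  let v : HeightOneSpectrum R := ⟨p, hp, hp0⟩
  refine ⟨v, ext_ring ?_⟩
  have hle : HeightOneSpectrum.valuationSubringAtPrime F v ≤ P.ring := by
    rintro x ⟨a, s, hs, rfl⟩
    exact P.ring.mul_mem _ _ (hP a) (hinv s hs)
  exact (ValuationSubring.eq_of_le_of_ne_top _ hle P.ring_ne_top).symm.trans
    (v.valuationSubringAtPrime_eq_valuationSubring)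

theorem residueHom_ofHeightOneSpectrum_surjective (v : HeightOneSpectrum R) :
    Function.Surjective (residueHom (R := R) (ofHeightOneSpectrum k F v)
      (algebraMap_mem_ofHeightOneSpectrum v)) := by
  intro x
  obtain ⟨⟨x, hx⟩, rfl⟩ := IsLocalRing.residue_surjective x
  obtain ⟨a, ha⟩ := v.exists_valuation_sub_lt_of_integer (K := F) hx 1
  refine ⟨a, ?_⟩
  have : residueHom (R := R) (ofHeightOneSpectrum k F v) (algebraMap_mem_ofHeightOneSpectrum v) a =
    IsLocalRing.residue _ ⟨algebraMap R F a, algebraMap_mem_ofHeightOneSpectrum v a⟩ := rfl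
  rw [this, ← sub_eq_zero, ← map_sub, IsLocalRing.residue_eq_zero_iff]
  obtain ⟨y, hy, hyx⟩ := ((ofHeightOneSpectrum_isNormalized (k := k) v).vanishes_iff _).2 ha
  have : y = ⟨algebraMap R F a, algebraMap_mem_ofHeightOneSpectrum v a⟩ - ⟨x, hx⟩ :=
    Subtype.ext hyx
  exact this ▸ hy

theorem degree_ofHeightOneSpectrum (v : HeightOneSpectrum R) :
    (ofHeightOneSpectrum k F v).degree = Module.finrank k (R ⧸ v.asIdeal) := by
  have hker : RingHom.ker (residueHom (R := R) (ofHeightOneSpectrum k F v)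
      (algebraMap_mem_ofHeightOneSpectrum v)) = v.asIdeal := by
    ext x
    rw [RingHom.mem_ker, residueHom_eq_zero_iff, vanishes_ofHeightOneSpectrum_iff]
  exact (((Ideal.quotientEquivAlgOfEq k hker.symm).trans (Ideal.quotientKerAlgEquivOfSurjective
    (residueHom_ofHeightOneSpectrum_surjective v))).toLinearEquiv.finrank_eq).symm

end Finite

end Place

/-! ### Dimensions of quotients of a Dedekind domain -/

section Dimension

variable {k R : Type*} [Field k] [CommRing R] [IsDedekindDomain R] [Algebra k R]

/-- For a maximal ideal `v` of a Dedekind domain, `J / v J` is isomorphic to `R / v`. -/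
theorem finrank_quotient_mul (v : HeightOneSpectrum R) (J : Ideal R) (hJ : J ≠ ⊥)
    [Module.Finite k (R ⧸ v.asIdeal)] [Module.Finite k (R ⧸ J)] :
    Module.Finite k (R ⧸ v.asIdeal * J) ∧ Module.finrank k (R ⧸ v.asIdeal * J) =
      Module.finrank k (R ⧸ v.asIdeal) + Module.finrank k (R ⧸ J) := by
  have hlt : v.asIdeal * J < J := by
    refine lt_of_le_of_ne Ideal.mul_le_right fun h => ?_
    have : v.asIdeal = 1 := mul_right_cancel₀ hJ (by rw [h, one_mul])
    exact v.isPrime.ne_top (by rw [this, Ideal.one_eq_top])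
  obtain ⟨a, haJ, ha⟩ := SetLike.exists_of_lt hlt
  let g₀ : (R ⧸ v.asIdeal) →ₗ[R] (R ⧸ v.asIdeal * J) :=
    Submodule.mapQ v.asIdeal (v.asIdeal * J) (LinearMap.mulLeft R a) (by
      intro x hx
      simpa [mul_comm a x] using Ideal.mul_mem_mul hx haJ)
  have hg₀ : ∀ x, g₀ (Ideal.Quotient.mk _ x) = Ideal.Quotient.mk _ (a * x) := fun _ => rfl
  let g := g₀.restrictScalars k
  let f := (Ideal.Quotient.factorₐ k (Ideal.mul_le_right : v.asIdeal * J ≤ J)).toLinearMap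
  have hf : ∀ x, f (Ideal.Quotient.mk _ x) = Ideal.Quotient.mk _ x := fun _ => rfl
  have hfs : Function.Surjective f := by
    intro x
    obtain ⟨x, rfl⟩ := Ideal.Quotient.mk_surjective x
    exact ⟨_, hf x⟩
  have hgi : Function.Injective g := by
    rw [← LinearMap.ker_eq_bot, LinearMap.ker_eq_bot']
    intro x
    obtain ⟨x, rfl⟩ := Ideal.Quotient.mk_surjective x
    intro hx
    change g₀ _ = 0 at hx
    rw [hg₀, Ideal.Quotient.eq_zero_iff_mem] at hx
    rw [Ideal.Quotient.eq_zero_iff_mem]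
    by_contra hxv
    obtain ⟨y, i, hi, hy⟩ := v.isMaximal.exists_inv hxv
    apply ha
    have : a = y * (a * x) + i * a := by linear_combination (-a) * hy
    rw [this]
    exact Ideal.add_mem _ (Ideal.mul_mem_left _ _ hx) (Ideal.mul_mem_mul hi haJ)
  have hrange : LinearMap.range g = LinearMap.ker f := by
    ext x
    obtain ⟨x, rfl⟩ := Ideal.Quotient.mk_surjective x
    rw [LinearMap.mem_range, LinearMap.mem_ker, hf, Ideal.Quotient.eq_zero_iff_mem]
    constructor
    · rintro ⟨y, hy⟩
      obtain ⟨y, rfl⟩ := Ideal.Quotient.mk_surjective y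
      change g₀ _ = _ at hy
      rw [hg₀, Ideal.Quotient.eq] at hy
      have : x = a * y - (a * y - x) := by ring
      rw [this]
      exact Ideal.sub_mem _ (Ideal.mul_mem_right _ _ haJ) (Ideal.mul_le_right hy)
    · intro hx
      -- No ideal lies strictly between `v J` and `J`.
      have hsup : J ≤ Ideal.span {a} ⊔ v.asIdeal * J := by
        have hI : Ideal.span {a} ⊔ v.asIdeal * J ≤ J :=
          sup_le ((Ideal.span_singleton_le_iff_mem _).2 haJ) Ideal.mul_le_right
        obtain ⟨I, hI⟩ := Ideal.dvd_iff_le.2 hI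
        have h1 : I ∣ v.asIdeal := by
          have h2 : J * I ∣ J * v.asIdeal := by
            rw [← hI, mul_comm J, Ideal.dvd_iff_le]
            exact le_sup_right
          exact (mul_dvd_mul_iff_left hJ).1 h2
        by_cases h : I = ⊤
        · rw [hI, h, Ideal.mul_top]
        · exfalso
          have h := v.isMaximal.eq_of_le h (Ideal.dvd_iff_le.1 h1)
          apply ha
          have h3 : a ∈ Ideal.span {a} ⊔ v.asIdeal * J :=
            Ideal.mem_sup_left (Ideal.mem_span_singleton_self a)
          rwa [hI, ← h, mul_comm] at h3
      obtain ⟨b, hb, c, hc, hbc⟩ := Submodule.mem_sup.1 (hsup hx)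
      obtain ⟨y, rfl⟩ := Ideal.mem_span_singleton'.1 hb
      refine ⟨Ideal.Quotient.mk _ y, ?_⟩
      change g₀ _ = _
      rw [hg₀, Ideal.Quotient.eq, ← hbc]
      have : a * y - (y * a + c) = -c := by ring
      rw [this]
      exact neg_mem hc
  have hfin : Module.Finite k (R ⧸ v.asIdeal * J) := by
    have : Module.Finite k (LinearMap.ker f) := by
      rw [← hrange]; infer_instance
    have : Module.Finite k ((R ⧸ v.asIdeal * J) ⧸ LinearMap.ker f) :=
      Module.Finite.equiv (f.quotKerEquivOfSurjective hfs).symm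
    exact Module.Finite.of_submodule_quotient (LinearMap.ker f)
  refine ⟨hfin, ?_⟩
  rw [← f.finrank_range_add_finrank_ker, LinearMap.range_eq_top.2 hfs, finrank_top, ← hrange,
    LinearMap.finrank_range_of_inj hgi, add_comm]

theorem finrank_quotient_pow_mul (v : HeightOneSpectrum R) (a : ℕ) (J : Ideal R) (hJ : J ≠ ⊥)
    [Module.Finite k (R ⧸ v.asIdeal)] [hfJ : Module.Finite k (R ⧸ J)] :
    Module.Finite k (R ⧸ v.asIdeal ^ a * J) ∧ Module.finrank k (R ⧸ v.asIdeal ^ a * J) =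
      a * Module.finrank k (R ⧸ v.asIdeal) + Module.finrank k (R ⧸ J) := by
  induction a with
  | zero =>
    rw [pow_zero, one_mul, zero_mul, zero_add]
    exact ⟨hfJ, rfl⟩
  | succ a ih =>
    have := ih.1
    have h := finrank_quotient_mul (k := k) v (v.asIdeal ^ a * J)
      (mul_ne_zero (pow_ne_zero _ v.ne_bot) hJ)
    rw [pow_succ', mul_assoc]
    exact ⟨h.1, by rw [h.2, ih.2]; ring⟩

/-- Induction on `S`, splitting off one prime power at a time. -/
theorem finrank_quotient_prod [∀ v : HeightOneSpectrum R, Module.Finite k (R ⧸ v.asIdeal)]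
    (S : Finset (HeightOneSpectrum R)) (a : HeightOneSpectrum R → ℕ) :
    Module.Finite k (R ⧸ ∏ v ∈ S, v.asIdeal ^ a v) ∧
      Module.finrank k (R ⧸ ∏ v ∈ S, v.asIdeal ^ a v) =
        ∑ v ∈ S, a v * Module.finrank k (R ⧸ v.asIdeal) := by
  classical
  induction S using Finset.induction_on with
  | empty =>
    rw [Finset.prod_empty, Finset.sum_empty, Ideal.one_eq_top]
    have : Subsingleton (R ⧸ (⊤ : Ideal R)) := Ideal.Quotient.subsingleton_iff.2 rfl
    exact ⟨inferInstance, Module.finrank_zero_of_subsingleton⟩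
  | insert v S hv ih =>
    have := ih.1
    rw [Finset.prod_insert hv, Finset.sum_insert hv, ← ih.2]
    refine finrank_quotient_pow_mul v (a v) _ ?_
    exact Finset.prod_ne_zero_iff.2 fun v _ => pow_ne_zero _ v.ne_bot

end Dimension

/-! ### The place at infinity -/

/-- A valuation on a field all of whose nonzero values are integral powers of one value `t > 1` is
equivalent to a valuation with values in `ℤᵐ⁰`. -/
theorem Valuation.exists_eq_exp {F Γ : Type*} [Field F] [LinearOrderedCommGroupWithZero Γ]
    (v : Valuation F Γ) {t : Γ} (ht : 1 < t) (h : ∀ x, x ≠ 0 → ∃ m : ℤ, v x = t ^ m) :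
    ∃ w : Valuation F ℤᵐ⁰, ∀ (x : F) (m : ℤ), v x = t ^ m → w x = exp m := by
  classical
  choose! d hd using h
  have ht0 : 0 < t := zero_lt_one.trans ht
  have hmono : StrictMono (fun m : ℤ => t ^ m) := zpow_right_strictMono₀ ht
  let w : Valuation F ℤᵐ⁰ :=
    { toFun := fun x => if x = 0 then 0 else exp (d x)
      map_zero' := if_pos rfl
      map_one' := by
        rw [if_neg one_ne_zero, ← exp_zero, exp_inj]
        apply hmono.injective
        simp only [← hd 1 one_ne_zero, map_one, zpow_zero]
      map_mul' := fun x y => by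
        by_cases hx : x = 0
        · simp [hx]
        by_cases hy : y = 0
        · simp [hy]
        rw [if_neg hx, if_neg hy, if_neg (mul_ne_zero hx hy), ← exp_add, exp_inj]
        apply hmono.injective
        simp only [← hd _ (mul_ne_zero hx hy), map_mul, hd x hx, hd y hy, zpow_add₀ ht0.ne']
      map_add_le_max' := fun x y => by
        by_cases hx : x = 0
        · simp [hx]
        by_cases hy : y = 0
        · simp [hy]
        by_cases hxy : x + y = 0
        · simp [hxy]
        rw [if_neg hx, if_neg hy, if_neg hxy, le_max_iff, exp_le_exp, exp_le_exp]
        have := v.map_add x y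
        rwa [hd x hx, hd y hy, hd _ hxy, le_max_iff, hmono.le_iff_le, hmono.le_iff_le] at this }
  refine ⟨w, fun x m hm => ?_⟩
  have hx : x ≠ 0 := by
    rintro rfl
    rw [map_zero] at hm
    exact (zpow_pos ht0 m).ne hm
  change (if x = 0 then 0 else exp (d x)) = exp m
  rw [if_neg hx, exp_inj]
  exact hmono.injective ((hd x hx).symm.trans hm)

namespace PlaneCurve

section Weight

variable (k : Type*) [Field k] (q n : ℕ)

/-- The function `y` in the coordinate ring. -/
noncomputable def coordY : CoordRing k q n := AdjoinRoot.mk (equation k q n) (C X)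

/-- The function `z` in the coordinate ring. -/
noncomputable def coordZ : CoordRing k q n := AdjoinRoot.mk (equation k q n) X

theorem coordZ_pow : coordZ k q n ^ r q n = coordY k q n ^ q ^ 2 - coordY k q n := by
  rw [coordZ, coordY, ← map_pow, ← map_pow, ← map_sub, ← sub_eq_zero, ← map_sub,
    AdjoinRoot.mk_eq_zero, equation, C_sub, C_pow]

variable [hq : Fact (IsPrimePow q)] [hn : Fact (Odd n)]

theorem monic_equation : (equation k q n).Monic := monic_X_pow_sub_C _ (r_pos q n).ne'

omit hq hn in
theorem natDegree_equation : (equation k q n).natDegree = r q n := natDegree_X_pow_sub_C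

/-- The `k[y]`-basis of the coordinate ring that consists of the `z ^ b` with `b < r`. -/
noncomputable def powZBasis : Module.Basis (Fin (r q n)) k[X] (CoordRing k q n) :=
  (AdjoinRoot.powerBasis' (monic_equation k q n)).basis.reindex
    (finCongr ((AdjoinRoot.powerBasis'_dim _).trans (natDegree_equation k q n)))

theorem powZBasis_apply (i : Fin (r q n)) : powZBasis k q n i = coordZ k q n ^ (i : ℕ) := by
  rw [powZBasis, Module.Basis.reindex_apply, PowerBasis.basis_eq_pow]
  rfl

/-- The `k`-basis of the coordinate ring that consists of the `y ^ a * z ^ b` with `b < r`. -/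
noncomputable def monomialBasis :
    Module.Basis (ℕ × Fin (r q n)) k (CoordRing k q n) :=
  (Polynomial.basisMonomials k).smulTower (powZBasis k q n)

theorem monomialBasis_apply (i : ℕ × Fin (r q n)) :
    monomialBasis k q n i = coordY k q n ^ i.1 * coordZ k q n ^ (i.2 : ℕ) := by
  rw [monomialBasis, Module.Basis.smulTower_apply, powZBasis_apply, coe_basisMonomials,
    Algebra.smul_def]
  beta_reduce
  rw [monomial_one_right_eq_X_pow, map_pow]
  rfl

/-- The pole order `r a + q ^ 2 b` of `y ^ a * z ^ b` at infinity. -/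
def weight (i : ℕ × Fin (r q n)) : ℕ := r q n * i.1 + q ^ 2 * i.2

omit hq in
theorem coprime_r : Nat.Coprime (r q n) q := by
  have h := r_mul_succ q n
  have hn0 : n ≠ 0 := by rintro rfl; exact absurd hn.out (by decide)
  have h1 : Nat.Coprime (q ^ n + 1) q := by
    obtain ⟨m, rfl⟩ := Nat.exists_eq_succ_of_ne_zero hn0
    rw [pow_succ]
    simp
  rw [← h] at h1
  exact h1.coprime_mul_right

/-- As `r` and `q ^ 2` are coprime, `r a + q ^ 2 b` determines `b` modulo `r`. -/
theorem weight_injective : Function.Injective (weight q n) := by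
  have key : ∀ a b a' b' : ℕ, b < r q n → b' < r q n → b ≤ b' →
      r q n * a + q ^ 2 * b = r q n * a' + q ^ 2 * b' → a = a' ∧ b = b' := by
    intro a b a' b' hb hb' hle h
    have hc : Nat.Coprime (r q n) (q ^ 2) := (coprime_r q n).pow_right 2
    obtain ⟨d, rfl⟩ := Nat.exists_eq_add_of_le hle
    have h1 : r q n ∣ q ^ 2 * d := by
      have h2 : r q n * a = r q n * a' + q ^ 2 * d := by rw [mul_add] at h; omega
      exact (Nat.dvd_add_right (Dvd.intro _ rfl)).1 (h2 ▸ Dvd.intro _ rfl)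
    have h2 : r q n ∣ d := hc.dvd_of_dvd_mul_left h1
    have h3 : d = 0 := Nat.eq_zero_of_dvd_of_lt h2 (by omega)
    subst h3
    simp only [add_zero, add_left_inj] at h
    exact ⟨Nat.eq_of_mul_eq_mul_left (r_pos q n) h, rfl⟩
  rintro ⟨a, b⟩ ⟨a', b'⟩ h
  have hb := b.2
  have hb' := b'.2
  rcases le_total (b : ℕ) b' with hle | hle
  · obtain ⟨h1, h2⟩ := key _ _ _ _ hb hb' hle h
    exact Prod.ext h1 (Fin.ext h2)
  · obtain ⟨h1, h2⟩ := key _ _ _ _ hb' hb hle h.symm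
    exact Prod.ext h1.symm (Fin.ext h2.symm)

/-- The pole order at infinity of a nonzero function in the coordinate ring. -/
noncomputable def wdeg (x : CoordRing k q n) : ℕ :=
  ((monomialBasis k q n).repr x).support.sup (weight q n)

/-- The functions in the coordinate ring with pole order at most `m` at infinity. -/
noncomputable def polesLE (m : ℕ) : Submodule k (CoordRing k q n) :=
  Submodule.span k (Set.range fun i : {i // weight q n i ≤ m} => monomialBasis k q n i)

variable {k q n}

theorem mem_polesLE_iff {m : ℕ} {x : CoordRing k q n} :
    x ∈ polesLE k q n m ↔ wdeg k q n x ≤ m := by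
  have : (Set.range fun i : {i // weight q n i ≤ m} => monomialBasis k q n i) =
      monomialBasis k q n '' {i | weight q n i ≤ m} := by
    ext x; simp
  rw [polesLE, this, Module.Basis.mem_span_image, wdeg, Finset.sup_le_iff]
  rfl

/-- A valuation that is trivial on `k` and in which `y` and `z` have the values `t ^ r` and
`t ^ (q ^ 2)`. -/
structure IsInfinite {Γ : Type*} [LinearOrderedCommGroupWithZero Γ]
    (v : Valuation (FunField k q n) Γ) (t : Γ) : Prop where
  one_lt : 1 < t
  map_const : ∀ c : k, c ≠ 0 → v (algebraMap k _ c) = 1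
  map_y : v (algebraMap _ _ (coordY k q n)) = t ^ r q n
  map_z : v (algebraMap _ _ (coordZ k q n)) = t ^ q ^ 2

variable {Γ : Type*} [LinearOrderedCommGroupWithZero Γ] {v : Valuation (FunField k q n) Γ} {t : Γ}

/-- The monomials in the basis have distinct values at infinity, so the value of a combination of
them is the largest one. -/
theorem IsInfinite.map_eq (h : IsInfinite v t) {x : CoordRing k q n} (hx : x ≠ 0) :
    v (algebraMap _ _ x) = t ^ wdeg k q n x := by
  set B := monomialBasis k q n
  have hterm : ∀ i, i ∈ (B.repr x).support →
      v (algebraMap _ _ (B.repr x i • B i)) = t ^ weight q n i := by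
    intro i hi
    rw [Algebra.smul_def, map_mul, map_mul, ← IsScalarTower.algebraMap_apply,
      h.map_const _ (Finsupp.mem_support_iff.1 hi), one_mul, monomialBasis_apply, map_mul, map_mul,
      map_pow, map_pow, map_pow, map_pow, h.map_y, h.map_z, ← pow_mul, ← pow_mul, ← pow_add, weight]
  have hne : (B.repr x).support.Nonempty := by
    rw [Finsupp.support_nonempty_iff]
    intro h0
    exact hx (B.repr.map_eq_zero_iff.1 h0)
  obtain ⟨i, hi, hmax⟩ := Finset.exists_max_image _ (weight q n) hne
  have hw : wdeg k q n x = weight q n i :=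
    le_antisymm (Finset.sup_le hmax) (Finset.le_sup (f := weight q n) hi)
  have hsum := B.linearCombination_repr x
  rw [Finsupp.linearCombination_apply, Finsupp.sum, ← Finset.add_sum_erase _ _ hi] at hsum
  rw [hw, ← hsum, map_add, Valuation.map_add_eq_of_lt_left, hterm i hi]
  rw [hterm i hi, map_sum]
  refine Valuation.map_sum_lt _ (pow_pos (zero_lt_one.trans h.one_lt) _).ne' fun j hj => ?_
  have hj' := Finset.mem_of_mem_erase hj
  rw [hterm j hj']
  refine pow_lt_pow_right₀ h.one_lt (lt_of_le_of_ne (hmax j hj') fun hij => ?_)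
  exact Finset.ne_of_mem_erase hj (weight_injective q n hij)

theorem IsInfinite.exists_map_eq_zpow (h : IsInfinite v t) (x : FunField k q n) (hx : x ≠ 0) :
    ∃ m : ℤ, v x = t ^ m := by
  obtain ⟨a, b, hb, rfl⟩ := IsFractionRing.div_surjective (A := CoordRing k q n) x
  have hb0 := nonZeroDivisors.ne_zero hb
  have ha0 : a ≠ 0 := by rintro rfl; simp at hx
  refine ⟨wdeg k q n a - wdeg k q n b, ?_⟩
  rw [map_div₀, h.map_eq ha0, h.map_eq hb0, zpow_sub₀ (zero_lt_one.trans h.one_lt).ne']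
  simp

/-- Two valuations as in `IsInfinite` have the same valuation ring. -/
theorem IsInfinite.map_le_one_iff {Γ' : Type*} [LinearOrderedCommGroupWithZero Γ']
    {v' : Valuation (FunField k q n) Γ'} {t' : Γ'} (h : IsInfinite v t) (h' : IsInfinite v' t')
    (x : FunField k q n) : v x ≤ 1 ↔ v' x ≤ 1 := by
  by_cases hx : x = 0
  · simp [hx]
  obtain ⟨a, b, hb, rfl⟩ := IsFractionRing.div_surjective (A := CoordRing k q n) x
  have hb0 := nonZeroDivisors.ne_zero hb
  have ha0 : a ≠ 0 := by rintro rfl; simp at hx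
  rw [map_div₀, map_div₀, h.map_eq ha0, h.map_eq hb0, h'.map_eq ha0, h'.map_eq hb0,
    div_le_one₀ (pow_pos (zero_lt_one.trans h.one_lt) _),
    div_le_one₀ (pow_pos (zero_lt_one.trans h'.one_lt) _),
    pow_le_pow_iff_right₀ h.one_lt, pow_le_pow_iff_right₀ h'.one_lt]

end Weight

section Infinity

variable {k : Type*} [Field k] {q n : ℕ} [hq : Fact (IsPrimePow q)] [hn : Fact (Odd n)]

omit hq in
/-- The coefficients give an element `y ^ A * z ^ B` with a simple pole at infinity. -/
theorem exists_bezout : ∃ A B : ℤ, A * r q n + B * (q ^ 2 : ℕ) = 1 := by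
  have hc : Nat.Coprime (r q n) (q ^ 2) := (coprime_r q n).pow_right 2
  have := Nat.gcd_eq_gcd_ab (r q n) (q ^ 2)
  rw [hc.gcd_eq_one] at this
  exact ⟨_, _, by rw [mul_comm, mul_comm (Nat.gcdB _ _)]; exact_mod_cast this.symm⟩

/-- At a place that is a pole of `y`, the equation of the curve determines the values of `y` and `z`
up to a common scale. -/
theorem exists_isInfinite (P : Place k (FunField k q n))
    (hP : algebraMap _ _ (coordY k q n) ∉ P.ring) :
    ∃ t, IsInfinite P.ring.valuation t := by
  set v := P.ring.valuation
  set y : FunField k q n := algebraMap _ _ (coordY k q n)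
  set z : FunField k q n := algebraMap _ _ (coordZ k q n)
  have hy1 : 1 < v y := by
    rw [← not_le, ValuationSubring.valuation_le_one_iff]; exact hP
  have hq1 : 1 < q ^ 2 := Nat.one_lt_pow two_ne_zero one_lt_q
  have hyz : v z ^ r q n = v y ^ q ^ 2 := by
    have h := congrArg (algebraMap _ (FunField k q n)) (coordZ_pow k q n)
    rw [map_pow, map_sub, map_pow] at h
    rw [← map_pow, h, Valuation.map_sub_eq_of_lt_left, map_pow]
    rw [map_pow]
    exact lt_self_pow₀ hy1 hq1
  have hy0 : v y ≠ 0 := (zero_lt_one.trans hy1).ne'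
  have hz0 : v z ≠ 0 := by
    intro h
    rw [h, zero_pow (r_pos q n).ne'] at hyz
    exact pow_ne_zero _ hy0 hyz.symm
  obtain ⟨A, B, hAB⟩ := exists_bezout (q := q) (n := n)
  have hty : v y = (v y ^ A * v z ^ B) ^ r q n := by
    rw [mul_pow, ← zpow_natCast (v z ^ B), ← zpow_mul, mul_comm B, zpow_mul, zpow_natCast, hyz,
      ← zpow_natCast (v y), ← zpow_mul, ← zpow_natCast, ← zpow_mul, ← zpow_add₀ hy0,
      mul_comm _ B, hAB, zpow_one]
  have htz : v z = (v y ^ A * v z ^ B) ^ q ^ 2 := by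
    rw [mul_pow, ← zpow_natCast (v y ^ A), ← zpow_mul, mul_comm A, zpow_mul, zpow_natCast, ← hyz,
      ← zpow_natCast (v z), ← zpow_mul, ← zpow_natCast, ← zpow_mul, ← zpow_add₀ hz0,
      mul_comm _ A, hAB, zpow_one]
  refine ⟨v y ^ A * v z ^ B, ?_, ?_, hty, htz⟩
  · rw [hty] at hy1
    exact (one_lt_pow_iff_of_nonneg zero_le (r_pos q n).ne').1 hy1
  · intro c hc
    refine le_antisymm ((ValuationSubring.valuation_le_one_iff _ _).2 (P.algebraMap_mem c)) ?_
    have h2 := (ValuationSubring.valuation_le_one_iff _ _).2 (P.algebraMap_mem c⁻¹)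
    rw [map_inv₀, map_inv₀] at h2
    have h3 : v (algebraMap k _ c) ≠ 0 := by simpa using hc
    exact (inv_le_one₀ (zero_lt_iff.2 h3)).1 h2

/-- The coordinate ring contains the polynomial ring `k[y]`. -/
theorem not_isIntegral_coordY : ¬ IsIntegral k (algebraMap _ (FunField k q n) (coordY k q n)) := by
  rintro ⟨p, hp, h⟩
  refine hp.ne_zero ?_
  have hdeg : (equation k q n).degree ≠ 0 := by
    rw [degree_eq_natDegree (monic_equation k q n).ne_zero, natDegree_equation]
    exact_mod_cast (r_pos q n).ne'
  apply AdjoinRoot.of.injective_of_degree_ne_zero hdeg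
  apply IsFractionRing.injective (CoordRing k q n) (FunField k q n)
  rw [map_zero, map_zero, ← h, ← aeval_def, aeval_algebraMap_apply]
  congr 1
  have : coordY k q n = algebraMap k[X] (CoordRing k q n) X := rfl
  rw [this, aeval_algebraMap_apply, aeval_X_left_apply]
  rfl

/-- The integral closure of `k` is the intersection of the valuation rings that contain it. -/
theorem exists_place_coordY_notMem :
    ∃ P : Place k (FunField k q n), algebraMap _ _ (coordY k q n) ∉ P.ring := by
  have h := not_isIntegral_coordY (k := k) (q := q) (n := n)
  set y : FunField k q n := algebraMap _ _ (coordY k q n)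
  have hy : y ∉ (integralClosure k (FunField k q n)).toSubring := h
  have : IsIntegrallyClosedIn (integralClosure k (FunField k q n)).toSubring (FunField k q n) :=
    inferInstanceAs (IsIntegrallyClosedIn (integralClosure k (FunField k q n)) _)
  obtain ⟨V, hV, hyV⟩ := Subring.exists_le_valuationSubring_of_isIntegrallyClosedIn hy
  refine ⟨⟨V, fun a => hV ((integralClosure k (FunField k q n)).algebraMap_mem a), ?_⟩, hyV⟩
  rintro rfl
  exact hyV trivial

variable (k q n)

/-- The place at infinity. -/
noncomputable def infinity : Place k (FunField k q n) := exists_place_coordY_notMem.choose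

theorem coordY_notMem_infinity : algebraMap _ _ (coordY k q n) ∉ (infinity k q n).ring :=
  exists_place_coordY_notMem.choose_spec

variable {k q n}

/-- There is only one place at which `y` has a pole. -/
theorem eq_infinity {P : Place k (FunField k q n)}
    (hP : algebraMap _ _ (coordY k q n) ∉ P.ring) : P = infinity k q n := by
  obtain ⟨t, ht⟩ := exists_isInfinite P hP
  obtain ⟨t', ht'⟩ := exists_isInfinite _ (coordY_notMem_infinity k q n)
  refine Place.ext_ring ?_
  ext x
  rw [← ValuationSubring.valuation_le_one_iff, ← ValuationSubring.valuation_le_one_iff]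
  exact ht.map_le_one_iff ht' x

variable (k q n)

theorem exists_infinityValuation : ∃ w : Valuation (FunField k q n) ℤᵐ⁰,
    (infinity k q n).IsNormalized w ∧ IsInfinite w (exp (1 : ℤ)) := by
  obtain ⟨t, ht⟩ := exists_isInfinite _ (coordY_notMem_infinity k q n)
  obtain ⟨w, hw⟩ := Valuation.exists_eq_exp _ ht.one_lt ht.exists_map_eq_zpow
  have hwi : IsInfinite w (exp (1 : ℤ)) := by
    refine ⟨by rw [← exp_zero, exp_lt_exp]; omega, fun c hc => ?_, ?_, ?_⟩
    · rw [hw _ 0 (by rw [ht.map_const c hc, zpow_zero]), exp_zero]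
    · rw [hw _ (r q n) (by rw [ht.map_y, zpow_natCast]), ← exp_nsmul]
      simp
    · rw [hw _ (q ^ 2 : ℕ) (by rw [ht.map_z, zpow_natCast]), ← exp_nsmul]
      simp
  refine ⟨w, ⟨fun x => ?_, ?_⟩, hwi⟩
  · rw [← ValuationSubring.valuation_le_one_iff]
    exact ht.map_le_one_iff hwi x
  · -- a uniformizer: the inverse of a monomial in `y` and `z` with pole order one
    obtain ⟨A, B, hAB⟩ := exists_bezout (q := q) (n := n)
    refine ⟨algebraMap _ _ (coordY k q n) ^ (-A) * algebraMap _ _ (coordZ k q n) ^ (-B), ?_⟩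
    rw [map_mul, map_zpow₀, map_zpow₀, hwi.map_y, hwi.map_z, ← exp_nsmul, ← exp_nsmul, ← exp_zsmul,
      ← exp_zsmul, ← exp_add, exp_inj]
    simp only [smul_eq_mul, nsmul_eq_mul, mul_one]
    linarith

/-- The normalized valuation of the place at infinity. -/
noncomputable def infinityValuation : Valuation (FunField k q n) ℤᵐ⁰ :=
  (exists_infinityValuation k q n).choose

theorem infinity_isNormalized : (infinity k q n).IsNormalized (infinityValuation k q n) :=
  (exists_infinityValuation k q n).choose_spec.1

theorem isInfinite_infinityValuation : IsInfinite (infinityValuation k q n) (exp (1 : ℤ)) :=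
  (exists_infinityValuation k q n).choose_spec.2

variable {k q n}

theorem infinityValuation_algebraMap {x : CoordRing k q n} (hx : x ≠ 0) :
    infinityValuation k q n (algebraMap _ _ x) = exp (wdeg k q n x : ℤ) := by
  rw [(isInfinite_infinityValuation k q n).map_eq hx, ← exp_nsmul]
  simp

theorem wdeg_mul {x y : CoordRing k q n} (hx : x ≠ 0) (hy : y ≠ 0) :
    wdeg k q n (x * y) = wdeg k q n x + wdeg k q n y := by
  have h := infinityValuation_algebraMap (mul_ne_zero hx hy)
  rw [map_mul, map_mul, infinityValuation_algebraMap hx, infinityValuation_algebraMap hy,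
    ← exp_add, exp_inj] at h
  exact_mod_cast h.symm

theorem wdeg_le_wdeg_iff {a b : CoordRing k q n} (ha : a ≠ 0) (hb : b ≠ 0) :
    wdeg k q n a ≤ wdeg k q n b ↔
      infinityValuation k q n (algebraMap _ _ a / algebraMap _ _ b) ≤ 1 := by
  rw [map_div₀, infinityValuation_algebraMap ha, infinityValuation_algebraMap hb,
    div_le_one₀ exp_pos, exp_le_exp, Nat.cast_le]

theorem exists_weight_eq_wdeg {a : CoordRing k q n} (ha : a ≠ 0) :
    ∃ i, (monomialBasis k q n).repr a i ≠ 0 ∧ weight q n i = wdeg k q n a := by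
  have hne : ((monomialBasis k q n).repr a).support.Nonempty := by
    rw [Finsupp.support_nonempty_iff]
    intro h0
    exact ha ((monomialBasis k q n).repr.map_eq_zero_iff.1 h0)
  obtain ⟨i, hi, h⟩ := Finset.exists_mem_eq_sup _ hne (weight q n)
  exact ⟨i, Finsupp.mem_support_iff.1 hi, h.symm⟩

/-- Two functions of equal pole order have the same leading monomial. -/
theorem exists_wdeg_sub_smul_lt {a b : CoordRing k q n} (ha : a ≠ 0) (hb : b ≠ 0)
    (h : wdeg k q n a = wdeg k q n b) :
    ∃ c : k, a - c • b = 0 ∨ wdeg k q n (a - c • b) < wdeg k q n b := by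
  set B := monomialBasis k q n with hB
  obtain ⟨i, hia, hi⟩ := exists_weight_eq_wdeg ha
  obtain ⟨j, hjb, hj⟩ := exists_weight_eq_wdeg hb
  obtain rfl : i = j := weight_injective q n (by rw [hi, hj, h])
  refine ⟨B.repr a i / B.repr b i, or_iff_not_imp_left.2 fun h0 => ?_⟩
  obtain ⟨l, hl, hl'⟩ := exists_weight_eq_wdeg h0
  rw [← hB, map_sub, map_smul, Finsupp.sub_apply, Finsupp.smul_apply, smul_eq_mul] at hl
  rw [← hl']
  refine lt_of_le_of_ne ?_ fun hlb => ?_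
  · by_contra hlt
    rw [not_le] at hlt
    have h1 : B.repr a l = 0 := by
      by_contra h1
      have := Finset.le_sup (f := weight q n) (Finsupp.mem_support_iff.2 h1)
      exact absurd (this.trans h.le) (not_le.2 hlt)
    have h2 : B.repr b l = 0 := by
      by_contra h2
      exact absurd (Finset.le_sup (f := weight q n) (Finsupp.mem_support_iff.2 h2)) (not_le.2 hlt)
    rw [h1, h2, mul_zero, sub_zero] at hl
    exact hl rfl
  · obtain rfl : i = l := weight_injective q n (by rw [hj, hlb])
    rw [div_mul_cancel₀ _ hjb, sub_self] at hl
    exact hl rfl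

end Infinity

end PlaneCurve

theorem Place.degree_eq_one_of_forall_exists {k F : Type*} [Field k] [Field F] [Algebra k F]
    {P : Place k F} (h : ∀ x ∈ P.ring, ∃ c : k, P.Vanishes (x - algebraMap k F c)) :
    P.degree = 1 := by
  have hs : Function.Surjective (algebraMap k (IsLocalRing.ResidueField P.ring)) := by
    intro x
    obtain ⟨x, rfl⟩ := IsLocalRing.residue_surjective x
    obtain ⟨c, y, hy, hyx⟩ := h x x.2
    refine ⟨c, ?_⟩
    have : algebraMap k (IsLocalRing.ResidueField P.ring) c =
      IsLocalRing.residue _ (algebraMap k P.ring c) := rfl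
    rw [this, eq_comm, ← sub_eq_zero, ← map_sub, IsLocalRing.residue_eq_zero_iff]
    have : y = x - algebraMap k P.ring c := Subtype.ext hyx
    exact this ▸ hy
  have e := AlgEquiv.ofBijective (Algebra.ofId k (IsLocalRing.ResidueField P.ring))
    ⟨(algebraMap k _).injective, hs⟩
  rw [Place.degree, ← e.toLinearEquiv.finrank_eq, Module.finrank_self]

namespace PlaneCurve

variable {k : Type*} [Field k] {q n : ℕ} [hq : Fact (IsPrimePow q)] [hn : Fact (Odd n)]

/-- The place at infinity is rational: the quotient of two functions of equal pole order differs
from a constant by a function that vanishes there. -/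
theorem degree_infinity : (infinity k q n).degree = 1 := by
  refine Place.degree_eq_one_of_forall_exists fun x hx => ?_
  have hw := infinity_isNormalized k q n
  simp only [hw.vanishes_iff]
  rw [hw.1] at hx
  by_cases hx0 : x = 0
  · exact ⟨0, by simp [hx0]⟩
  obtain ⟨a, b, hb, rfl⟩ := IsFractionRing.div_surjective (A := CoordRing k q n) x
  have hb0 := nonZeroDivisors.ne_zero hb
  have ha0 : a ≠ 0 := by rintro rfl; simp at hx0
  rcases ((wdeg_le_wdeg_iff ha0 hb0).2 hx).lt_or_eq with hlt | heq
  · refine ⟨0, ?_⟩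
    rw [map_zero, sub_zero, map_div₀, infinityValuation_algebraMap ha0,
      infinityValuation_algebraMap hb0, div_lt_one₀ exp_pos, exp_lt_exp, Nat.cast_lt]
    exact hlt
  · obtain ⟨c, hc⟩ := exists_wdeg_sub_smul_lt ha0 hb0 heq
    refine ⟨c, ?_⟩
    have hb' : algebraMap (CoordRing k q n) (FunField k q n) b ≠ 0 := by simpa using hb0
    have : algebraMap (CoordRing k q n) (FunField k q n) a / algebraMap _ _ b - algebraMap k _ c =
        algebraMap (CoordRing k q n) (FunField k q n) (a - c • b) / algebraMap _ _ b := by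
      rw [map_sub, Algebra.smul_def, map_mul, sub_div, mul_div_cancel_right₀ _ hb',
        ← IsScalarTower.algebraMap_apply]
    rw [this]
    by_cases h0 : a - c • b = 0
    · simp [h0]
    · rw [map_div₀, infinityValuation_algebraMap h0, infinityValuation_algebraMap hb0,
        div_lt_one₀ exp_pos, exp_lt_exp, Nat.cast_lt]
      exact hc.resolve_left h0

end PlaneCurve

/-! ### Pole orders at infinity and dimensions -/

namespace PlaneCurve

section Count

variable (q n : ℕ) [hq : Fact (IsPrimePow q)] [hn : Fact (Odd n)]

theorem finite_weight_le (m : ℕ) : Finite {i : ℕ × Fin (r q n) // weight q n i ≤ m} := by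
  refine Finite.of_injective (β := Fin (m + 1)) (fun i => ⟨weight q n i, Nat.lt_succ_of_le i.2⟩) ?_
  intro i j h
  exact Subtype.ext (weight_injective q n (Fin.mk.inj_iff.1 h))

/-- Up to a bound `m ≥ q ^ 2 (r - 1)`, the numerical semigroup generated by `r` and `q ^ 2` misses
`(q ^ 2 - 1) (r - 1) / 2` numbers. -/
theorem two_mul_card_weight_le {m : ℕ} (hm : q ^ 2 * (r q n - 1) ≤ m) :
    2 * Nat.card {i : ℕ × Fin (r q n) // weight q n i ≤ m} + (q ^ 2 - 1) * (r q n - 1) =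
      2 * m + 2 := by
  have hr := r_pos q n
  have hle : ∀ b < r q n, q ^ 2 * b ≤ m := fun b hb =>
    (Nat.mul_le_mul_left _ (by omega)).trans hm
  let e : {i : ℕ × Fin (r q n) // weight q n i ≤ m} ≃
      Σ b : Fin (r q n), Fin ((m - q ^ 2 * b) / r q n + 1) :=
    { toFun := fun i => ⟨i.1.2, i.1.1, by
        have h := i.2
        rw [weight] at h
        rw [Nat.lt_succ_iff, Nat.le_div_iff_mul_le hr, mul_comm]
        omega⟩
      invFun := fun s => ⟨(s.2, s.1), by
        have h := s.2.2
        rw [Nat.lt_succ_iff, Nat.le_div_iff_mul_le hr, mul_comm] at h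
        have := hle s.1 s.1.2
        rw [weight]
        dsimp only
        omega⟩
      left_inv := fun _ => rfl
      right_inv := fun _ => rfl }
  have hcard : Nat.card {i : ℕ × Fin (r q n) // weight q n i ≤ m} =
      ∑ b ∈ Finset.range (r q n), (m - q ^ 2 * b) / r q n + r q n := by
    rw [Nat.card_congr e, Nat.card_sigma, Finset.sum_range]
    simp [Finset.sum_add_distrib]
  -- The residues `(m - q ^ 2 b) % r` are a permutation of `0, …, r - 1`.
  have hinj : Set.InjOn (fun b => (m - q ^ 2 * b) % r q n) (Finset.range (r q n)) := by
    have key : ∀ b c, b < r q n → c < r q n → b ≤ c →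
        (m - q ^ 2 * b) % r q n = (m - q ^ 2 * c) % r q n → b = c := by
      intro b c hb hc hbc h
      have h1 : r q n ∣ (m - q ^ 2 * b) - (m - q ^ 2 * c) :=
        (Nat.modEq_iff_dvd' (Nat.sub_le_sub_left (Nat.mul_le_mul_left _ hbc) _)).1 h.symm
      have h2 : (m - q ^ 2 * b) - (m - q ^ 2 * c) = q ^ 2 * (c - b) := by
        have := hle c hc
        have := Nat.mul_le_mul_left (q ^ 2) hbc
        rw [Nat.mul_sub]
        omega
      rw [h2] at h1
      have h3 := ((coprime_r q n).pow_right 2).dvd_of_dvd_mul_left h1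
      have := Nat.eq_zero_of_dvd_of_lt h3 (by omega)
      omega
    intro b hb c hc h
    rw [Finset.coe_range, Set.mem_Iio] at hb hc
    rcases le_total b c with hbc | hbc
    · exact key b c hb hc hbc h
    · exact (key c b hc hb hbc h.symm).symm
  have himage : (Finset.range (r q n)).image (fun b => (m - q ^ 2 * b) % r q n) =
      Finset.range (r q n) := by
    refine Finset.eq_of_subset_of_card_le ?_ (Finset.card_image_of_injOn hinj).ge
    intro b hb
    obtain ⟨c, -, rfl⟩ := Finset.mem_image.1 hb
    exact Finset.mem_range.2 (Nat.mod_lt _ hr)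
  have hmod : ∑ b ∈ Finset.range (r q n), (m - q ^ 2 * b) % r q n =
      ∑ b ∈ Finset.range (r q n), b := by
    conv_rhs => rw [← himage]
    rw [Finset.sum_image hinj]
  have hdiv : r q n * ∑ b ∈ Finset.range (r q n), (m - q ^ 2 * b) / r q n +
      ∑ b ∈ Finset.range (r q n), (m - q ^ 2 * b) % r q n +
        q ^ 2 * ∑ b ∈ Finset.range (r q n), b = r q n * m := by
    rw [Finset.mul_sum, Finset.mul_sum, ← Finset.sum_add_distrib, ← Finset.sum_add_distrib]
    rw [Finset.sum_congr rfl (g := fun _ => m), Finset.sum_const, Finset.card_range, smul_eq_mul]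
    intro b hb
    have := hle b (Finset.mem_range.1 hb)
    rw [Nat.div_add_mod]
    omega
  have hsum := Finset.sum_range_id_mul_two (r q n)
  rw [hcard]
  rw [hmod] at hdiv
  generalize ∑ b ∈ Finset.range (r q n), (m - q ^ 2 * b) / r q n = A at hdiv ⊢
  generalize ∑ b ∈ Finset.range (r q n), b = S at hdiv hsum
  obtain ⟨R, hR⟩ : ∃ R, r q n = R + 1 := ⟨r q n - 1, by omega⟩
  obtain ⟨s, hs⟩ : ∃ s, q ^ 2 = s + 1 :=
    ⟨q ^ 2 - 1, by have := Nat.one_le_pow 2 q hq.out.pos; omega⟩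
  rw [hR, hs] at hdiv
  rw [hR, Nat.add_sub_cancel] at hsum
  rw [hR, hs, Nat.add_sub_cancel, Nat.add_sub_cancel]
  apply Nat.eq_of_mul_eq_mul_left R.succ_pos
  zify at hdiv hsum ⊢
  linear_combination 2 * hdiv - (2 + (s : ℤ)) * hsum

/-- The genus of the curve. -/
def genus : ℕ := (q ^ 2 - 1) * (r q n - 1) / 2

theorem two_mul_genus : 2 * genus q n = (q ^ 2 - 1) * (r q n - 1) := by
  have h := two_mul_card_weight_le q n le_rfl
  rw [genus]
  omega

theorem card_weight_le_add_genus {m : ℕ} (hm : q ^ 2 * (r q n - 1) ≤ m) :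
    Nat.card {i : ℕ × Fin (r q n) // weight q n i ≤ m} + genus q n = m + 1 := by
  have h := two_mul_card_weight_le q n hm
  have h' := two_mul_genus q n
  omega

end Count

variable {k : Type*} [Field k] {q n : ℕ} [hq : Fact (IsPrimePow q)] [hn : Fact (Odd n)]

instance finite_polesLE (m : ℕ) : Module.Finite k (polesLE k q n m) := by
  have := finite_weight_le q n m
  exact Module.Finite.span_of_finite k (Set.finite_range _)

theorem finrank_polesLE (m : ℕ) : Module.finrank k (polesLE k q n m) =
    Nat.card {i : ℕ × Fin (r q n) // weight q n i ≤ m} := by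
  have := finite_weight_le q n m
  have := Fintype.ofFinite {i : ℕ × Fin (r q n) // weight q n i ≤ m}
  rw [polesLE, finrank_span_eq_card, Nat.card_eq_fintype_card]
  exact (monomialBasis k q n).linearIndependent.comp _ Subtype.val_injective

theorem finrank_polesLE_add_genus {m : ℕ} (hm : q ^ 2 * (r q n - 1) ≤ m) :
    Module.finrank k (polesLE k q n m) + genus q n = m + 1 := by
  rw [finrank_polesLE, card_weight_le_add_genus q n hm]

theorem wdeg_mul_le (x y : CoordRing k q n) :
    wdeg k q n (x * y) ≤ wdeg k q n x + wdeg k q n y := by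
  by_cases hx : x = 0
  · simp [hx, wdeg]
  by_cases hy : y = 0
  · simp [hy, wdeg]
  exact (wdeg_mul hx hy).le

/-- The codimension of the ideal generated by `h` is at most the pole order of `h` at infinity. -/
theorem finrank_le_wdeg {V : Type*} [AddCommGroup V] [Module k V] [Module.Finite k V]
    (φ : CoordRing k q n →ₗ[k] V) (hφ : Function.Surjective φ) {h : CoordRing k q n} (h0 : h ≠ 0)
    (hφh : ∀ x, φ (h * x) = 0) : Module.finrank k V ≤ wdeg k q n h := by
  obtain ⟨s, hs⟩ := Module.Finite.fg_top (R := k) (M := V)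
  choose g hg using hφ
  set M₀ := s.sup (fun v => wdeg k q n (g v)) with hM₀
  set d := wdeg k q n h
  set M := M₀ + q ^ 2 * (r q n - 1) with hM
  -- for large `M`, the functions of pole order at most `M + d` map onto `V`, and the kernel contains
  -- the multiples of `h` by the functions of pole order at most `M`
  let ψ : polesLE k q n (M + d) →ₗ[k] V := φ.comp (Submodule.subtype _)
  have hψ : Function.Surjective ψ := by
    rw [← LinearMap.range_eq_top, eq_top_iff, ← hs, Submodule.span_le]
    intro v hv
    refine ⟨⟨g v, mem_polesLE_iff.2 ?_⟩, hg v⟩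
    have := Finset.le_sup (f := fun v => wdeg k q n (g v)) hv
    rw [← hM₀] at this
    omega
  let μ : polesLE k q n M →ₗ[k] LinearMap.ker ψ :=
    LinearMap.codRestrict _ (LinearMap.codRestrict _
      ((LinearMap.mulLeft k h).comp (Submodule.subtype _)) fun x => mem_polesLE_iff.2 (by
        have h1 := mem_polesLE_iff.1 x.2
        have h2 := wdeg_mul_le h (x : CoordRing k q n)
        change wdeg k q n (h * x) ≤ M + d
        omega)) fun x => LinearMap.mem_ker.2 (hφh x)
  have hμ : Function.Injective μ := by
    intro x y hxy
    have h1 : h * (x : CoordRing k q n) = h * y := 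
      congrArg (fun z : LinearMap.ker ψ => ((z : polesLE k q n (M + d)) : CoordRing k q n)) hxy
    exact Subtype.ext (mul_left_cancel₀ h0 h1)
  have h1 := LinearMap.finrank_le_finrank_of_injective hμ
  have h2 := ψ.finrank_range_add_finrank_ker
  rw [LinearMap.range_eq_top.2 hψ, finrank_top] at h2
  have h3 := finrank_polesLE_add_genus (k := k) (q := q) (n := n) (m := M) (by omega)
  have h4 := finrank_polesLE_add_genus (k := k) (q := q) (n := n) (m := M + d) (by omega)
  omega

end PlaneCurve

/-! ### The genus -/

namespace PlaneCurve

variable {k : Type*} [Field k] {q n : ℕ} [hq : Fact (IsPrimePow q)] [hn : Fact (Odd n)]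

/-- If `y` is integral at a place, then so is `z`, by the equation of the curve. -/
theorem algebraMap_mem_of_coordY_mem {P : Place k (FunField k q n)}
    (hP : algebraMap _ _ (coordY k q n) ∈ P.ring) (x : CoordRing k q n) :
    algebraMap _ _ x ∈ P.ring := by
  have hz : algebraMap _ _ (coordZ k q n) ∈ P.ring := by
    have h := congrArg (algebraMap _ (FunField k q n)) (coordZ_pow k q n)
    rw [map_pow, map_sub, map_pow] at h
    have h1 : algebraMap _ (FunField k q n) (coordZ k q n) ^ r q n ∈ P.ring := by
      rw [h]; exact sub_mem (pow_mem hP _) hP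
    rw [← ValuationSubring.valuation_le_one_iff, map_pow] at h1
    rw [← ValuationSubring.valuation_le_one_iff]
    exact (pow_le_one_iff_of_nonneg zero_le (r_pos q n).ne').1 h1
  have hx := (monomialBasis k q n).mem_span x
  induction hx using Submodule.span_induction with
  | mem x h =>
    obtain ⟨i, rfl⟩ := h
    rw [monomialBasis_apply, map_mul, map_pow, map_pow]
    exact P.ring.mul_mem _ _ (pow_mem hP _) (pow_mem hz _)
  | zero => rw [map_zero]; exact P.ring.zero_mem
  | add x y _ _ hx hy => rw [map_add]; exact P.ring.add_mem _ _ hx hy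
  | smul a x _ hx =>
    rw [Algebra.smul_def, map_mul, ← IsScalarTower.algebraMap_apply]
    exact P.ring.mul_mem _ _ (P.algebraMap_mem a) hx

instance finiteType_coordRing : Algebra.FiniteType k (CoordRing k q n) :=
  .trans (S := k[X]) inferInstance inferInstance

variable [IsDedekindDomain (CoordRing k q n)]

instance finite_quotient_heightOneSpectrum (v : HeightOneSpectrum (CoordRing k q n)) :
    Module.Finite k (CoordRing k q n ⧸ v.asIdeal) := by
  have := v.isMaximal
  let := Ideal.Quotient.field v.asIdeal
  exact finite_of_finite_type_of_isJacobsonRing k (CoordRing k q n ⧸ v.asIdeal)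

/-- The places of the curve: the point at infinity, and the maximal ideals of the coordinate
ring. -/
theorem eq_infinity_or_exists_eq (P : Place k (FunField k q n)) :
    P = infinity k q n ∨ ∃ v : HeightOneSpectrum (CoordRing k q n),
      P = Place.ofHeightOneSpectrum k (FunField k q n) v := by
  by_cases hP : algebraMap _ _ (coordY k q n) ∈ P.ring
  · exact Or.inr (Place.exists_eq_ofHeightOneSpectrum P (algebraMap_mem_of_coordY_mem hP))
  · exact Or.inl (eq_infinity hP)

theorem ofHeightOneSpectrum_ne_infinity (v : HeightOneSpectrum (CoordRing k q n)) :
    Place.ofHeightOneSpectrum k (FunField k q n) v ≠ infinity k q n := by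
  intro h
  apply coordY_notMem_infinity k q n
  rw [← h]
  exact Place.algebraMap_mem_ofHeightOneSpectrum v _

theorem mem_riemannRochSpace_iff (D : PlaceDivisor k (FunField k q n)) (f : FunField k q n) :
    f ∈ D.riemannRochSpace ↔ infinityValuation k q n f ≤ exp (D (infinity k q n)) ∧
      ∀ v : HeightOneSpectrum (CoordRing k q n),
        v.valuation _ f ≤ exp (D (Place.ofHeightOneSpectrum k _ v)) := by
  have h : f ∈ D.riemannRochSpace ↔ ∀ (P : Place k (FunField k q n)) (π : P.ring),
      Irreducible π → f * (π : FunField k q n) ^ D P ∈ P.ring := Iff.rfl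
  rw [h]
  constructor
  · intro h
    exact ⟨((infinity_isNormalized k q n).forall_mul_zpow_mem_iff _ _).1 (h _),
      fun v => ((Place.ofHeightOneSpectrum_isNormalized v).forall_mul_zpow_mem_iff _ _).1 (h _)⟩
  · rintro ⟨h1, h2⟩ P
    rcases eq_infinity_or_exists_eq P with rfl | ⟨v, rfl⟩
    · exact ((infinity_isNormalized k q n).forall_mul_zpow_mem_iff _ _).2 h1
    · exact ((Place.ofHeightOneSpectrum_isNormalized v).forall_mul_zpow_mem_iff _ _).2 (h2 v)

/-- A function with no poles at the finite places lies in the coordinate ring. -/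
theorem exists_mem_polesLE {f : FunField k q n} {m : ℤ}
    (h : infinityValuation k q n f ≤ exp m)
    (h' : ∀ v : HeightOneSpectrum (CoordRing k q n), v.valuation _ f ≤ 1) :
    ∃ x ∈ polesLE k q n m.toNat, algebraMap _ _ x = f := by
  obtain ⟨x, rfl⟩ := HeightOneSpectrum.mem_integers_of_valuation_le_one _ f h'
  refine ⟨x, ?_, rfl⟩
  by_cases hx : x = 0
  · rw [hx]; exact Submodule.zero_mem _
  have h : infinityValuation k q n (algebraMap _ _ x) ≤ exp m := h
  rw [infinityValuation_algebraMap hx, exp_le_exp] at h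
  rw [mem_polesLE_iff]
  omega

theorem finrank_riemannRochSpace_infinity (m : ℕ) :
    Module.finrank k (PlaceDivisor.riemannRochSpace (Finsupp.single (infinity k q n) (m : ℤ))) =
      Module.finrank k (polesLE k q n m) := by
  let ι := (IsScalarTower.toAlgHom k (CoordRing k q n) (FunField k q n)).toLinearMap
  have hι : Function.Injective ι := IsFractionRing.injective _ _
  have : PlaceDivisor.riemannRochSpace (Finsupp.single (infinity k q n) (m : ℤ)) =
      (polesLE k q n m).map ι := by
    ext f
    rw [mem_riemannRochSpace_iff, Finsupp.single_eq_same]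
    have h0 : ∀ v : HeightOneSpectrum (CoordRing k q n),
        (Finsupp.single (infinity k q n) (m : ℤ)) (Place.ofHeightOneSpectrum k _ v) = 0 :=
      fun v => Finsupp.single_eq_of_ne (ofHeightOneSpectrum_ne_infinity v)
    simp only [h0, exp_zero]
    constructor
    · rintro ⟨h1, h2⟩
      obtain ⟨x, hx, hxf⟩ := exists_mem_polesLE h1 h2
      rw [Int.toNat_natCast] at hx
      exact ⟨x, hx, hxf⟩
    · rintro ⟨x, hx, rfl⟩
      refine ⟨?_, fun v => v.valuation_le_one x⟩
      by_cases hx0 : x = 0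
      · rw [hx0, map_zero, map_zero]; exact zero_le
      · change infinityValuation k q n (algebraMap _ _ x) ≤ _
        rw [infinityValuation_algebraMap hx0, exp_le_exp]
        exact_mod_cast mem_polesLE_iff.1 hx
  rw [this]
  exact (Submodule.equivMapOfInjective ι hι _).finrank_eq.symm

theorem degree_eq (D : PlaceDivisor k (FunField k q n))
    (S : Finset (HeightOneSpectrum (CoordRing k q n)))
    (hS : ∀ v, v ∉ S → D (Place.ofHeightOneSpectrum k _ v) = 0) :
    D.degree = D (infinity k q n) + ∑ v ∈ S, D (Place.ofHeightOneSpectrum k _ v) *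
      (Module.finrank k (CoordRing k q n ⧸ v.asIdeal) : ℤ) := by
  classical
  have hsub : D.support ⊆ insert (infinity k q n)
      (S.image (Place.ofHeightOneSpectrum k (FunField k q n))) := by
    intro P hP
    rcases eq_infinity_or_exists_eq P with rfl | ⟨v, rfl⟩
    · exact Finset.mem_insert_self _ _
    · refine Finset.mem_insert_of_mem (Finset.mem_image_of_mem _ ?_)
      by_contra hv
      exact Finsupp.mem_support_iff.1 hP (hS v hv)
  rw [PlaceDivisor.degree, Finsupp.sum_of_support_subset D hsub (fun P m => m * (P.degree : ℤ))
      (fun _ _ => zero_mul _),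
    Finset.sum_insert, Finset.sum_image (Place.ofHeightOneSpectrum_injective.injOn),
    degree_infinity, Nat.cast_one, mul_one]
  · simp only [Place.degree_ofHeightOneSpectrum]
  · intro h
    obtain ⟨v, -, hv⟩ := Finset.mem_image.1 h
    exact ofHeightOneSpectrum_ne_infinity v hv

omit [IsDedekindDomain (CoordRing k q n)] in
/-- For every finite set of finite places with prescribed zeros there is a function in the
coordinate ring that has at least these zeros, and a pole of high order at infinity. -/
theorem exists_mem_prod_pow (S : Finset (HeightOneSpectrum (CoordRing k q n)))
    (a : HeightOneSpectrum (CoordRing k q n) → ℕ) (N : ℕ) :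
    ∃ p : CoordRing k q n, p ≠ 0 ∧ N ≤ wdeg k q n p ∧ ∀ v ∈ S, p ∈ v.asIdeal ^ a v := by
  have hJ : ∏ v ∈ S, v.asIdeal ^ a v ≠ ⊥ :=
    Finset.prod_ne_zero_iff.2 fun v _ => pow_ne_zero _ v.ne_bot
  obtain ⟨p, hp, hp0⟩ := Submodule.exists_mem_ne_zero_of_ne_bot hJ
  have hy0 : coordY k q n ≠ 0 := by
    intro h
    apply coordY_notMem_infinity k q n
    rw [h, map_zero]
    exact (infinity k q n).ring.zero_mem
  have hyN : wdeg k q n (coordY k q n ^ N) = r q n * N := by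
    have h := infinityValuation_algebraMap (pow_ne_zero N hy0)
    rw [map_pow, map_pow, (isInfinite_infinityValuation k q n).map_y, ← pow_mul, ← exp_nsmul,
      exp_inj] at h
    rw [nsmul_eq_mul, mul_one] at h
    exact_mod_cast h.symm
  refine ⟨p * coordY k q n ^ N, mul_ne_zero hp0 (pow_ne_zero _ hy0), ?_, fun v hv => ?_⟩
  · rw [wdeg_mul hp0 (pow_ne_zero _ hy0), hyN]
    have := Nat.mul_le_mul_right N (r_pos q n)
    omega
  · exact Ideal.mul_mem_right _ _ (Ideal.le_of_dvd (Finset.dvd_prod_of_mem _ hv) hp)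

/-- Riemann's inequality. For a nonzero `p` in the coordinate ring with sufficiently many zeros, the
quotients `x / p` lie in `L(D)` if `x` has bounded pole order and lies in the ideal `I` that is
prescribed by `D` and the zeros of `p`; the dimension of the space of these `x` is at least the
number of functions of that pole order minus the codimension of `I`. -/
theorem degree_sub_finrank_le_genus (D : PlaceDivisor k (FunField k q n)) :
    D.degree - (Module.finrank k D.riemannRochSpace : ℤ) + 1 ≤ genus q n := by
  classical
  let ofv := Place.ofHeightOneSpectrum k (FunField k q n) (R := CoordRing k q n)
  set S₀ : Finset (HeightOneSpectrum (CoordRing k q n)) :=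
    D.support.preimage ofv Place.ofHeightOneSpectrum_injective.injOn with hS₀
  have hDS₀ : ∀ v, v ∉ S₀ → D (ofv v) = 0 := by
    intro v hv
    rw [hS₀, Finset.mem_preimage, Finsupp.notMem_support_iff] at hv
    exact hv
  obtain ⟨p, hp0, hpN, hpS⟩ := exists_mem_prod_pow S₀ (fun v => (D (ofv v)).toNat)
    ((D (infinity k q n)).natAbs + q ^ 2 * (r q n - 1))
  have hexp : ∀ v : HeightOneSpectrum (CoordRing k q n), ∃ e : ℕ,
      v.intValuation p = exp (-(e : ℤ)) := fun v => ⟨_, v.intValuation_if_neg hp0⟩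
  choose e he using hexp
  have hfin := Ideal.finite_factors (I := Ideal.span {p}) (by simpa using hp0)
  set S := S₀ ∪ hfin.toFinset with hS
  have heS : ∀ v, v ∉ S → e v = 0 := by
    intro v hv
    have h1 : ¬ v.intValuation p < 1 := by
      rw [v.intValuation_lt_one_iff_dvd]
      intro h
      exact hv (Finset.mem_union_right _ (hfin.mem_toFinset.2 h))
    rw [he, ← exp_zero, exp_lt_exp] at h1
    omega
  have hDS : ∀ v, v ∉ S → D (ofv v) = 0 := fun v hv =>
    hDS₀ v fun h => hv (Finset.mem_union_left _ h)
  have hDe : ∀ v, D (ofv v) ≤ e v := by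
    intro v
    by_cases hv : v ∈ S₀
    · have h1 := (v.intValuation_le_pow_iff_mem p _).2 (hpS v hv)
      rw [he, exp_le_exp] at h1
      omega
    · rw [hDS₀ v hv]; omega
  set a : HeightOneSpectrum (CoordRing k q n) → ℕ := fun v => (e v - D (ofv v)).toNat with ha
  have haD : ∀ v, (a v : ℤ) = e v - D (ofv v) := fun v => by
    have := hDe v
    rw [ha]
    dsimp only
    omega
  obtain ⟨hfinE, hdimE⟩ := finrank_quotient_prod (k := k) S e
  obtain ⟨hfinI, hdimI⟩ := finrank_quotient_prod (k := k) S a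
  set E := ∏ v ∈ S, v.asIdeal ^ e v with hE
  set I := ∏ v ∈ S, v.asIdeal ^ a v with hI
  have hpE : p ∈ E := by
    rw [hE, ← IsDedekindDomain.inf_pow_eq_prod_of_prime S (fun v => v.asIdeal) e
      (fun v _ => v.prime) (fun v _ w _ hvw h => hvw (HeightOneSpectrum.ext h))]
    rw [Submodule.mem_finsetInf]
    intro v _
    exact (v.intValuation_le_pow_iff_mem p _).1 (he v).le
  have hEp : Module.finrank k (CoordRing k q n ⧸ E) ≤ wdeg k q n p :=
    finrank_le_wdeg (Ideal.Quotient.mkₐ k E).toLinearMap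
      (Ideal.Quotient.mkₐ_surjective k E) hp0
      fun x => Ideal.Quotient.eq_zero_iff_mem.2 (Ideal.mul_mem_right _ _ hpE)
  -- The functions `x / p` with `x` in `I` and of bounded pole order lie in `L(D)`.
  obtain ⟨M, hM⟩ : ∃ M : ℕ, (M : ℤ) = D (infinity k q n) + wdeg k q n p :=
    ⟨(D (infinity k q n) + wdeg k q n p).toNat, by omega⟩
  let φ : CoordRing k q n →ₗ[k] FunField k q n :=
    (LinearMap.mulRight k (algebraMap _ (FunField k q n) p)⁻¹).comp
      (IsScalarTower.toAlgHom k (CoordRing k q n) (FunField k q n)).toLinearMap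
  have hφ : ∀ x, φ x = algebraMap _ _ x / algebraMap _ _ p := fun x => by
    rw [div_eq_mul_inv]; rfl
  have hp0' : algebraMap _ (FunField k q n) p ≠ 0 := by simpa using hp0
  have hφinj : Function.Injective φ := by
    intro x y h
    rw [hφ, hφ, div_left_inj' hp0'] at h
    exact IsFractionRing.injective _ _ h
  have hLfin : Module.Finite k D.riemannRochSpace := by
    have hle : D.riemannRochSpace ≤ (polesLE k q n M).map φ := by
      intro f hf
      obtain ⟨h1, h2⟩ := (mem_riemannRochSpace_iff D f).1 hf
      obtain ⟨x, hx, hxf⟩ := exists_mem_polesLE (f := f * algebraMap _ _ p) (m := M)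
        (by
          rw [map_mul, infinityValuation_algebraMap hp0, hM, exp_add]
          exact mul_le_mul_left h1 _)
        (fun v => by
          rw [map_mul, v.valuation_of_algebraMap, he]
          refine (mul_le_mul_left (h2 v) _).trans ?_
          rw [← exp_add, ← exp_zero, exp_le_exp]
          have := hDe v
          change D (ofv v) + _ ≤ _
          omega)
      refine ⟨x, by simpa using hx, ?_⟩
      rw [hφ, hxf, mul_div_cancel_right₀ _ hp0']
    exact Submodule.finiteDimensional_of_le hle
  let ψ : polesLE k q n M →ₗ[k] (CoordRing k q n ⧸ I) :=
    (Ideal.Quotient.mkₐ k I).toLinearMap.comp (Submodule.subtype _)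
  have hmem : ∀ x : LinearMap.ker ψ, φ ((x : polesLE k q n M) : CoordRing k q n) ∈
      D.riemannRochSpace := by
    rintro ⟨⟨x, hxM⟩, hx⟩
    have hxI : x ∈ I := Ideal.Quotient.eq_zero_iff_mem.1 hx
    rw [mem_riemannRochSpace_iff, hφ]
    by_cases hx0 : x = 0
    · simp [hx0]
    constructor
    · rw [map_div₀, infinityValuation_algebraMap hx0, infinityValuation_algebraMap hp0, ← exp_sub,
        exp_le_exp]
      have := mem_polesLE_iff.1 hxM
      omega
    · intro v
      have hxv : v.intValuation x ≤ exp (-(a v : ℤ)) := by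
        by_cases hv : v ∈ S
        · exact (v.intValuation_le_pow_iff_mem x _).2
            (Ideal.le_of_dvd (Finset.dvd_prod_of_mem _ hv) hxI)
        · have : a v = 0 := by
            have h1 := haD v
            rw [heS v hv, hDS v hv] at h1
            omega
          rw [this]
          exact v.intValuation_le_one x
      rw [map_div₀, v.valuation_of_algebraMap, v.valuation_of_algebraMap, he, div_le_iff₀ exp_pos,
        ← exp_add]
      refine hxv.trans ?_
      rw [exp_le_exp, haD]
      change _ ≤ D (ofv v) + _
      omega
  let μ : LinearMap.ker ψ →ₗ[k] D.riemannRochSpace :=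
    LinearMap.codRestrict _ (φ.comp ((Submodule.subtype _).comp (Submodule.subtype _))) hmem
  have hμ : Function.Injective μ := by
    intro x y h
    exact Subtype.ext (Subtype.ext (hφinj (congrArg Subtype.val h)))
  have h1 := LinearMap.finrank_le_finrank_of_injective hμ
  have h2 := ψ.finrank_range_add_finrank_ker
  have h3 := Submodule.finrank_le (LinearMap.range ψ)
  have h4 := finrank_polesLE_add_genus (k := k) (q := q) (n := n) (m := M) (by omega)
  have h5 := degree_eq D S hDS
  have h6 : ∑ v ∈ S, D (ofv v) * (Module.finrank k (CoordRing k q n ⧸ v.asIdeal) : ℤ) =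
      Module.finrank k (CoordRing k q n ⧸ E) - Module.finrank k (CoordRing k q n ⧸ I) := by
    rw [hdimE, hdimI, Nat.cast_sum, Nat.cast_sum, ← Finset.sum_sub_distrib]
    refine Finset.sum_congr rfl fun v _ => ?_
    push_cast
    rw [haD]
    ring
  rw [h5]
  change _ + ∑ v ∈ S, D (ofv v) * _ - _ + _ ≤ _
  rw [h6]
  omega

/-- The maximum is attained at a large multiple of the place at infinity. -/
theorem hasGenus_genus : HasGenus k (FunField k q n) (genus q n) := by
  constructor
  · refine ⟨Finsupp.single (infinity k q n) ((q ^ 2 * (r q n - 1) : ℕ) : ℤ), ?_⟩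
    dsimp only
    rw [finrank_riemannRochSpace_infinity, PlaceDivisor.degree, Finsupp.sum_single_index (by simp),
      degree_infinity]
    have := finrank_polesLE_add_genus (k := k) (q := q) (n := n) le_rfl
    omega
  · rintro _ ⟨D, rfl⟩
    exact degree_sub_finrank_le_genus D

end PlaneCurve

/-! ### The places at the affine rational points -/

namespace PlaneCurve

variable {k : Type*} [Field k] {q n : ℕ}

theorem eval₂_equation {β γ : k} (h : β ^ q ^ 2 - β = γ ^ r q n) :
    eval₂ (evalRingHom β) γ (equation k q n) = 0 := by
  rw [equation, eval₂_sub, eval₂_X_pow, eval₂_C, coe_evalRingHom, ← h]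
  simp

/-- The evaluation of functions at an affine point of the curve. -/
noncomputable def evalAt {β γ : k} (h : β ^ q ^ 2 - β = γ ^ r q n) : CoordRing k q n →ₐ[k] k where
  toRingHom := AdjoinRoot.lift (evalRingHom β) γ (eval₂_equation h)
  commutes' a := by
    have : algebraMap k (CoordRing k q n) a = AdjoinRoot.of (equation k q n) (C a) := rfl
    rw [this]
    simp

variable {β γ : k} (h : β ^ q ^ 2 - β = γ ^ r q n)

theorem evalAt_mk (G : k[X][Y]) : evalAt h (AdjoinRoot.mk _ G) = G.evalEval β γ := by
  refine (AdjoinRoot.lift_mk (eval₂_equation h) G).trans ?_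
  rw [eval₂_evalRingHom]

theorem evalAt_coordY : evalAt h (coordY k q n) = β := by
  rw [coordY, evalAt_mk, evalEval_C, eval_X]

theorem evalAt_coordZ : evalAt h (coordZ k q n) = γ := by
  rw [coordZ, evalAt_mk, evalEval_X]

theorem evalAt_surjective : Function.Surjective (evalAt h) := fun a =>
  ⟨algebraMap _ _ a, (evalAt h).commutes a⟩

/-- Algebra homomorphisms from the coordinate ring are determined by the images of `y` and `z`. -/
theorem algHom_coordRing_ext {A : Type*} [CommRing A] [Algebra k A] {φ ψ : CoordRing k q n →ₐ[k] A}
    (hy : φ (coordY k q n) = ψ (coordY k q n)) (hz : φ (coordZ k q n) = ψ (coordZ k q n)) :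
    φ = ψ := by
  have hring : (φ : CoordRing k q n →+* A) = ψ := by
    refine Ideal.Quotient.ringHom_ext (Polynomial.ringHom_ext' (Polynomial.ringHom_ext' ?_ ?_) ?_)
    · ext a
      exact (φ.commutes a).trans (ψ.commutes a).symm
    · exact hy
    · exact hz
  exact AlgHom.coe_ringHom_injective hring

variable [hq : Fact (IsPrimePow q)] [hn : Fact (Odd n)]

/-- The function `y` has a pole at infinity, so it is not constant. -/
theorem coordY_ne_algebraMap (a : k) : coordY k q n ≠ algebraMap _ _ a := by
  intro h
  apply coordY_notMem_infinity k q n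
  rw [h, ← IsScalarTower.algebraMap_apply]
  exact (infinity k q n).algebraMap_mem a

/-- The maximal ideal of an affine rational point of the curve. -/
noncomputable def pointPrime : HeightOneSpectrum (CoordRing k q n) where
  asIdeal := RingHom.ker (evalAt h)
  isPrime := RingHom.ker_isPrime _
  ne_bot h0 := by
    have h1 : coordY k q n - algebraMap _ _ β ∈ RingHom.ker (evalAt h) := by
      rw [RingHom.mem_ker, map_sub, evalAt_coordY, AlgHom.commutes]
      exact sub_self β
    rw [h0, Ideal.mem_bot, sub_eq_zero] at h1
    exact coordY_ne_algebraMap β h1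

theorem mem_pointPrime_iff {x : CoordRing k q n} :
    x ∈ (pointPrime h).asIdeal ↔ evalAt h x = 0 := Iff.rfl

variable [IsDedekindDomain (CoordRing k q n)]

theorem eq_pointPrime_of_mem {v : HeightOneSpectrum (CoordRing k q n)}
    (hy : coordY k q n - algebraMap _ _ β ∈ v.asIdeal)
    (hz : coordZ k q n - algebraMap _ _ γ ∈ v.asIdeal) : v = pointPrime h := by
  have hφ : Ideal.Quotient.mkₐ k v.asIdeal =
      (Algebra.ofId k (CoordRing k q n ⧸ v.asIdeal)).comp (evalAt h) := by
    apply algHom_coordRing_ext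
    · rw [AlgHom.comp_apply, evalAt_coordY]
      exact Ideal.Quotient.eq.2 hy
    · rw [AlgHom.comp_apply, evalAt_coordZ]
      exact Ideal.Quotient.eq.2 hz
  have hle : (pointPrime h).asIdeal ≤ v.asIdeal := by
    intro x hx
    rw [mem_pointPrime_iff] at hx
    have := congrArg (fun φ => φ x) hφ
    rw [AlgHom.comp_apply, hx, map_zero] at this
    exact Ideal.Quotient.eq_zero_iff_mem.1 this
  exact HeightOneSpectrum.ext ((pointPrime h).isMaximal.eq_of_le v.isPrime.ne_top hle).symm

theorem isAt_iff {P : Place k (FunField k q n)} :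
    IsAt P (β, γ) ↔ P = Place.ofHeightOneSpectrum k _ (pointPrime h) := by
  have hy : (toFun (C (X - C β)) : FunField k q n) =
      algebraMap _ _ (coordY k q n - algebraMap _ _ β) := by
    rw [toFun, C_sub, map_sub]; rfl
  have hz : (toFun (X - C (C γ)) : FunField k q n) =
      algebraMap _ _ (coordZ k q n - algebraMap _ _ γ) := by
    rw [toFun, map_sub]; rfl
  rw [IsAt, hy, hz]
  constructor
  · rintro ⟨h1, h2⟩
    rcases eq_infinity_or_exists_eq P with rfl | ⟨v, rfl⟩
    · exfalso
      obtain ⟨x, -, hx⟩ := h1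
      apply coordY_notMem_infinity k q n
      rw [map_sub, ← IsScalarTower.algebraMap_apply] at hx
      rw [eq_add_of_sub_eq hx.symm]
      exact add_mem x.2 (Place.algebraMap_mem _ β)
    · rw [Place.vanishes_ofHeightOneSpectrum_iff] at h1 h2
      rw [eq_pointPrime_of_mem h h1 h2]
  · rintro rfl
    rw [Place.vanishes_ofHeightOneSpectrum_iff, Place.vanishes_ofHeightOneSpectrum_iff,
      mem_pointPrime_iff, mem_pointPrime_iff, map_sub, map_sub, evalAt_coordY, evalAt_coordZ,
      AlgHom.commutes, AlgHom.commutes]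
    exact ⟨sub_self _, sub_self _⟩

omit [IsDedekindDomain (CoordRing k q n)] in
theorem finrank_quotient_pointPrime :
    Module.finrank k (CoordRing k q n ⧸ (pointPrime h).asIdeal) = 1 := by
  rw [← Module.finrank_self k]
  exact (Ideal.quotientKerAlgEquivOfSurjective (evalAt_surjective h)).toLinearEquiv.finrank_eq

theorem degree_pointPrime :
    (Place.ofHeightOneSpectrum k (FunField k q n) (pointPrime h)).degree = 1 := by
  rw [Place.degree_ofHeightOneSpectrum, finrank_quotient_pointPrime]

theorem exists_eq_pointPrime {v : HeightOneSpectrum (CoordRing k q n)}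
    (hv : Function.Surjective (algebraMap k (CoordRing k q n ⧸ v.asIdeal))) :
    ∃ (β γ : k) (h : β ^ q ^ 2 - β = γ ^ r q n), v = pointPrime h := by
  obtain ⟨β, hβ⟩ := hv (Ideal.Quotient.mk _ (coordY k q n))
  obtain ⟨γ, hγ⟩ := hv (Ideal.Quotient.mk _ (coordZ k q n))
  have h : β ^ q ^ 2 - β = γ ^ r q n := by
    apply (algebraMap k (CoordRing k q n ⧸ v.asIdeal)).injective
    rw [map_sub, map_pow, map_pow, hβ, hγ, ← map_pow, ← map_pow, ← map_sub, coordZ_pow]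
  exact ⟨β, γ, h, eq_pointPrime_of_mem h (Ideal.Quotient.eq.1 hβ.symm) (Ideal.Quotient.eq.1 hγ.symm)⟩

/-- The rational places are the place at infinity and those at the affine rational points. -/
theorem card_degree_one [Finite k] :
    Nat.card {P : Place k (FunField k q n) // P.degree = 1} =
      Nat.card {Q : k × k // Q.1 ^ q ^ 2 - Q.1 = Q.2 ^ r q n} + 1 := by
  -- `none` stands for the place at infinity
  let φ : Option {Q : k × k // Q.1 ^ q ^ 2 - Q.1 = Q.2 ^ r q n} →
      {P : Place k (FunField k q n) // P.degree = 1} := fun o =>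
    match o with
    | none => ⟨infinity k q n, degree_infinity⟩
    | some Q => ⟨Place.ofHeightOneSpectrum k _ (pointPrime Q.2), degree_pointPrime Q.2⟩
  have hφ : Function.Bijective φ := by
    constructor
    · rintro (_ | Q) (_ | Q') h
      · rfl
      · exact absurd (congrArg Subtype.val h).symm (ofHeightOneSpectrum_ne_infinity _)
      · exact absurd (congrArg Subtype.val h) (ofHeightOneSpectrum_ne_infinity _)
      · have h1 := Place.ofHeightOneSpectrum_injective (congrArg Subtype.val h)
        have key : ∀ x : CoordRing k q n, evalAt Q.2 x = 0 → evalAt Q'.2 x = 0 := by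
          intro x hx
          rw [← mem_pointPrime_iff] at hx ⊢
          rwa [← h1]
        have hy := key (coordY k q n - algebraMap _ _ Q.1.1) (by
          rw [map_sub, evalAt_coordY, AlgHom.commutes]; exact sub_self _)
        have hz := key (coordZ k q n - algebraMap _ _ Q.1.2) (by
          rw [map_sub, evalAt_coordZ, AlgHom.commutes]; exact sub_self _)
        rw [map_sub, evalAt_coordY, AlgHom.commutes] at hy
        rw [map_sub, evalAt_coordZ, AlgHom.commutes] at hz
        exact congrArg some (Subtype.ext (Prod.ext (sub_eq_zero.1 hy).symm (sub_eq_zero.1 hz).symm))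
    · rintro ⟨P, hP⟩
      rcases eq_infinity_or_exists_eq P with rfl | ⟨v, rfl⟩
      · exact ⟨none, rfl⟩
      · rw [Place.degree_ofHeightOneSpectrum] at hP
        have hs : Function.Surjective (algebraMap k (CoordRing k q n ⧸ v.asIdeal)) := by
          have := v.isMaximal
          intro x
          obtain ⟨c, hc⟩ := (finrank_eq_one_iff_of_nonzero' (1 : CoordRing k q n ⧸ v.asIdeal)
            one_ne_zero).1 hP x
          exact ⟨c, by rw [Algebra.algebraMap_eq_smul_one, hc]⟩
        obtain ⟨β, γ, h, rfl⟩ := exists_eq_pointPrime hs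
        exact ⟨some ⟨(β, γ), h⟩, rfl⟩
  rw [← Nat.card_eq_of_bijective φ hφ, Finite.card_option]

end PlaneCurve

/-! ### Counting with homomorphisms of finite groups -/

section FiniteGroups

/-- If a finite group has `a * b` elements and the kernel and the range of a homomorphism have at
most `a` and `b` elements, then these bounds are attained. -/
@[to_additive]
theorem MonoidHom.card_ker_and_card_range_of_le {G H : Type*} [Group G] [Group H] [Finite G]
    (f : G →* H) {a b : ℕ} (hG : Nat.card G = a * b) (hker : Nat.card f.ker ≤ a)
    (hrange : Nat.card f.range ≤ b) : Nat.card f.ker = a ∧ Nat.card f.range = b := by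
  have h := f.ker.card_mul_index
  rw [Subgroup.index_ker, hG] at h
  have hpos : 0 < a * b := hG ▸ Nat.card_pos
  have ha := Nat.pos_of_mul_pos_right hpos
  have hb := Nat.pos_of_mul_pos_left hpos
  constructor
  · refine hker.antisymm (le_of_mul_le_mul_right ?_ hb)
    rw [← h]
    exact Nat.mul_le_mul_left _ hrange
  · refine hrange.antisymm (le_of_mul_le_mul_left ?_ ha)
    rw [← h]
    exact Nat.mul_le_mul_right _ hker

@[to_additive]
theorem MonoidHom.card_fiber {G H : Type*} [Group G] [Group H] (f : G →* H) {y : H}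
    (hy : y ∈ f.range) : Nat.card {x // f x = y} = Nat.card f.ker := by
  obtain ⟨x, rfl⟩ := hy
  exact Nat.card_congr (f.fiberEquivKer x)

/-- If every fiber over `s` of a map from `p` to `s` has `c` elements, then `p` has `c` times as
many elements as `s`. -/
theorem Nat.card_subtype_eq_mul_of_fiber {α β : Type*} [Finite α] [Finite β] {p : α → Prop}
    {s : β → Prop} (f : α → β) {c : ℕ} (hf : ∀ x, p x → s (f x))
    (hc : ∀ y, s y → Nat.card {x // p x ∧ f x = y} = c) :
    Nat.card {x // p x} = Nat.card {y // s y} * c := by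
  have := Fintype.ofFinite {y // s y}
  let φ : {x // p x} → {y // s y} := fun x => ⟨f x, hf x x.2⟩
  have key : ∀ y, Nat.card {x // φ x = y} = c := fun y => by
    rw [← hc y y.2]
    refine Nat.card_congr ⟨fun x => ⟨x.1, x.1.2, congrArg Subtype.val x.2⟩,
      fun x => ⟨⟨x.1, x.2.1⟩, Subtype.ext x.2.2⟩, fun _ => rfl, fun _ => rfl⟩
  rw [← Nat.card_congr (Equiv.sigmaFiberEquiv φ), Nat.card_sigma, Finset.sum_congr rfl
    fun y _ => key y, Finset.sum_const, smul_eq_mul, Finset.card_univ, Nat.card_eq_fintype_card]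

variable {k : Type*} [Field k]

theorem natCard_subtype_le_of_eval_eq_zero {p : k[X]} (hp : p ≠ 0) {d : ℕ}
    (hd : p.natDegree ≤ d) {s : k → Prop} (h : ∀ x, s x → p.eval x = 0) :
    Nat.card {x // s x} ≤ d := by
  classical
  refine le_trans ?_ hd
  refine le_trans ?_ (p.roots.toFinset_card_le.trans p.card_roots')
  rw [← Nat.card_eq_finsetCard]
  have := p.roots.toFinset.finite_toSet
  refine Nat.card_le_card_of_injective (β := p.roots.toFinset)
    (fun x => ⟨x, by simpa [hp] using h x x.2⟩) fun x y hxy => ?_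
  exact Subtype.ext (by simpa using hxy)

variable [Finite k]

theorem natCard_eq_natCard_units_add_one {s : k → Prop} (h0 : s 0) :
    Nat.card {x // s x} = Nat.card {u : kˣ // s u} + 1 := by
  classical
  rw [← Finite.card_option]
  refine (Nat.card_congr (Equiv.ofBijective (fun o : Option {u : kˣ // s u} =>
    (o.elim ⟨0, h0⟩ fun u => ⟨u.1, u.2⟩ : {x // s x})) ⟨?_, ?_⟩)).symm
  · rintro (_ | u) (_ | v) h
    · rfl
    · exact absurd (congrArg Subtype.val h).symm v.1.ne_zero
    · exact absurd (congrArg Subtype.val h) u.1.ne_zero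
    · exact congrArg some (Subtype.ext (Units.ext (congrArg Subtype.val h)))
  · rintro ⟨x, hx⟩
    by_cases hx0 : x = 0
    · exact ⟨none, Subtype.ext hx0.symm⟩
    · exact ⟨some ⟨Units.mk0 x hx0, hx⟩, rfl⟩

theorem natCard_units_pow_eq_one_le {a : ℕ} (ha : 0 < a) {s : kˣ → Prop}
    (h : ∀ u, s u → u ^ a = 1) : Nat.card {u // s u} ≤ a := by
  have : Nat.card {x : k // x ^ a = 1} ≤ a :=
    natCard_subtype_le_of_eval_eq_zero (X_pow_sub_C_ne_zero ha (1 : k))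
      natDegree_X_pow_sub_C.le fun x hx => by simp [hx]
  refine le_trans (Nat.card_le_card_of_injective (β := {x : k // x ^ a = 1})
    (fun u => ⟨u.1, by rw [← Units.val_pow_eq_pow_val, h u u.2, Units.val_one]⟩) ?_) this
  exact fun u v huv => Subtype.ext (Units.ext (congrArg Subtype.val huv))

/-- For `a * b = |kˣ|`, the map `u ↦ u ^ a` has `a` elements in its kernel, and its range is the
kernel of `u ↦ u ^ b`. -/
theorem card_ker_and_range_powMonoidHom {a b : ℕ} (hab : Nat.card kˣ = a * b) :
    Nat.card (powMonoidHom a : kˣ →* kˣ).ker = a ∧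
      (powMonoidHom a : kˣ →* kˣ).range = (powMonoidHom b : kˣ →* kˣ).ker := by
  have hpos : 0 < a * b := hab ▸ Nat.card_pos
  have ha := Nat.pos_of_mul_pos_right hpos
  have hb := Nat.pos_of_mul_pos_left hpos
  have hle : (powMonoidHom a : kˣ →* kˣ).range ≤ (powMonoidHom b : kˣ →* kˣ).ker := by
    rintro _ ⟨u, rfl⟩
    rw [MonoidHom.mem_ker, powMonoidHom_apply, powMonoidHom_apply, ← pow_mul, ← hab,
      pow_card_eq_one']
  have hkb : Nat.card (powMonoidHom b : kˣ →* kˣ).ker ≤ b :=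
    natCard_units_pow_eq_one_le hb fun u hu => hu
  have hka : Nat.card (powMonoidHom a : kˣ →* kˣ).ker ≤ a :=
    natCard_units_pow_eq_one_le ha fun u hu => hu
  obtain ⟨h1, h2⟩ := MonoidHom.card_ker_and_card_range_of_le _ hab hka
    ((Subgroup.card_le_of_le hle).trans hkb)
  exact ⟨h1, Subgroup.eq_of_le_of_card_ge hle (by rw [h2]; exact hkb)⟩

end FiniteGroups

/-! ### The number of rational points -/

namespace PlaneCurve

section RationalPoints

variable {k : Type*} [Field k] {q n : ℕ} [hq : Fact (IsPrimePow q)] (hK : (q : k) = 0)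

/-- The field endomorphism `x ↦ x ^ q ^ e`. -/
noncomputable def powHom (e : ℕ) : k →+* k := (exists_ringHom_pow hK k e).choose

theorem powHom_apply (e : ℕ) (x : k) : powHom hK e x = x ^ q ^ e :=
  (exists_ringHom_pow hK k e).choose_spec x

/-- The additive map `y ↦ y ^ (q ^ 2) - y`. -/
noncomputable def artinSchreier : k →+ k := (powHom hK 2 : k →+ k) - AddMonoidHom.id k

theorem artinSchreier_apply (y : k) : artinSchreier hK y = y ^ q ^ 2 - y := by
  simp [artinSchreier, powHom_apply]

/-- The trace `x ↦ ∑ x ^ (q ^ (2 j))` from the field with `q ^ (2 n)` elements to the one with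
`q ^ 2` elements. -/
noncomputable def traceHom (n : ℕ) : k →+ k := ∑ j ∈ Finset.range n, (powHom hK (2 * j) : k →+ k)

theorem traceHom_apply (n : ℕ) (x : k) :
    traceHom hK n x = ∑ j ∈ Finset.range n, x ^ q ^ (2 * j) := by
  simp [traceHom, powHom_apply]

theorem traceHom_artinSchreier (n : ℕ) (x : k) :
    traceHom hK n (artinSchreier hK x) = x ^ q ^ (2 * n) - x := by
  have := Finset.sum_range_sub (fun j => x ^ q ^ (2 * j)) n
  simp only [mul_zero, pow_zero, pow_one] at this
  rw [← this, traceHom_apply]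
  refine Finset.sum_congr rfl fun j _ => ?_
  rw [← powHom_apply hK, artinSchreier_apply, map_sub, map_pow, powHom_apply, ← pow_mul, ← pow_add,
    mul_add]

variable [Finite k]

omit [Finite k] in
theorem natCard_ker_artinSchreier_le : Nat.card (artinSchreier hK).ker ≤ q ^ 2 := by
  have hq1 : 1 < q ^ 2 := Nat.one_lt_pow two_ne_zero one_lt_q
  refine natCard_subtype_le_of_eval_eq_zero (p := X ^ q ^ 2 - X) ?_ ?_ fun x hx => ?_
  · exact FiniteField.X_pow_card_sub_X_ne_zero k hq1
  · exact (FiniteField.X_pow_card_sub_X_natDegree_eq k hq1).le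
  · rw [AddMonoidHom.mem_ker, artinSchreier_apply] at hx
    simpa using hx

omit [Finite k] hq in
theorem derivative_X_pow_q_pow (hK : (q : k) = 0) {e : ℕ} (he : e ≠ 0) :
    derivative (X ^ q ^ e : k[X]) = 0 := by
  rw [derivative_X_pow, Nat.cast_pow, hK, zero_pow he, C_0, zero_mul]

omit [Finite k] in
theorem natCard_ker_traceHom_le (hn : n ≠ 0) :
    Nat.card (traceHom hK n).ker ≤ q ^ (2 * (n - 1)) := by
  obtain ⟨m, rfl⟩ := Nat.exists_eq_succ_of_ne_zero hn
  refine natCard_subtype_le_of_eval_eq_zero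
    (p := ∑ j ∈ Finset.range (m + 1), X ^ q ^ (2 * j)) ?_ ?_ fun x hx => ?_
  · have : derivative (∑ j ∈ Finset.range (m + 1), X ^ q ^ (2 * j) : k[X]) = 1 := by
      rw [Finset.sum_range_succ', derivative_add, derivative_sum,
        Finset.sum_eq_zero fun j _ => derivative_X_pow_q_pow hK (by omega)]
      simp
    intro h0
    rw [h0, derivative_zero] at this
    exact zero_ne_one this
  · refine natDegree_sum_le_of_forall_le _ _ fun j hj => ?_
    rw [natDegree_X_pow]
    have := Finset.mem_range.1 hj
    exact Nat.pow_le_pow_right hq.out.pos (by omega)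
  · rw [AddMonoidHom.mem_ker, traceHom_apply] at hx
    simpa [eval_finsetSum] using hx

omit hq in
theorem natCast_eq_zero_of_natCard (hk : Nat.card k = q ^ (2 * n)) : (q : k) = 0 := by
  have := Fintype.ofFinite k
  have h := FiniteField.cast_card_eq_zero k
  rw [← Nat.card_eq_fintype_card, hk, Nat.cast_pow] at h
  exact eq_zero_of_pow_eq_zero h

omit hq in
theorem pow_eq_self_of_natCard (hk : Nat.card k = q ^ (2 * n)) (x : k) : x ^ q ^ (2 * n) = x := by
  have := Fintype.ofFinite k
  have h := FiniteField.pow_card x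
  rwa [← Nat.card_eq_fintype_card, hk] at h

/-- The additive form of Hilbert's Theorem 90. -/
theorem natCard_ker_and_range_artinSchreier (hn : n ≠ 0) (hk : Nat.card k = q ^ (2 * n)) :
    Nat.card (artinSchreier hK).ker = q ^ 2 ∧
      (artinSchreier hK).range = (traceHom hK n).ker := by
  have hle : (artinSchreier hK).range ≤ (traceHom hK n).ker := by
    rintro _ ⟨x, rfl⟩
    rw [AddMonoidHom.mem_ker, traceHom_artinSchreier, pow_eq_self_of_natCard hk, sub_self]
  have hT := natCard_ker_traceHom_le hK hn
  obtain ⟨h1, h2⟩ := AddMonoidHom.card_ker_and_card_range_of_le (artinSchreier hK)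
    (a := q ^ 2) (b := q ^ (2 * (n - 1)))
    (by rw [hk, ← pow_add]; congr 1; omega) (natCard_ker_artinSchreier_le hK)
    ((AddSubgroup.card_le_of_le hle).trans hT)
  exact ⟨h1, AddSubgroup.eq_of_le_of_card_ge hle (by rw [h2]; exact hT)⟩

/-- By the additive form of Hilbert's Theorem 90, `z` is the second coordinate of a point if and only
if the trace of `z ^ d` vanishes, and then of `q ^ 2` points. -/
theorem natCard_affine_points (hn : n ≠ 0) (hk : Nat.card k = q ^ (2 * n)) (d : ℕ) :
    Nat.card {Q : k × k // Q.1 ^ q ^ 2 - Q.1 = Q.2 ^ d} =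
      Nat.card {z : k // traceHom hK n (z ^ d) = 0} * q ^ 2 := by
  obtain ⟨h1, h2⟩ := natCard_ker_and_range_artinSchreier hK hn hk
  refine Nat.card_subtype_eq_mul_of_fiber Prod.snd (fun Q hQ => ?_) fun z hz => ?_
  · rw [← hQ, ← artinSchreier_apply hK, ← AddMonoidHom.mem_ker, ← h2]
    exact ⟨_, rfl⟩
  · rw [← AddMonoidHom.mem_ker, ← h2] at hz
    refine Eq.trans ?_ ((AddMonoidHom.card_fiber _ hz).trans h1)
    refine Nat.card_congr ⟨fun Q => ⟨Q.1.1, ?_⟩, fun y => ⟨(y.1, z), ?_, rfl⟩, ?_, fun _ => rfl⟩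
    · rw [artinSchreier_apply, Q.2.1, Q.2.2]
    · rw [← artinSchreier_apply hK, y.2]
    · rintro ⟨⟨y, z'⟩, h, rfl⟩
      rfl

/-- For `δ ^ (q + 1) = 1`, the trace to the field with `q ^ 2` elements has `q ^ (n - 1)` zeros
among the `q ^ n` solutions of `x ^ q ^ n = δ x`: on these solutions its values satisfy
`t ^ q = δ t`, and it is given by a polynomial of degree `q ^ (n - 1)`. -/
theorem natCard_traceHom_eq_zero [hn : Fact (Odd n)] (hk : Nat.card k = q ^ (2 * n)) {δ : k}
    (hδ : δ ^ (q + 1) = 1) :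
    Nat.card {x : k // x ^ q ^ n = δ * x ∧ traceHom hK n x = 0} = q ^ (n - 1) := by
  obtain ⟨m, hm⟩ := hn.out
  have hq0 : 0 < q := hq.out.pos
  have hqQ : 1 < q ^ n := Nat.one_lt_pow (by omega) one_lt_q
  have hδQ : δ ^ q ^ n * δ = 1 := by
    rw [← pow_succ, ← r_mul_succ, mul_comm, pow_mul, hδ, one_pow]
  have hδq : δ ^ q * δ = 1 := by rw [← pow_succ, hδ]
  have hδ0 : δ ≠ 0 := right_ne_zero_of_mul_eq_one hδq
  have hδqq : (δ ^ q) ^ q = δ := by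
    apply mul_right_cancel₀ (pow_ne_zero q hδ0)
    rw [← mul_pow, hδq, one_pow, mul_comm, hδq]
  have hδodd : ∀ l, δ ^ q ^ (2 * l + 1) = δ ^ q := by
    intro l
    induction l with
    | zero => simp
    | succ l ih => rw [show 2 * (l + 1) + 1 = 2 * l + 1 + 1 + 1 by ring, pow_succ, pow_mul, pow_succ,
        pow_mul, ih, hδqq]
  -- the map `x ↦ x ^ q ^ n - δ x` has values with `t ^ q ^ n = - δ⁻¹ t`
  let A : k →+ k := (powHom hK n : k →+ k) - AddMonoidHom.mulLeft δ
  have hA : ∀ x, A x = x ^ q ^ n - δ * x := fun x => by simp [A, powHom_apply]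
  have hmem : ∀ x, x ∈ A.ker ↔ x ^ q ^ n = δ * x := fun x => by
    rw [AddMonoidHom.mem_ker, hA, sub_eq_zero]
  have hbound : ∀ d : k, ∀ e : ℕ, 1 < q ^ e → ∀ s : k → Prop, (∀ x, s x → x ^ q ^ e = d * x) →
      Nat.card {x // s x} ≤ q ^ e := by
    intro d e he s hs
    have hdeg : (C d * X : k[X]).natDegree < (X ^ q ^ e : k[X]).natDegree := by
      rw [natDegree_X_pow]
      exact ((natDegree_C_mul_le d X).trans natDegree_X_le).trans_lt he
    refine natCard_subtype_le_of_eval_eq_zero (p := X ^ q ^ e - C d * X) ?_ ?_ fun x hx => ?_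
    · intro h0
      rw [sub_eq_zero] at h0
      rw [h0] at hdeg
      exact lt_irrefl _ hdeg
    · rw [natDegree_sub_eq_left_of_natDegree_lt hdeg, natDegree_X_pow]
    · simp [hs x hx]
  have hAker : Nat.card A.ker = q ^ n := by
    refine (A.card_ker_and_card_range_of_le (a := q ^ n) (b := q ^ n) (by rw [hk]; ring) ?_ ?_).1
    · exact hbound δ n hqQ _ fun x hx => (hmem x).1 hx
    · refine hbound (-δ ^ q ^ n) n hqQ _ ?_
      rintro _ ⟨x, rfl⟩
      rw [hA, ← powHom_apply hK, map_sub, map_mul, map_pow, powHom_apply, powHom_apply, ← pow_mul,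
        ← pow_add, ← two_mul, pow_eq_self_of_natCard hk]
      linear_combination (-x) * hδQ
  -- the trace on the kernel of this map
  have hT : ∀ x, x ^ q ^ n = δ * x → traceHom hK n x =
      ∑ j ∈ Finset.range (m + 1), x ^ q ^ (2 * j) +
        δ ^ q * ∑ l ∈ Finset.range m, x ^ q ^ (2 * l + 1) := by
    intro x hx
    rw [traceHom_apply, hm, show 2 * m + 1 = (m + 1) + m by ring, Finset.sum_range_add,
      Finset.mul_sum]
    congr 1
    refine Finset.sum_congr rfl fun l _ => ?_
    rw [show 2 * (m + 1 + l) = n + (2 * l + 1) by omega, pow_add, pow_mul, hx, mul_pow, hδodd]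
  let T : A.ker →+ k := (traceHom hK n).comp A.ker.subtype
  have hTker : Nat.card T.ker = q ^ (n - 1) := by
    refine (T.card_ker_and_card_range_of_le (b := q ^ 1) ?_ ?_ ?_).1
    · rw [hAker, ← pow_add]
      congr 1
      omega
    · have : Nat.card {x : k // x ^ q ^ n = δ * x ∧ traceHom hK n x = 0} ≤ q ^ (n - 1) := by
        refine natCard_subtype_le_of_eval_eq_zero
          (p := ∑ j ∈ Finset.range (m + 1), X ^ q ^ (2 * j) +
            C (δ ^ q) * ∑ l ∈ Finset.range m, X ^ q ^ (2 * l + 1)) ?_ ?_ fun x hx => ?_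
        · have : derivative (∑ j ∈ Finset.range (m + 1), X ^ q ^ (2 * j) +
              C (δ ^ q) * ∑ l ∈ Finset.range m, X ^ q ^ (2 * l + 1) : k[X]) = 1 := by
            rw [Finset.sum_range_succ', derivative_add, derivative_add, derivative_sum,
              Finset.sum_eq_zero fun j _ => derivative_X_pow_q_pow hK (by omega),
              derivative_C_mul, derivative_sum,
              Finset.sum_eq_zero fun j _ => derivative_X_pow_q_pow hK (by omega)]
            simp
          intro h0
          rw [h0, derivative_zero] at this
          exact zero_ne_one this
        · refine natDegree_add_le_of_degree_le ?_ ((natDegree_C_mul_le _ _).trans ?_)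
          all_goals
            refine natDegree_sum_le_of_forall_le _ _ fun j hj => ?_
            rw [natDegree_X_pow]
            have := Finset.mem_range.1 hj
            exact Nat.pow_le_pow_right hq0 (by omega)
        · have := hT x hx.1
          rw [hx.2] at this
          simpa [eval_finsetSum] using this.symm
      refine le_trans (Nat.card_le_card_of_injective
        (β := {x : k // x ^ q ^ n = δ * x ∧ traceHom hK n x = 0})
        (fun x => ⟨x.1.1, (hmem _).1 x.1.2, x.2⟩) fun x y hxy => ?_) this
      exact Subtype.ext (Subtype.ext (by simpa using hxy))
    · refine hbound δ 1 (by rw [pow_one]; exact one_lt_q) _ ?_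
      rintro _ ⟨⟨x, hx⟩, rfl⟩
      have hx' := (hmem x).1 hx
      have h1 : T ⟨x, hx⟩ = traceHom hK n x := rfl
      have h2 : ∀ e, (x ^ q ^ e) ^ q ^ 1 = x ^ q ^ (e + 1) := fun e => by
        rw [← pow_mul, ← pow_add]
      have h3 : ∑ j ∈ Finset.range (m + 1), x ^ q ^ (2 * j + 1) =
          ∑ l ∈ Finset.range m, x ^ q ^ (2 * l + 1) + δ * x := by
        rw [Finset.sum_range_succ, ← hm, hx']
      have h4 : ∑ j ∈ Finset.range (m + 1), x ^ q ^ (2 * j) =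
          ∑ l ∈ Finset.range m, x ^ q ^ (2 * l + 1 + 1) + x := by
        rw [Finset.sum_range_succ']
        simp [mul_add]
      rw [h1, hT x hx', ← powHom_apply hK, map_add, map_mul, map_sum, map_sum]
      simp only [powHom_apply, h2]
      rw [h3, h4, pow_one, hδqq]
      linear_combination (-∑ l ∈ Finset.range m, x ^ q ^ (2 * l + 1)) * hδq
  rw [← hTker]
  exact Nat.card_congr ⟨fun x => ⟨⟨x.1, (hmem _).2 x.2.1⟩, x.2.2⟩,
    fun x => ⟨x.1.1, (hmem _).1 x.1.2, x.2⟩, fun _ => rfl, fun _ => rfl⟩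

/-- The trace of `z ^ r` vanishes for `1 + r (q + 1) (q ^ (n - 1) - 1)` elements `z`: the nonzero
`r`-th powers are the solutions of `x ^ (q ^ n - 1) = δ` for the `δ` with `δ ^ (q + 1) = 1`. -/
theorem natCard_traceHom_pow_r_eq_zero [hn : Fact (Odd n)] (hk : Nat.card k = q ^ (2 * n)) :
    Nat.card {z : k // traceHom hK n (z ^ r q n) = 0} =
      (q + 1) * (q ^ (n - 1) - 1) * r q n + 1 := by
  have hq0 : 0 < q := hq.out.pos
  have hr := r_mul_succ q n
  have hqQ : 1 < q ^ n := Nat.one_lt_pow hn.out.pos.ne' one_lt_q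
  have hunits : Nat.card kˣ = r q n * ((q ^ n - 1) * (q + 1)) := by
    rw [Nat.card_units, hk, mul_left_comm, hr, mul_comm 2 n, pow_mul]
    have := Nat.sq_sub_sq (q ^ n) 1
    rw [one_pow] at this
    rw [this, mul_comm]
  obtain ⟨h1, h2⟩ := card_ker_and_range_powMonoidHom hunits
  have h3 := (card_ker_and_range_powMonoidHom (k := k)
    (a := q + 1) (b := r q n * (q ^ n - 1)) (by rw [hunits]; ring)).1
  rw [natCard_eq_natCard_units_add_one (s := fun z => traceHom hK n (z ^ r q n) = 0)
    (by rw [zero_pow (r_pos q n).ne', map_zero])]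
  congr 1
  rw [Nat.card_subtype_eq_mul_of_fiber (α := kˣ) (β := kˣ) (powMonoidHom (r q n)) (c := r q n)
    (s := fun x : kˣ => (x ^ (q ^ n - 1)) ^ (q + 1) = 1 ∧ traceHom hK n (x : k) = 0)]
  · congr 1
    rw [Nat.card_subtype_eq_mul_of_fiber (fun x : kˣ => x ^ (q ^ n - 1)) (c := q ^ (n - 1) - 1)
      (s := fun δ => δ ^ (q + 1) = 1) fun x hx => hx.1]
    · exact congrArg (· * _) h3
    · intro δ hδ
      have hδ' : (δ : k) ^ (q + 1) = 1 := by
        rw [← Units.val_pow_eq_pow_val, hδ, Units.val_one]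
      have h := natCard_traceHom_eq_zero hK hk hδ'
      rw [natCard_eq_natCard_units_add_one (s := fun x : k => x ^ q ^ n = δ * x ∧
        traceHom hK n x = 0) (by simp; omega)] at h
      rw [← h, Nat.add_sub_cancel]
      refine Nat.card_congr (Equiv.subtypeEquivRight fun x => ?_)
      have : x ^ (q ^ n - 1) = δ ↔ (x : k) ^ q ^ n = δ * x := by
        rw [← Units.val_pow_eq_pow_val, ← Units.val_mul, Units.val_inj,
          ← mul_left_inj x (b := x ^ (q ^ n - 1)), ← pow_succ, Nat.sub_add_cancel hqQ.le]
      rw [← this]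
      constructor
      · rintro ⟨⟨-, h5⟩, h6⟩
        exact ⟨h6, h5⟩
      · rintro ⟨h6, h5⟩
        exact ⟨⟨by rw [h6, hδ], h5⟩, h6⟩
  · intro u hu
    refine ⟨?_, by simpa using hu⟩
    rw [← pow_mul, ← powMonoidHom_apply, ← MonoidHom.mem_ker, ← h2]
    exact ⟨u, rfl⟩
  · rintro x ⟨hx, hx'⟩
    rw [← pow_mul, ← powMonoidHom_apply, ← MonoidHom.mem_ker, ← h2] at hx
    refine Eq.trans ?_ ((MonoidHom.card_fiber _ hx).trans h1)
    refine Nat.card_congr (Equiv.subtypeEquivRight fun u => ?_)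
    constructor
    · exact fun h => h.2
    · rintro rfl
      exact ⟨by simpa using hx', rfl⟩

end RationalPoints

section Maximal

variable {k : Type*} [Field k] [Finite k] {q n : ℕ} [hq : Fact (IsPrimePow q)]
  [hn : Fact (Odd n)] [IsDedekindDomain (CoordRing k q n)]

/-- With `r (q + 1) = q ^ n + 1`, the number of rational places
`1 + q ^ 2 (1 + r (q + 1) (q ^ (n - 1) - 1))` equals `1 + q ^ (2 n) + (q ^ 2 - 1) (r - 1) q ^ n`. -/
theorem isMaximalCurve (hk : Nat.card k = q ^ (2 * n)) : IsMaximalCurve k (FunField k q n) := by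
  refine ⟨genus q n, hasGenus_genus, ?_⟩
  have hK := natCast_eq_zero_of_natCard hk
  have hq0 : 0 < q := hq.out.pos
  have hQ : q ^ n = q ^ (n - 1) * q := by
    rw [← pow_succ, Nat.sub_add_cancel hn.out.pos]
  have h1 : (1 : ℕ) ≤ q ^ (n - 1) := Nat.one_le_pow _ _ hq0
  have h2 : 1 ≤ q ^ 2 := Nat.one_le_pow _ _ hq0
  have hr := r_mul_succ q n
  have hg := two_mul_genus q n
  have hrpos := r_pos q n
  rw [card_degree_one, natCard_affine_points hK hn.out.pos.ne' hk,
    natCard_traceHom_pow_r_eq_zero hK hk, hk]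
  have hsqrt : √((q ^ (2 * n) : ℕ) : ℝ) = q ^ n := by
    rw [mul_comm, pow_mul, Nat.cast_pow, Nat.cast_pow]
    exact Real.sqrt_sq (by positivity)
  rw [hsqrt]
  have hg' : (2 : ℝ) * genus q n = (q ^ 2 - 1) * (r q n - 1) := by
    have := congrArg (Nat.cast : ℕ → ℝ) hg
    rw [Nat.cast_mul, Nat.cast_mul, Nat.cast_sub h2, Nat.cast_sub hrpos] at this
    push_cast at this
    exact this
  have hr' : (r q n : ℝ) * (q + 1) = q ^ n + 1 := by exact_mod_cast hr
  have hQ' : (q : ℝ) ^ n = q ^ (n - 1) * q := by exact_mod_cast hQ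
  push_cast [Nat.cast_sub h1]
  rw [hg', mul_comm 2 n, pow_mul]
  generalize (q : ℝ) ^ (n - 1) = a at *
  rw [hQ'] at hr' ⊢
  have hx : (r q n : ℝ) = (a * q + 1) / (q + 1) := by
    field_simp
    linarith
  rw [hx]
  field_simp
  ring

end Maximal

end PlaneCurve

/-! ### Orders of functions and their pole order at infinity -/

section

variable {K : Type*} [Field K] {q n : ℕ} [hq : Fact (IsPrimePow q)] [hn : Fact (Odd n)]

namespace PlaneCurve

section Orders

variable [IsDedekindDomain (CoordRing K q n)]

theorem prod_pow_dvd_span_singleton {R : Type*} [CommRing R] [IsDedekindDomain R] {x : R}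
    (S : Finset (HeightOneSpectrum R)) {a : HeightOneSpectrum R → ℕ}
    (hx : ∀ v ∈ S, x ∈ v.asIdeal ^ a v) : ∏ v ∈ S, v.asIdeal ^ a v ∣ Ideal.span {x} := by
  refine Finset.prod_dvd_of_coprime (fun v _ w _ hvw => ?_) fun v hv =>
    Ideal.dvd_span_singleton.2 (hx v hv)
  have := v.isMaximal
  have := w.isMaximal
  exact IsCoprime.pow (Ideal.isCoprime_of_isMaximal fun h => hvw (HeightOneSpectrum.ext h))

/-- The orders of a function at the affine places sum up to at most its pole order at infinity. -/
theorem sum_le_wdeg {x : CoordRing K q n} (hx0 : x ≠ 0)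
    (a : HeightOneSpectrum (CoordRing K q n) →₀ ℕ) (hx : ∀ v, x ∈ v.asIdeal ^ a v) :
    (a.sum fun v m => m * Module.finrank K (CoordRing K q n ⧸ v.asIdeal)) ≤ wdeg K q n x := by
  obtain ⟨h1, h2⟩ := finrank_quotient_prod (k := K) a.support a
  rw [Finsupp.sum, ← h2]
  refine finrank_le_wdeg (Ideal.Quotient.mkₐ K _).toLinearMap (Ideal.Quotient.mkₐ_surjective K _)
    hx0 fun y => ?_
  refine Ideal.Quotient.eq_zero_iff_mem.2 (Ideal.mul_mem_right _ _ ?_)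
  exact Ideal.dvd_span_singleton.1 (prod_pow_dvd_span_singleton _ fun v _ => hx v)

/-- If lower bounds for the orders of a function at the affine places add up to its pole order at
infinity, then they are all attained. -/
theorem notMem_pow_succ_of_wdeg_le {x : CoordRing K q n} (hx0 : x ≠ 0)
    (a : HeightOneSpectrum (CoordRing K q n) →₀ ℕ) (hx : ∀ v, x ∈ v.asIdeal ^ a v)
    (hdeg : wdeg K q n x ≤ a.sum fun v m => m * Module.finrank K (CoordRing K q n ⧸ v.asIdeal))
    (v : HeightOneSpectrum (CoordRing K q n)) : x ∉ v.asIdeal ^ (a v + 1) := by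
  classical
  intro hv
  have h := sum_le_wdeg hx0 (a + Finsupp.single v 1) fun w => by
    by_cases hw : v = w
    · subst hw
      simpa using hv
    · simpa [Finsupp.single_apply, hw] using hx w
  rw [Finsupp.sum_add_index' (by simp) (by simp [add_mul]), Finsupp.sum_single_index (by simp),
    one_mul] at h
  have : 0 < Module.finrank K (CoordRing K q n ⧸ v.asIdeal) := by
    have := Ideal.Quotient.nontrivial_iff.2 v.isPrime.ne_top
    exact Module.finrank_pos
  omega

end Orders

/-! ### The function `h = (y ^ q - b) (y - b ^ q) - f(c z) g(c z)` -/

omit hq hn in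
/-- The function `h` that the second curve defines on the first one. -/
theorem mk_secondCurve (b c : K) (w : K[X]) :
    AdjoinRoot.mk (equation K q n) (secondCurve q b c w) =
      (coordY K q n ^ q - algebraMap _ _ b) * (coordY K q n - algebraMap _ _ b ^ q) -
        aeval (algebraMap _ _ c * coordZ K q n) w := by
  have h1 : AdjoinRoot.mk (equation K q n) (C X) = coordY K q n := rfl
  have h2 : AdjoinRoot.mk (equation K q n) X = coordZ K q n := rfl
  have h3 : ∀ a : K, AdjoinRoot.mk (equation K q n) (C (C a)) = algebraMap _ _ a := fun _ => rfl
  have h4 : ∀ x : K[X][Y], AdjoinRoot.mk (equation K q n) (aeval x w) =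
      aeval (AdjoinRoot.mk (equation K q n) x) w := fun x => hom_eval₂ w _ _ x
  rw [secondCurve, map_sub, h4, map_mul (AdjoinRoot.mk _) (C (C c)), h2, h3]
  simp only [map_mul, map_sub, map_pow, h1, h3]

omit hq hn in
theorem derivative_factorU (hK : (q : K) = 0) : derivative (factorU K q n) = 0 := by
  rw [factorU, derivative_neg, derivative_sum, Finset.sum_eq_zero, neg_zero]
  intro i hi
  have := (Finset.mem_Ico.1 hi).1
  rw [derivative_X_pow, Nat.cast_mul, Nat.cast_pow, hK, zero_pow (by omega), mul_zero, C_0, zero_mul]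

omit hq in
theorem natCast_r (hK : (q : K) = 0) : (r q n : K) = 1 := by
  have := congrArg (Nat.cast : ℕ → K) (r_mul_succ q n)
  push_cast at this
  rwa [hK, zero_pow hn.out.pos.ne', zero_add, mul_one] at this

omit hq in
theorem derivative_factorV (hK : (q : K) = 0) :
    derivative (factorV K q n) = -X ^ (r q n - 1) := by
  obtain ⟨m, hm⟩ := hn.out
  have : (n + 1) / 2 = m + 1 := by omega
  rw [factorV, this, derivative_neg, Finset.sum_range_succ', derivative_add, derivative_sum,
    Finset.sum_eq_zero, zero_add]
  · simp [derivative_X_pow, natCast_r hK]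
  · intro i _
    rw [derivative_X_pow, Nat.cast_mul, Nat.cast_pow, hK, zero_pow (by omega), mul_zero, C_0,
      zero_mul]

/-- The derivative of the identity `w(t ^ (q ^ n + 1)) = U(t) V(t)` for `w = f g`. -/
theorem pow_mul_aeval_derivative (hK : (q : K) = 0) (x : K) :
    x ^ q ^ n * aeval (x ^ (q ^ n + 1)) (derivative (f K q n * g K q n)) =
      -(x ^ (r q n - 1) * aeval x (factorU K q n)) := by
  have h := congrArg (fun p => aeval x (derivative p)) (expand_f_mul_g K q n)
  rw [derivative_expand, derivative_mul (f := factorU K q n), derivative_factorU hK,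
    derivative_factorV hK, map_mul, expand_aeval] at h
  simp only [zero_mul, zero_add, map_mul, map_neg, map_pow, aeval_X, map_add, map_natCast,
    Nat.cast_add, Nat.cast_pow, hK, zero_pow hn.out.pos.ne', Nat.cast_one, map_one, one_mul,
    Nat.add_sub_cancel] at h
  linear_combination h

omit hq hn in
theorem map_f_mul_g (φ : K →+* K) : (f K q n * g K q n).map φ = f K q n * g K q n := by
  simp [f, g, Polynomial.map_mul, Polynomial.map_sum]

/-- The degree of `U V` is `q ^ n + 1` times that of `f g`, and `q ^ 2 deg U ≤ r q ^ n`,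
`q ^ 2 deg V ≤ r q ^ (n + 1)`. -/
theorem natDegree_f_mul_g_le : q ^ 2 * (f K q n * g K q n).natDegree ≤ q ^ n := by
  have hr := r_mul_succ q n
  have hq0 : 0 < q := hq.out.pos
  have hn' := hn.out
  have hU : (factorU K q n).natDegree * q ^ 2 ≤ r q n * q ^ n := by
    rw [factorU, natDegree_neg, mul_comm]
    have key : ∀ i ∈ Finset.Ico 1 ((n + 1) / 2),
        q ^ 2 * (X ^ (r q n * q ^ (2 * i - 1)) : K[X]).natDegree ≤ r q n * q ^ n := by
      intro i hi
      have := Finset.mem_Ico.1 hi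
      rw [natDegree_X_pow, mul_left_comm, ← pow_add]
      exact Nat.mul_le_mul_left _ (Nat.pow_le_pow_right hq0 (by omega))
    have hq2 : 0 < q ^ 2 := pow_pos hq0 2
    rw [mul_comm, ← Nat.le_div_iff_mul_le hq2]
    refine natDegree_sum_le_of_forall_le _ _ fun i hi => ?_
    rw [Nat.le_div_iff_mul_le hq2, mul_comm]
    exact key i hi
  have hV : (factorV K q n).natDegree * q ^ 2 ≤ r q n * q ^ (n + 1) := by
    have : (factorV K q n).natDegree ≤ r q n * q ^ (n - 1) := by
      rw [factorV, natDegree_neg]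
      refine natDegree_sum_le_of_forall_le _ _ fun i hi => ?_
      rw [natDegree_X_pow]
      have := Finset.mem_range.1 hi
      exact Nat.mul_le_mul_left _ (Nat.pow_le_pow_right hq0 (by omega))
    refine (Nat.mul_le_mul_right _ this).trans_eq ?_
    rw [mul_assoc, ← pow_add]
    congr 2
    have := hn.out.pos
    omega
  have h := congrArg natDegree (expand_f_mul_g K q n)
  rw [natDegree_expand] at h
  have h2 := natDegree_mul_le (p := factorU K q n) (q := factorV K q n)
  refine le_of_mul_le_mul_right (a := q ^ n + 1) ?_ (Nat.succ_pos _)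
  calc q ^ 2 * (f K q n * g K q n).natDegree * (q ^ n + 1) =
      (factorU K q n * factorV K q n).natDegree * q ^ 2 := by rw [← h]; ring
    _ ≤ ((factorU K q n).natDegree + (factorV K q n).natDegree) * q ^ 2 :=
      Nat.mul_le_mul_right _ h2
    _ ≤ r q n * q ^ n + r q n * q ^ (n + 1) := by rw [add_mul]; exact add_le_add hU hV
    _ = q ^ n * (q ^ n + 1) := by rw [← hr]; ring

/-- The expansion of `h` at `(β, γ)`. Substituting `b = y ^ q ^ n - (y - β) ^ q ^ n` and
`c = z ^ q ^ n - (z - γ) ^ q ^ n` turns the leading part of `h` into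
`(y ^ q - y ^ q ^ n) (y - y ^ q ^ (n + 1)) - w(z ^ (q ^ n + 1))`, which vanishes on the curve. -/
theorem exists_mk_secondCurve_eq (hK : (q : K) = 0) (β γ : K) :
    ∃ s t : CoordRing K q n,
      AdjoinRoot.mk (equation K q n)
          (secondCurve q (β ^ q ^ n) (γ ^ q ^ n) (f K q n * g K q n)) =
        (coordY K q n - algebraMap _ _ β) ^ q ^ n * (coordY K q n - coordY K q n ^ q ^ (n + 1)) +
        (coordZ K q n - algebraMap _ _ γ) ^ q ^ n * (coordZ K q n *
          aeval (coordZ K q n ^ (q ^ n + 1)) (derivative (f K q n * g K q n))) +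
        (coordY K q n - algebraMap _ _ β) ^ (q ^ n * 2) * s +
        (coordZ K q n - algebraMap _ _ γ) ^ (q ^ n * 2) * t := by
  obtain ⟨φ, hφ⟩ := exists_ringHom_pow hK (CoordRing K q n) n
  obtain ⟨ψ, hψ⟩ := exists_ringHom_pow hK (CoordRing K q n) 1
  have hβ : (coordY K q n - algebraMap _ _ β) ^ q ^ n =
      coordY K q n ^ q ^ n - algebraMap _ _ (β ^ q ^ n) := by
    rw [← hφ, map_sub, hφ, hφ, map_pow]
  have hγ : (coordZ K q n - algebraMap _ _ γ) ^ q ^ n =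
      coordZ K q n ^ q ^ n - algebraMap _ _ (γ ^ q ^ n) := by
    rw [← hφ, map_sub, hφ, hφ, map_pow]
  have hβ' : (coordY K q n - algebraMap _ _ β) ^ (q ^ n * q) =
      coordY K q n ^ q ^ (n + 1) - algebraMap _ _ (β ^ q ^ n) ^ q := by
    simp only [pow_one] at hψ
    rw [pow_mul, hβ, ← hψ, map_sub, hψ, hψ, pow_succ q n, pow_mul]
  have hw := aeval_f_mul_g n hK (coordZ_pow K q n).symm
  obtain ⟨t, ht⟩ := binomExpansion ((f K q n * g K q n).map (algebraMap K (CoordRing K q n)))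
    (coordZ K q n ^ (q ^ n + 1)) (-((coordZ K q n - algebraMap _ _ γ) ^ q ^ n * coordZ K q n))
  rw [derivative_map, eval_map_algebraMap, eval_map_algebraMap, eval_map_algebraMap, hw,
    show coordZ K q n ^ (q ^ n + 1) + -((coordZ K q n - algebraMap _ _ γ) ^ q ^ n * coordZ K q n) =
      algebraMap _ _ (γ ^ q ^ n) * coordZ K q n by rw [hγ]; ring] at ht
  -- the term `(y - β) ^ q ^ (n + 1)` is a multiple of `(y - β) ^ (2 q ^ n)`, since `q ≥ 2`
  obtain ⟨d, hd⟩ := Nat.exists_eq_add_of_le' hq.out.two_le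
  refine ⟨(coordY K q n - algebraMap _ _ β) ^ (q ^ n * d) *
    (coordY K q n ^ q - algebraMap _ _ (β ^ q ^ n)), -t * coordZ K q n ^ 2, ?_⟩
  have hη : (coordY K q n - algebraMap _ _ β) ^ (q ^ n * 2) *
      ((coordY K q n - algebraMap _ _ β) ^ (q ^ n * d) *
        (coordY K q n ^ q - algebraMap _ _ (β ^ q ^ n))) =
      (coordY K q n ^ q ^ (n + 1) - algebraMap _ _ (β ^ q ^ n) ^ q) *
        (coordY K q n ^ q - algebraMap _ _ (β ^ q ^ n)) := by
    rw [← mul_assoc, ← pow_add, ← mul_add, add_comm 2 d, ← hd, hβ']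
  rw [mk_secondCurve, ht, hη, hβ]
  ring

omit hn in
theorem pow_pow_sub_pow (hK : (q : K) = 0) {β γ : K} (h : β ^ q ^ 2 - β = γ ^ r q n) (e : ℕ) :
    (β ^ q ^ e) ^ q ^ 2 - β ^ q ^ e = (γ ^ q ^ e) ^ r q n := by
  have := congrArg (powHom hK e) h
  rwa [map_sub, map_pow, map_pow, powHom_apply, powHom_apply] at this

section PointPrime

variable {β γ : K} (h : β ^ q ^ 2 - β = γ ^ r q n)

theorem coordY_sub_mem_pointPrime :
    coordY K q n - algebraMap _ _ β ∈ (pointPrime h).asIdeal := by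
  rw [mem_pointPrime_iff, map_sub, evalAt_coordY, AlgHom.commutes]
  exact sub_self β

theorem coordZ_sub_mem_pointPrime :
    coordZ K q n - algebraMap _ _ γ ∈ (pointPrime h).asIdeal := by
  rw [mem_pointPrime_iff, map_sub, evalAt_coordZ, AlgHom.commutes]
  exact sub_self γ

/-- `h` vanishes at `(β, γ)` to order at least `q ^ n`. -/
theorem mk_secondCurve_mem_pow (hK : (q : K) = 0) :
    AdjoinRoot.mk (equation K q n)
      (secondCurve q (β ^ q ^ n) (γ ^ q ^ n) (f K q n * g K q n)) ∈
        (pointPrime h).asIdeal ^ q ^ n := by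
  obtain ⟨s, t, hst⟩ := exists_mk_secondCurve_eq (n := n) hK β γ
  rw [hst]
  have hy := Ideal.pow_mem_pow (coordY_sub_mem_pointPrime h) (q ^ n)
  have hz := Ideal.pow_mem_pow (coordZ_sub_mem_pointPrime h) (q ^ n)
  refine add_mem (add_mem (add_mem (Ideal.mul_mem_right _ _ hy) (Ideal.mul_mem_right _ _ hz))
    (Ideal.mul_mem_right _ _ ?_)) (Ideal.mul_mem_right _ _ ?_)
  all_goals
    rw [pow_mul]
    exact Ideal.pow_mem_of_mem _ (by assumption) 2 two_pos

/-- `h` vanishes at the image `(β ^ q ^ (2 n), γ ^ q ^ (2 n))` of `(β, γ)` under Frobenius. -/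
theorem mk_secondCurve_mem_frobenius (hK : (q : K) = 0) :
    AdjoinRoot.mk (equation K q n)
      (secondCurve q (β ^ q ^ n) (γ ^ q ^ n) (f K q n * g K q n)) ∈
        (pointPrime (pow_pow_sub_pow hK h (2 * n))).asIdeal := by
  have hw := aeval_f_mul_g n hK (pow_pow_sub_pow hK h n)
  generalize f K q n * g K q n = w at hw ⊢
  rw [mem_pointPrime_iff, mk_secondCurve]
  simp only [map_sub, map_mul, map_pow, evalAt_coordY, evalAt_coordZ, AlgHom.commutes,
    ← aeval_algHom_apply]
  simp only [Algebra.algebraMap_self, RingHom.id_apply]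
  have hγ : γ ^ q ^ n * γ ^ q ^ (2 * n) = (γ ^ q ^ n) ^ (q ^ n + 1) := by
    ring
  rw [hγ, hw]
  ring

/-- The value of the derivative of `w = f g` that makes `h` vanish to order `q ^ n + 1` at a point
fixed by Frobenius: the derivative of `w(t ^ (q ^ n + 1)) = U(t) V(t)` at `γ`, raised to the
`q ^ n`-th power. -/
theorem mul_aeval_derivative_f_mul_g (h : β ^ q ^ 2 - β = γ ^ r q n) (hK : (q : K) = 0)
    (hβ : β ^ q ^ (2 * n) = β) (hγ : γ ^ q ^ (2 * n) = γ) :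
    γ * aeval (γ ^ (q ^ n + 1)) (derivative (f K q n * g K q n)) =
      (γ ^ (r q n - 1)) ^ q ^ n * (β - β ^ q ^ (n + 1)) := by
  have hQ : ∀ x : K, (x ^ q ^ n) ^ q ^ n = x ^ q ^ (2 * n) := fun x => by
    rw [← pow_mul, ← pow_add, two_mul]
  have hU := aeval_factorU n hK h
  -- `w` has coefficients in the prime field, and `γ ^ (q ^ n + 1)` is fixed by `x ↦ x ^ q ^ n`
  have hD : aeval (γ ^ (q ^ n + 1)) (derivative (f K q n * g K q n)) ^ q ^ n =
      aeval (γ ^ (q ^ n + 1)) (derivative (f K q n * g K q n)) := by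
    rw [← powHom_apply hK, aeval_def, hom_eval₂, Algebra.algebraMap_self, RingHom.comp_id,
      ← eval_map, ← derivative_map, map_f_mul_g, powHom_apply, eval₂_id]
    congr 1
    rw [pow_succ, mul_pow, hQ, hγ, mul_comm]
  have key := congrArg (powHom hK n) (pow_mul_aeval_derivative (n := n) hK γ)
  generalize aeval (γ ^ (q ^ n + 1)) (derivative (f K q n * g K q n)) = D at hD key ⊢
  rw [map_mul, map_neg, map_mul, powHom_apply, powHom_apply, hQ, hγ, hD, hU, map_sub, powHom_apply,
    powHom_apply, powHom_apply, hQ, hβ] at key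
  rw [key]
  ring

/-- `h` vanishes to order at least `q ^ n + 1` at the points fixed by Frobenius: there `y - β` is
`-γ ^ (r - 1) (z - γ)` up to terms of order two, and the coefficient of `(z - γ) ^ q ^ n` in `h`
vanishes by `mul_aeval_derivative_f_mul_g`. -/
theorem mk_secondCurve_mem_pow_succ (hK : (q : K) = 0) (hβ : β ^ q ^ (2 * n) = β)
    (hγ : γ ^ q ^ (2 * n) = γ) :
    AdjoinRoot.mk (equation K q n)
      (secondCurve q (β ^ q ^ n) (γ ^ q ^ n) (f K q n * g K q n)) ∈
        (pointPrime h).asIdeal ^ (q ^ n + 1) := by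
  obtain ⟨s, t, hst⟩ := exists_mk_secondCurve_eq (n := n) hK β γ
  obtain ⟨φ, hφ⟩ := exists_ringHom_pow hK (CoordRing K q n) n
  obtain ⟨ψ, hψ⟩ := exists_ringHom_pow hK (CoordRing K q n) 2
  have hmy := coordY_sub_mem_pointPrime h
  have hmz := coordZ_sub_mem_pointPrime h
  -- the tangent line at the point, from the expansion of `z ^ r` at `γ`
  obtain ⟨u, hu⟩ := powAddExpansion (algebraMap K (CoordRing K q n) γ)
    (coordZ K q n - algebraMap _ _ γ) (r q n)
  have hr1 : (r q n : CoordRing K q n) = 1 := by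
    rw [← map_natCast (algebraMap K (CoordRing K q n)), natCast_r hK, map_one]
  have hlin : coordY K q n - algebraMap _ _ β = (coordY K q n - algebraMap _ _ β) ^ q ^ 2 -
      algebraMap _ _ (γ ^ (r q n - 1)) * (coordZ K q n - algebraMap _ _ γ) -
        u * (coordZ K q n - algebraMap _ _ γ) ^ 2 := by
    rw [add_sub_cancel, coordZ_pow, hr1, one_mul, ← map_pow, ← map_pow, ← h, map_sub, map_pow] at hu
    rw [← hψ, map_sub, hψ, hψ]
    linear_combination -hu
  generalize hη : coordY K q n - algebraMap K (CoordRing K q n) β = η at *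
  generalize hτ : coordZ K q n - algebraMap K (CoordRing K q n) γ = τ at *
  have hlinQ : η ^ q ^ n = η ^ (q ^ 2 * q ^ n) -
      algebraMap K (CoordRing K q n) ((γ ^ (r q n - 1)) ^ q ^ n) * τ ^ q ^ n -
        u ^ q ^ n * τ ^ (q ^ n * 2) := by
    have := congrArg φ hlin
    rw [map_sub, map_sub, map_mul, map_mul, map_pow, map_pow φ τ, hφ, hφ, hφ, hφ] at this
    rw [this, map_pow _ (γ ^ (r q n - 1)) (q ^ n), map_pow, ← pow_mul, ← pow_mul τ,
      mul_comm (q ^ n) (q ^ 2)]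
  have hmem : coordZ K q n *
        aeval (coordZ K q n ^ (q ^ n + 1)) (derivative (f K q n * g K q n)) -
      algebraMap K (CoordRing K q n) ((γ ^ (r q n - 1)) ^ q ^ n) *
        (coordY K q n - coordY K q n ^ q ^ (n + 1)) ∈ (pointPrime h).asIdeal := by
    rw [mem_pointPrime_iff]
    simp only [map_sub, map_mul, evalAt_coordY, evalAt_coordZ, AlgHom.commutes,
      ← aeval_algHom_apply, map_pow]
    rw [mul_aeval_derivative_f_mul_g h hK hβ hγ]
    simp
  have hq2 := hq.out.two_le
  have hQ1 : 1 ≤ q ^ n := Nat.one_le_pow _ _ hq.out.pos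
  have hQ2 : q ^ n + 1 ≤ q ^ n * 2 := by omega
  have hQ3 : q ^ n + 1 ≤ q ^ 2 * q ^ n :=
    hQ2.trans ((mul_comm _ _).trans_le
      (Nat.mul_le_mul_right _ (hq2.trans (Nat.le_self_pow two_ne_zero q))))
  have hsplit : ∀ {x : CoordRing K q n}, x ∈ (pointPrime h).asIdeal → ∀ {e}, q ^ n + 1 ≤ e →
      x ^ e ∈ (pointPrime h).asIdeal ^ (q ^ n + 1) := fun hx e he =>
    Ideal.pow_le_pow_right he (Ideal.pow_mem_pow hx e)
  have hdecomp : AdjoinRoot.mk (equation K q n)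
      (secondCurve q (β ^ q ^ n) (γ ^ q ^ n) (f K q n * g K q n)) =
      τ ^ q ^ n * (coordZ K q n *
          aeval (coordZ K q n ^ (q ^ n + 1)) (derivative (f K q n * g K q n)) -
        algebraMap K (CoordRing K q n) ((γ ^ (r q n - 1)) ^ q ^ n) *
          (coordY K q n - coordY K q n ^ q ^ (n + 1))) +
      η ^ (q ^ 2 * q ^ n) * (coordY K q n - coordY K q n ^ q ^ (n + 1)) +
      η ^ (q ^ n * 2) * s +
      τ ^ (q ^ n * 2) * (t - u ^ q ^ n * (coordY K q n - coordY K q n ^ q ^ (n + 1))) := by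
    rw [hst, hlinQ]
    ring
  rw [hdecomp]
  refine add_mem (add_mem (add_mem ?_ ?_) ?_) ?_
  · rw [pow_succ (pointPrime h).asIdeal]
    exact Ideal.mul_mem_mul (Ideal.pow_mem_pow hmz _) hmem
  · exact Ideal.mul_mem_right _ _ (hsplit hmy hQ3)
  · exact Ideal.mul_mem_right _ _ (hsplit hmy hQ2)
  · exact Ideal.mul_mem_right _ _ (hsplit hmz hQ2)

end PointPrime

/-- `h` has pole order `q ^ n + 1` at infinity: this is the pole order of `(y ^ q - b) (y - b ^ q)`,
and that of `f(c z) g(c z)` is smaller. -/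
theorem infinityValuation_mk_secondCurve (b c : K) :
    infinityValuation K q n (algebraMap _ _ (AdjoinRoot.mk (equation K q n)
      (secondCurve q b c (f K q n * g K q n)))) = exp ((q ^ n + 1 : ℕ) : ℤ) := by
  set v := infinityValuation K q n
  have hv : IsInfinite v (exp (1 : ℤ)) := isInfinite_infinityValuation K q n
  have hconst : ∀ a : K, v (algebraMap _ _ (algebraMap K (CoordRing K q n) a)) ≤ 1 := by
    intro a
    rw [← IsScalarTower.algebraMap_apply]
    rcases eq_or_ne a 0 with rfl | ha
    · simp
    · exact (hv.map_const a ha).le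
  have hy : ∀ e : ℕ, 0 < e → v (algebraMap _ _ (coordY K q n ^ e)) = exp ((r q n * e : ℕ) : ℤ) ∧
      (1 : ℤᵐ⁰) < exp ((r q n * e : ℕ) : ℤ) := by
    intro e he
    constructor
    · rw [map_pow, map_pow, hv.map_y, ← pow_mul, ← exp_nsmul]
      simp
    · rw [← exp_zero, exp_lt_exp]
      exact_mod_cast Nat.mul_pos (r_pos q n) he
  have hsub : ∀ (e : ℕ) (a : K), 0 < e →
      v (algebraMap _ _ (coordY K q n ^ e - algebraMap _ _ a)) = exp ((r q n * e : ℕ) : ℤ) := by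
    intro e a he
    obtain ⟨h1, h2⟩ := hy e he
    rw [map_sub, Valuation.map_sub_eq_of_lt_left, h1]
    rw [h1]
    exact (hconst a).trans_lt h2
  have hmain : v (algebraMap _ _ ((coordY K q n ^ q - algebraMap _ _ b) *
      (coordY K q n - algebraMap _ _ b ^ q))) = exp ((q ^ n + 1 : ℕ) : ℤ) := by
    have h1 := hsub 1 (b ^ q) one_pos
    rw [pow_one, map_pow] at h1
    rw [map_mul, map_mul, hsub q b hq.out.pos, h1, ← exp_add, ← r_mul_succ q n]
    push_cast
    ring_nf
  have hw : v (algebraMap _ _ (aeval (algebraMap _ _ c * coordZ K q n) (f K q n * g K q n))) <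
      exp ((q ^ n + 1 : ℕ) : ℤ) := by
    have hcz : v (algebraMap _ _ (algebraMap _ _ c * coordZ K q n)) ≤ exp ((q ^ 2 : ℕ) : ℤ) := by
      rw [map_mul, map_mul, hv.map_z, ← exp_nsmul]
      refine (mul_le_mul_left (hconst c) _).trans_eq ?_
      simp
    rw [aeval_eq_sum_range, map_sum]
    refine Valuation.map_sum_lt _ exp_ne_zero fun i hi => ?_
    rw [Algebra.smul_def, map_mul, map_mul, map_pow, map_pow]
    refine (mul_le_mul' (hconst _) (pow_le_pow_left' hcz i)).trans_lt ?_
    rw [one_mul, ← exp_nsmul, exp_lt_exp, nsmul_eq_mul]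
    have h1 : i ≤ (f K q n * g K q n).natDegree := Nat.lt_succ_iff.1 (Finset.mem_range.1 hi)
    have h2 := (Nat.mul_le_mul_left (q ^ 2) h1).trans natDegree_f_mul_g_le
    rw [← Nat.cast_mul, Nat.cast_lt, mul_comm]
    exact Nat.lt_succ_of_le h2
  rw [mk_secondCurve, map_sub, Valuation.map_sub_eq_of_lt_left, hmain]
  rwa [hmain]

section Divisor

variable {β γ : K} (h : β ^ q ^ 2 - β = γ ^ r q n) (hK : (q : K) = 0)
  [IsDedekindDomain (CoordRing K q n)]

omit [IsDedekindDomain (CoordRing K q n)] in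
theorem mk_secondCurve_ne_zero (b c : K) :
    AdjoinRoot.mk (equation K q n) (secondCurve q b c (f K q n * g K q n)) ≠ 0 := by
  intro h0
  have := infinityValuation_mk_secondCurve (q := q) (n := n) b c
  rw [h0, map_zero, map_zero] at this
  exact exp_ne_zero this.symm

omit [IsDedekindDomain (CoordRing K q n)] in
theorem eq_of_pointPrime_eq {β' γ' : K} (h' : β' ^ q ^ 2 - β' = γ' ^ r q n)
    (heq : pointPrime h = pointPrime h') : β = β' ∧ γ = γ' := by
  have hy := coordY_sub_mem_pointPrime h
  have hz := coordZ_sub_mem_pointPrime h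
  rw [heq, mem_pointPrime_iff, map_sub, AlgHom.commutes, sub_eq_zero] at hy hz
  rw [evalAt_coordY] at hy
  rw [evalAt_coordZ] at hz
  exact ⟨hy.symm, hz.symm⟩

/-- The orders of `h` at the affine places. They are at least those claimed, and they cannot be
larger, since the claimed ones already sum up to the pole order of `h` at infinity. -/
theorem valuation_mk_secondCurve (v : HeightOneSpectrum (CoordRing K q n)) :
    v.valuation (FunField K q n) (algebraMap _ _ (AdjoinRoot.mk (equation K q n)
      (secondCurve q (β ^ q ^ n) (γ ^ q ^ n) (f K q n * g K q n)))) =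
      exp (-(((Finsupp.single (pointPrime h) (q ^ n) +
        Finsupp.single (pointPrime (pow_pow_sub_pow hK h (2 * n))) 1 :
          HeightOneSpectrum (CoordRing K q n) →₀ ℕ) v : ℕ) : ℤ)) := by
  classical
  set x := AdjoinRoot.mk (equation K q n)
    (secondCurve q (β ^ q ^ n) (γ ^ q ^ n) (f K q n * g K q n)) with hx
  have hx0 : x ≠ 0 := mk_secondCurve_ne_zero _ _
  set P₁ := pointPrime h with hP₁
  set P₂ := pointPrime (pow_pow_sub_pow hK h (2 * n)) with hP₂
  set a : HeightOneSpectrum (CoordRing K q n) →₀ ℕ :=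
    Finsupp.single P₁ (q ^ n) + Finsupp.single P₂ 1 with ha
  have hmem : ∀ w, x ∈ w.asIdeal ^ a w := by
    intro w
    rw [ha, Finsupp.add_apply, Finsupp.single_apply, Finsupp.single_apply]
    by_cases h1 : P₁ = w
    · by_cases h2 : P₂ = w
      · rw [if_pos h1, if_pos h2, ← h1]
        obtain ⟨hβ, hγ⟩ := eq_of_pointPrime_eq _ _ (h2.trans h1.symm)
        exact mk_secondCurve_mem_pow_succ h hK hβ hγ
      · rw [if_pos h1, if_neg h2, add_zero, ← h1]
        exact mk_secondCurve_mem_pow h hK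
    · by_cases h2 : P₂ = w
      · rw [if_neg h1, if_pos h2, zero_add, pow_one, ← h2]
        exact mk_secondCurve_mem_frobenius h hK
      · rw [if_neg h1, if_neg h2, add_zero, pow_zero, Ideal.one_eq_top]
        trivial
  have hdeg : wdeg K q n x ≤
      a.sum fun w m => m * Module.finrank K (CoordRing K q n ⧸ w.asIdeal) := by
    have h1 := infinityValuation_mk_secondCurve (q := q) (n := n) (β ^ q ^ n) (γ ^ q ^ n)
    rw [infinityValuation_algebraMap hx0, exp_inj, Nat.cast_inj] at h1
    rw [h1, ha, Finsupp.sum_add_index' (by simp) (by simp [add_mul]),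
      Finsupp.sum_single_index (by simp), Finsupp.sum_single_index (by simp), hP₁, hP₂,
      finrank_quotient_pointPrime, finrank_quotient_pointPrime, mul_one, mul_one]
  have hnot := notMem_pow_succ_of_wdeg_le hx0 a hmem hdeg v
  have hle := (v.intValuation_le_pow_iff_mem x (a v)).2 (hmem v)
  rw [← v.intValuation_le_pow_iff_mem] at hnot
  rw [HeightOneSpectrum.valuation_of_algebraMap]
  obtain ⟨m, hm⟩ : ∃ m, v.intValuation x = exp m :=
    ⟨_, (exp_log (v.intValuation_ne_zero x hx0)).symm⟩
  rw [hm, exp_le_exp] at hle hnot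
  rw [hm, exp_inj]
  push_cast at hnot
  omega

theorem hasDivisor_secondCurve :
    HasDivisor (toFun (secondCurve q (β ^ q ^ n) (γ ^ q ^ n) (f K q n * g K q n)) : FunField K q n)
      (Finsupp.single (Place.ofHeightOneSpectrum K _ (pointPrime h)) ((q : ℤ) ^ n) +
        Finsupp.single (Place.ofHeightOneSpectrum K _
          (pointPrime (pow_pow_sub_pow hK h (2 * n)))) 1 -
        Finsupp.single (infinity K q n) ((q : ℤ) ^ n + 1)) := by
  classical
  intro P
  rcases eq_infinity_or_exists_eq P with rfl | ⟨v, rfl⟩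
  · rw [(infinity_isNormalized K q n).hasOrder_iff, toFun, infinityValuation_mk_secondCurve]
    simp [ofHeightOneSpectrum_ne_infinity]
  · rw [(Place.ofHeightOneSpectrum_isNormalized v).hasOrder_iff, toFun,
      valuation_mk_secondCurve h hK]
    have hinj : ∀ w : HeightOneSpectrum (CoordRing K q n),
        Place.ofHeightOneSpectrum K (FunField K q n) w = Place.ofHeightOneSpectrum K _ v ↔ w = v :=
      fun w => Place.ofHeightOneSpectrum_injective.eq_iff
    simp only [Finsupp.sub_apply, Finsupp.add_apply, Finsupp.single_apply, hinj,
      (ofHeightOneSpectrum_ne_infinity v).symm, if_false]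
    push_cast
    rw [sub_zero]

end Divisor

theorem isCommonPole_iff {P : Place K (FunField K q n)} :
    IsCommonPole P ↔ P = infinity K q n := by
  have hy : (toFun (C X) : FunField K q n) = algebraMap _ _ (coordY K q n) := rfl
  have hz : (toFun X : FunField K q n) = algebraMap _ _ (coordZ K q n) := rfl
  rw [IsCommonPole, hy, hz]
  constructor
  · exact fun h => eq_infinity h.1
  · rintro rfl
    refine ⟨coordY_notMem_infinity K q n, fun h => ?_⟩
    rw [(infinity_isNormalized K q n).1, (isInfinite_infinityValuation K q n).map_z, ← exp_nsmul,
      ← exp_zero, exp_le_exp, nsmul_eq_mul, mul_one, ← Nat.cast_zero, Nat.cast_le] at h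
    exact absurd h (pow_pos hq.out.pos 2).not_ge

end PlaneCurve

end

/-! ### Intersection multiplicities -/

namespace PlaneCurve

variable {K : Type*} [Field K] {q n : ℕ}

/-- Two curves do not intersect in a point that does not lie on the first one. -/
theorem intersectionMultiplicity_eq_zero {G H : K[X][Y]} {Q : K × K} (hG : G ∉ pointIdeal Q) :
    intersectionMultiplicity G H Q = 0 := by
  rw [intersectionMultiplicity, localMultiplicity, Module.length_eq_zero_iff,
    Ideal.Quotient.subsingleton_iff]
  refine Ideal.eq_top_of_isUnit_mem _ (Ideal.subset_span (Set.mem_insert _ _)) ?_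
  exact IsLocalization.map_units (Localization.AtPrime (pointIdeal Q))
    (⟨G, hG⟩ : (pointIdeal Q).primeCompl)

variable {β γ : K} (h : β ^ q ^ 2 - β = γ ^ r q n)
  [hq : Fact (IsPrimePow q)] [hn : Fact (Odd n)]

theorem mk_mem_pointPrime_iff {G : K[X][Y]} :
    AdjoinRoot.mk (equation K q n) G ∈ (pointPrime h).asIdeal ↔ G ∈ pointIdeal (β, γ) := by
  rw [mem_pointPrime_iff, evalAt_mk, pointIdeal, RingHom.mem_ker, coe_evalEvalRingHom]

theorem isUnit_mk_quotient_pow {x : CoordRing K q n} (hx : x ∉ (pointPrime h).asIdeal) (e : ℕ) :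
    IsUnit (Ideal.Quotient.mk ((pointPrime h).asIdeal ^ e) x) := by
  have hmax : (pointPrime h).asIdeal.IsMaximal :=
    RingHom.ker_isMaximal_of_surjective _ (evalAt_surjective h)
  have hco : IsCoprime (Ideal.span {x}) ((pointPrime h).asIdeal ^ e) := by
    refine IsCoprime.pow_right (IsCoprime.symm ?_)
    rw [Ideal.isCoprime_iff_sup_eq]
    refine hmax.1.2 _ (lt_of_le_of_ne le_sup_left fun heq => hx ?_)
    rw [heq]
    exact Ideal.mem_sup_right (Ideal.mem_span_singleton_self x)
  obtain ⟨a, ha, b, hb, hab⟩ := Ideal.isCoprime_iff_exists.1 hco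
  obtain ⟨c, rfl⟩ := Ideal.mem_span_singleton.1 ha
  refine IsUnit.of_mul_eq_one (Ideal.Quotient.mk _ c) ?_
  rw [← map_mul, ← map_one (Ideal.Quotient.mk _), ← hab, map_add,
    Ideal.Quotient.eq_zero_iff_mem.2 hb, add_zero]

variable [IsDedekindDomain (CoordRing K q n)]

theorem length_quotient_pointPrime_pow (e : ℕ) :
    Module.length K (CoordRing K q n ⧸ (pointPrime h).asIdeal ^ e) = e := by
  obtain ⟨h1, h2⟩ := finrank_quotient_prod (k := K) {pointPrime h} fun _ => e
  rw [Finset.prod_singleton] at h1 h2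
  rw [Finset.sum_singleton, finrank_quotient_pointPrime, mul_one] at h2
  rw [Module.length_of_free_of_finite, h2]
  simp

/-- If the function defined by `H` on the curve has order `e` at `(β, γ)`, then the curve `H = 0`
intersects the curve in `(β, γ)` with multiplicity `e`: the local ring of the plane modulo the two
equations is the quotient of the coordinate ring by the `e`-th power of the maximal ideal. -/
theorem intersectionMultiplicity_eq {H : K[X][Y]} {e : ℕ}
    (hmem : AdjoinRoot.mk (equation K q n) H ∈ (pointPrime h).asIdeal ^ e)
    (hnot : AdjoinRoot.mk (equation K q n) H ∉ (pointPrime h).asIdeal ^ (e + 1)) :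
    intersectionMultiplicity (equation K q n) H (β, γ) = e := by
  set p := pointIdeal (β, γ) with hp
  set m := (pointPrime h).asIdeal with hm
  let g : K[X][Y] →+* CoordRing K q n ⧸ m ^ e :=
    (Ideal.Quotient.mk (m ^ e)).comp (AdjoinRoot.mk (equation K q n))
  have hg : ∀ y : p.primeCompl, IsUnit (g y) := fun y =>
    isUnit_mk_quotient_pow h (fun hy => y.2 ((mk_mem_pointPrime_iff h).1 hy)) e
  let φ : Localization.AtPrime p →ₐ[K] CoordRing K q n ⧸ m ^ e :=
    { IsLocalization.lift hg with
      commutes' := fun a => by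
        rw [IsScalarTower.algebraMap_apply K K[X][Y] (Localization.AtPrime p)]
        exact IsLocalization.lift_eq hg _ }
  have hφ : ∀ x, φ (algebraMap _ _ x) = g x := fun x => IsLocalization.lift_eq hg x
  have hsurj : Function.Surjective φ := by
    intro x
    obtain ⟨x, rfl⟩ := Ideal.Quotient.mk_surjective x
    obtain ⟨x, rfl⟩ := AdjoinRoot.mk_surjective x
    exact ⟨algebraMap _ _ x, hφ x⟩
  have hker : Ideal.span {algebraMap K[X][Y] (Localization.AtPrime p) (equation K q n),
      algebraMap K[X][Y] (Localization.AtPrime p) H} = RingHom.ker φ := by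
    refine le_antisymm ?_ fun x hx => ?_
    · rw [Ideal.span_le]
      rintro x (rfl | rfl)
      · change φ _ = 0
        rw [hφ]
        change Ideal.Quotient.mk _ (AdjoinRoot.mk _ _) = 0
        rw [AdjoinRoot.mk_self, map_zero]
      · change φ _ = 0
        rw [hφ]
        exact Ideal.Quotient.eq_zero_iff_mem.2 hmem
    · -- clear denominators, so that `x` becomes a polynomial `s` whose image lies in `m ^ e`
      obtain ⟨⟨s, d⟩, hsd⟩ := IsLocalization.surj p.primeCompl x
      have hs : AdjoinRoot.mk (equation K q n) s ∈ m ^ e := by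
        rw [RingHom.mem_ker] at hx
        rw [← Ideal.Quotient.eq_zero_iff_mem]
        change g s = 0
        rw [← hφ, ← hsd, map_mul, hx, zero_mul]
      -- `(h) = m ^ e J` for an ideal `J` that is not contained in `m`
      obtain ⟨J, hJ⟩ := Ideal.dvd_span_singleton.2 hmem
      have hJm : ¬ J ≤ m := fun hle => by
        refine hnot ?_
        rw [← Ideal.span_singleton_le_iff_mem, hJ, pow_succ]
        exact Ideal.mul_mono_right hle
      obtain ⟨j, hjJ, hjm⟩ := SetLike.not_le_iff_exists.1 hJm
      obtain ⟨j, rfl⟩ := AdjoinRoot.mk_surjective j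
      have hsj := Ideal.mul_mem_mul hs hjJ
      rw [← hJ, Ideal.mem_span_singleton] at hsj
      obtain ⟨t, ht⟩ := hsj
      obtain ⟨t, rfl⟩ := AdjoinRoot.mk_surjective t
      rw [← map_mul, ← map_mul, ← sub_eq_zero, ← map_sub, AdjoinRoot.mk_eq_zero] at ht
      obtain ⟨c, hc⟩ := ht
      have hu1 := IsLocalization.map_units (Localization.AtPrime p) d
      have hu2 := IsLocalization.map_units (Localization.AtPrime p)
        (⟨j, fun hj => hjm ((mk_mem_pointPrime_iff h).2 hj)⟩ : p.primeCompl)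
      rw [← Ideal.unit_mul_mem_iff_mem _ (hu1.mul hu2), Ideal.mem_span_pair]
      refine ⟨algebraMap _ _ c, algebraMap _ _ t, ?_⟩
      have hc' := congrArg (algebraMap K[X][Y] (Localization.AtPrime p)) (sub_eq_iff_eq_add.1 hc)
      rw [map_mul, map_add, map_mul, map_mul, ← hsd] at hc'
      rw [mul_comm (algebraMap _ _ c), mul_comm (algebraMap _ _ t), ← hc']
      ring
  rw [intersectionMultiplicity, localMultiplicity, hker,
    (Ideal.quotientKerAlgEquivOfSurjective hsurj).toLinearEquiv.length_eq,
    length_quotient_pointPrime_pow]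

/-- The intersection of the curve with the second curve for the solution `w = f g`. -/
theorem intersectionMultiplicity_secondCurve (h : β ^ q ^ 2 - β = γ ^ r q n) (hK : (q : K) = 0)
    (Q : K × K) :
    intersectionMultiplicity (equation K q n)
        (secondCurve q (β ^ q ^ n) (γ ^ q ^ n) (f K q n * g K q n)) Q =
      (((Finsupp.single (β, γ) (q ^ n) +
        Finsupp.single (β ^ q ^ (2 * n), γ ^ q ^ (2 * n)) 1 : K × K →₀ ℕ) Q : ℕ) : ℕ∞) := by
  classical
  have h2 := pow_pow_sub_pow hK h (2 * n)
  obtain ⟨β', γ'⟩ := Q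
  -- the points of the curve correspond to primes of the coordinate ring
  by_cases h' : β' ^ q ^ 2 - β' = γ' ^ r q n
  · have hval := valuation_mk_secondCurve h hK (pointPrime h')
    have hiff : ∀ {b c : K} (hbc : b ^ q ^ 2 - b = c ^ r q n),
        pointPrime hbc = pointPrime h' ↔ (b, c) = (β', γ') := fun hbc =>
      ⟨fun heq => Prod.ext_iff.2 (eq_of_pointPrime_eq hbc h' heq),
        fun heq => by cases heq; rfl⟩
    have hfin : (Finsupp.single (pointPrime h) (q ^ n) + Finsupp.single (pointPrime h2) 1 :
        HeightOneSpectrum (CoordRing K q n) →₀ ℕ) (pointPrime h') =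
        (Finsupp.single (β, γ) (q ^ n) +
          Finsupp.single (β ^ q ^ (2 * n), γ ^ q ^ (2 * n)) 1 : K × K →₀ ℕ) (β', γ') := by
      simp only [Finsupp.add_apply, Finsupp.single_apply, hiff]
    rw [hfin, HeightOneSpectrum.valuation_of_algebraMap] at hval
    refine intersectionMultiplicity_eq h' ?_ ?_
    · exact ((pointPrime h').intValuation_le_pow_iff_mem _ _).1 hval.le
    · rw [← (pointPrime h').intValuation_le_pow_iff_mem, hval, exp_le_exp]
      push_cast
      omega
  · have hne : ∀ {b c : K}, b ^ q ^ 2 - b = c ^ r q n → (b, c) ≠ (β', γ') := fun hbc heq => by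
      cases heq
      exact h' hbc
    rw [intersectionMultiplicity_eq_zero, Finsupp.add_apply, Finsupp.single_apply,
      Finsupp.single_apply, if_neg (hne h), if_neg (hne h2)]
    · rfl
    · intro hmem
      apply h'
      rw [pointIdeal, RingHom.mem_ker, coe_evalEvalRingHom, equation] at hmem
      simp only [evalEval_sub, evalEval_pow, evalEval_X, evalEval_C, eval_sub, eval_pow, eval_X]
        at hmem
      exact (sub_eq_zero.1 hmem).symm

end PlaneCurve

end

theorem mainTheorem3 (q n : ℕ) [Fact (IsPrimePow q)] [Fact (Odd n)]
    (k : Type*) [Field k] [Finite k] (hk : Nat.card k = q ^ (2 * n))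
    (K : Type*) [Field K] [Algebra k K] [IsAlgClosed K] :
    PlaneCurve.IsSolution q n (PlaneCurve.f K q n * PlaneCurve.g K q n) ∧
    (∀ β γ : K, β ^ q ^ 2 - β = γ ^ PlaneCurve.r q n →
      (∀ w : Polynomial K, PlaneCurve.IsSolution q n w → ∀ Q : K × K,
        intersectionMultiplicity (PlaneCurve.equation K q n)
            (PlaneCurve.secondCurve q (β ^ q ^ n) (γ ^ q ^ n) w) Q =
          (((Finsupp.single (β, γ) (q ^ n) +
            Finsupp.single (β ^ q ^ (2 * n), γ ^ q ^ (2 * n)) 1 : K × K →₀ ℕ) Q : ℕ) : ℕ∞)) ∧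
      ∃ P₁ P₂ Pinf : Place K (PlaneCurve.FunField K q n),
        (∀ P, PlaneCurve.IsAt P (β, γ) ↔ P = P₁) ∧
        (∀ P, PlaneCurve.IsAt P (β ^ q ^ (2 * n), γ ^ q ^ (2 * n)) ↔ P = P₂) ∧
        (∀ P, PlaneCurve.IsCommonPole P ↔ P = Pinf) ∧
        HasDivisor
          (PlaneCurve.toFun (PlaneCurve.secondCurve q (β ^ q ^ n) (γ ^ q ^ n)
            (PlaneCurve.f K q n * PlaneCurve.g K q n)) : PlaneCurve.FunField K q n)
          (Finsupp.single P₁ ((q : ℤ) ^ n) + Finsupp.single P₂ 1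
            - Finsupp.single Pinf ((q : ℤ) ^ n + 1)) ∧
        (β ∈ Set.range (algebraMap k K) → γ ∈ Set.range (algebraMap k K) →
          HasDivisor
            (PlaneCurve.toFun (PlaneCurve.secondCurve q (β ^ q ^ n) (γ ^ q ^ n)
              (PlaneCurve.f K q n * PlaneCurve.g K q n)) : PlaneCurve.FunField K q n)
            (((q : ℤ) ^ n + 1) • (Finsupp.single P₁ 1 - Finsupp.single Pinf 1)))) ∧
    IsMaximalCurve k (PlaneCurve.FunField k q n) := by
  have hk0 : (q : k) = 0 := PlaneCurve.natCast_eq_zero_of_natCard hk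
  have hK : (q : K) = 0 := by rw [← map_natCast (algebraMap k K), hk0, map_zero]
  have := PlaneCurve.isDedekindDomain_coordRing k q n hk0
  have := PlaneCurve.isDedekindDomain_coordRing K q n hK
  refine ⟨PlaneCurve.isSolution_f_mul_g hK, fun β γ h => ⟨fun w hw Q => ?_, ?_⟩,
    PlaneCurve.isMaximalCurve hk⟩
  · -- `f g` is the only solution
    rw [hw.eq_f_mul_g hK]
    exact PlaneCurve.intersectionMultiplicity_secondCurve h hK Q
  · have h2 := PlaneCurve.pow_pow_sub_pow hK h (2 * n)
    have hdiv := PlaneCurve.hasDivisor_secondCurve h hK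
    refine ⟨_, _, _, fun P => PlaneCurve.isAt_iff h, fun P => PlaneCurve.isAt_iff h2,
      fun P => PlaneCurve.isCommonPole_iff, hdiv, ?_⟩
    rintro ⟨b, rfl⟩ ⟨c, rfl⟩
    have hfix : ∀ a : k, algebraMap k K a ^ q ^ (2 * n) = algebraMap k K a := fun a => by
      rw [← map_pow, PlaneCurve.pow_eq_self_of_natCard hk]
    -- over `k` the point is fixed by Frobenius, so both places coincide
    have heq : PlaneCurve.pointPrime h2 = PlaneCurve.pointPrime h := by
      simp only [hfix]
    rw [heq] at hdiv
    convert hdiv using 1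
    rw [smul_sub, ← Finsupp.single_add, Finsupp.smul_single, Finsupp.smul_single, smul_eq_mul,
      mul_one]
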